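/- Let $T>0$, let $\alpha,\beta:[0,T]\to\mathbb R$ and $\zeta:[0,T]\to(0,\infty)$ be continuous, and put $$\varphi(t)=\exp\Big(\int_0^t\beta(u)\,du\Big),\quad m(t)=\varphi(t)\int_0^t\frac{\alpha(u)}{\varphi(u)}\,du,\quad h(t)=\int_0^t\frac{\zeta^2(u)}{\varphi^2(u)}\,du .$$ For $s\in[0,1]$ let $t(s)\in[0,T]$ be the unique time with $h(t(s))=s\,h(T)$, and define the gain function $$G(s,y)=a_0(s)+a_1(s)y,\qquad a_0(s)=m(t(s)),\qquad a_1(s)=\varphi(t(s))\sqrt{h(T)} .$$ Let $x_0\in\mathbb R$, let $\nu$ be a probability density on $\mathbb R$, and write $\phi(\cdot\,;\theta,\gamma^2)$ for the normal density with mean $\theta$ and variance $\gamma^2$. For $s\in[0,1)$ and $y\in\mathbb R$ let $Z_{s,y}$ be a random variable with density $$\nu_{s,y}(z)=\frac{1}{\psi(s,y)}\,\frac{\phi(z;y,1-s)}{\phi(z;x_0,1)}\,\nu(z),\qquad \psi(s,y)=\int_{\mathbb R}\frac{\phi(z;y,1-s)}{\phi(z;x_0,1)}\,\nu(z)\,dz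 .$$ Assume that for every $\varepsilon\in(0,1)$ there is a constant $L_\varepsilon>0$ with $\operatorname{Var}[Z_{s,y}]\le L_\varepsilon$ for all $(s,y)\in(0,1-\varepsilon]\times\mathbb R$. Let $Y^{s,y}=(Y^{s,y}_u)_{u\in[0,1-s]}$ be the randomized Brownian bridge started from $y$ at time $s$ (the law, from time $s$ on and given the value $y$ at time $s$, of a Brownian motion started from $x_0$ at time $0$ and conditioned to have terminal density $\nu$ at time $1$); that is, conditionally on $Z_{s,y}=z$ it is a Brownian bridge of length $1-s$ from $y$ to $z$: $$Y^{s,y}_u=y+(Z_{s,y}-y)\frac{u}{1-s}+\Big(B_u-\frac{u}{1-s}B_{1-s}\Big),$$ with $B$ a standard Brownian motion independent of $Z_{s,y}$. Define the value function $$W(s,y)=\sup_{\sigma\le 1-s}\mathbb E\big[G(s+\sigma,Y^{s,y}_\sigma)\big],$$ the supremum being over the stopping times $\sigma\le 1-s$ of the natural filtration of $Y^{s,y}$. Then $\nu_{s,y}$ is a well-defined probability density for all $(s,y)\in[0,1)\times\mathbb R$, the expectations in the definition of $W$ exist and the supremum is finite; and for every compact set $R\subset[0,1)\times\mathbb R$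 there is a constant $L_R>0$ such that $$|W(s_1,y_1)-W(s_2,y_2)|\le L_R\big(|s_1-s_2|+|y_1-y_2|\big)\qquad\text{for all }(s_1,y_1),(s_2,y_2)\in R .$$ -/

import Mathlib

open MeasureTheory ProbabilityTheory Set
open scoped NNReal

noncomputable section

namespace RandomizedBridge

/-! ### The gain function of the transformed problem

`α`, `β`, `ζ` are the coefficients of the Gauss-Markov diffusion
`dX = (α + β X) dt + ζ dB` on `[0, T]`. -/

/-- `φ(t, t') = exp ∫_t^{t'} β`. -/
def propagator (β : ℝ → ℝ) (t t' : ℝ) : ℝ := Real.exp (∫ u in t..t', β u)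

/-- `m(t) = φ(0,t) ∫_0^t α(u) / φ(0,u) du`, the mean of `X_t` when `X_0 = 0`. -/
def meanFn (α β : ℝ → ℝ) (t : ℝ) : ℝ :=
  propagator β 0 t * ∫ u in (0 : ℝ)..t, α u / propagator β 0 u

/-- The clock `h(t) = ∫_0^t ζ(u)² / φ(0,u)² du`. -/
def clock (β ζ : ℝ → ℝ) (t : ℝ) : ℝ :=
  ∫ u in (0 : ℝ)..t, ζ u ^ 2 / propagator β 0 u ^ 2

/-- The time `t ∈ [0, T]` with `h(t) = s h(T)`, for `s ∈ [0, 1]`. -/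
def clockInv (β ζ : ℝ → ℝ) (T s : ℝ) : ℝ :=
  Function.invFunOn (clock β ζ) (Icc 0 T) (s * clock β ζ T)

/-- `a₀(s) = m(t)` where `h(t) = s h(T)`. -/
def gainShift (α β ζ : ℝ → ℝ) (T s : ℝ) : ℝ := meanFn α β (clockInv β ζ T s)

/-- `a₁(s) = φ(0,t) √h(T)` where `h(t) = s h(T)`. -/
def gainSlope (β ζ : ℝ → ℝ) (T s : ℝ) : ℝ :=
  propagator β 0 (clockInv β ζ T s) * √(clock β ζ T)

/-- The gain function `G(s, y) = a₀(s) + a₁(s) y`. -/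
def gain (α β ζ : ℝ → ℝ) (T s y : ℝ) : ℝ :=
  gainShift α β ζ T s + gainSlope β ζ T s * y

/-! ### The pinning point -/

/-- `ψ(s, y) = ∫ φ(z; y, 1-s) / φ(z; x₀, 1) ν(z) dz`, with `φ(·; θ, γ²)` the normal density. -/
def psi (ν : ℝ → ℝ) (x₀ s y : ℝ) : ℝ :=
  ∫ z, gaussianPDFReal y (1 - s).toNNReal z / gaussianPDFReal x₀ 1 z * ν z

/-- The density `ν_{s,y}` of the pinning point given that the process is at `y` at time `s`. -/
def pinningDensity (ν : ℝ → ℝ) (x₀ s y z : ℝ) : ℝ :=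
  gaussianPDFReal y (1 - s).toNNReal z / gaussianPDFReal x₀ 1 z * ν z / psi ν x₀ s y

/-- The law of the pinning point `Z_{s,y}`. -/
def pinningLaw (ν : ℝ → ℝ) (x₀ s y : ℝ) : Measure ℝ :=
  volume.withDensity fun z ↦ ENNReal.ofReal (pinningDensity ν x₀ s y z)

/-- Regularity of the terminal density: for every `ε ∈ (0, 1)` the variance of `Z_{s,y}` is
bounded uniformly in `(s, y) ∈ (0, 1-ε] × ℝ`. -/
def RegularTerminalDensity (ν : ℝ → ℝ) (x₀ : ℝ) : Prop :=
  ∀ ε ∈ Ioo (0 : ℝ) 1, ∃ L : ℝ, 0 < L ∧ ∀ s ∈ Ioc (0 : ℝ) (1 - ε), ∀ y : ℝ,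
    evariance (fun z : ℝ ↦ z) (pinningLaw ν x₀ s y) ≤ ENNReal.ofReal L

/-! ### The randomized Brownian bridge and the optimal stopping problem -/

variable {Ω : Type*} [MeasurableSpace Ω]

/-- The randomized Brownian bridge started from `y` at time `s`, at elapsed time `u ∈ [0, 1-s]`:
the Brownian bridge from `y` to `z` of length `1 - s`, in which `z` is the second coordinate of
the sample point. It is considered under `bridgeMeasure` below, where `B` is a Brownian motion and
`z` is an independent random variable with law `pinningLaw ν x₀ s y`. -/
def bridge (B : ℝ≥0 → Ω → ℝ) (s y : ℝ) (u : ℝ≥0) (ω : Ω × ℝ) : ℝ :=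
  y + (ω.2 - y) * (u / (1 - s)) + (B u ω.1 - u / (1 - s) * B (1 - s).toNNReal ω.1)

/-- The probability measure under which `bridge B s y` is the randomized Brownian bridge. -/
def bridgeMeasure (P : Measure Ω) (ν : ℝ → ℝ) (x₀ s y : ℝ) : Measure (Ω × ℝ) :=
  P.prod (pinningLaw ν x₀ s y)

theorem stronglyMeasurable_bridge {B : ℝ≥0 → Ω → ℝ} (hB : ∀ u, Measurable (B u)) (s y : ℝ)
    (u : ℝ≥0) : StronglyMeasurable (bridge B s y u) := by
  have h1 : Measurable fun ω : Ω × ℝ ↦ B u ω.1 := (hB u).comp measurable_fst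
  have h2 : Measurable fun ω : Ω × ℝ ↦ B (1 - s).toNNReal ω.1 := (hB _).comp measurable_fst
  unfold bridge
  exact Measurable.stronglyMeasurable (by fun_prop)

/-- `σ` is a stopping time of the process `bridge B s y` (that is, of its natural filtration, which
does not reveal the pinning point) with `σ ≤ 1 - s`. -/
def IsAdmissible {B : ℝ≥0 → Ω → ℝ} (hB : ∀ u, Measurable (B u)) (s y : ℝ)
    (σ : Ω × ℝ → WithTop ℝ≥0) : Prop :=
  IsStoppingTime (Filtration.natural (bridge B s y) (stronglyMeasurable_bridge hB s y)) σ ∧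
    ∀ ω, σ ω ≤ ((1 - s).toNNReal : WithTop ℝ≥0)

/-- The random payoff `G(s + σ, Y_{s+σ})`. -/
def payoff (α β ζ : ℝ → ℝ) (T : ℝ) (B : ℝ≥0 → Ω → ℝ) (s y : ℝ) (σ : Ω × ℝ → WithTop ℝ≥0) :
    Ω × ℝ → ℝ :=
  stoppedValue (fun (u : ℝ≥0) ω ↦ gain α β ζ T (s + u) (bridge B s y u ω)) σ

/-- The set of expected payoffs over all admissible stopping times. -/
def expectedPayoffs (α β ζ : ℝ → ℝ) (T : ℝ) (ν : ℝ → ℝ) (x₀ : ℝ) (P : Measure Ω)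
    {B : ℝ≥0 → Ω → ℝ} (hB : ∀ u, Measurable (B u)) (s y : ℝ) : Set ℝ :=
  {e | ∃ σ : Ω × ℝ → WithTop ℝ≥0, IsAdmissible hB s y σ ∧
    e = ∫ ω, payoff α β ζ T B s y σ ω ∂(bridgeMeasure P ν x₀ s y)}

/-- The value function `W(s, y) = sup_{σ ≤ 1-s} E[G(s + σ, Y_{s+σ})]`. -/
def value (α β ζ : ℝ → ℝ) (T : ℝ) (ν : ℝ → ℝ) (x₀ : ℝ) (P : Measure Ω)
    {B : ℝ≥0 → Ω → ℝ} (hB : ∀ u, Measurable (B u)) (s y : ℝ) : ℝ :=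
  sSup (expectedPayoffs α β ζ T ν x₀ P hB s y)

end RandomizedBridge

end

/-!
The value function is compared at two starting points by transferring stopping rules from one to
the other, so the proof puts all the randomized bridges on one sample space.

**Common observations.** Let `d` be half the distance of the compact set `R` from time `1`, and
split the interval `[s, 1]` into a head of length `l = 1 - s - d ≥ d` and a tail of length `d`.
After rescaling the head to `[0, 1]`, the bridge from `(s, y)` is determined by four ingredients: a
standard bridge on the head, a bridge on the tail, the rescaled displacement `w` over the head and
the pinning point `z`. What is observed up to the canonical time `v` depends on these ingredients
only (`canonObs`), not on `(s, y)`, and it generates the filtration of the bridge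
(`natural_bridge_eq_comap`). Hence a stopping rule for the canonical observations gives an
admissible stopping time for every starting point (`IsGridRule.isAdmissible`), and every admissible
stopping time is, up to discretization, of this form (`exists_isGridRule_of_isAdmissible`).

**Smooth dependence of the law.** Under the bridge measure, the two bridges are independent of each
other and of `(w, z)` and their law does not depend on `(s, y)`, whereas `(w, z)` has a density
proportional to `exp (jointExponent x₀ l d y (w, z))` with respect to Lebesgue measure times `ν`
(`map_canonMap_eq`). The tail of length `d` keeps this density from degenerating: it is a smooth
function of the starting point, with a logarithmic derivative of polynomial growth. The payoff of a
fixed rule is Lipschitz in the starting point as well, because the coefficients `a₀` and `a₁` are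
(`exists_gainBound`), so the expected payoffs have a common Lipschitz constant
(`exists_lipschitz_expectedRulePayoff`), which passes to the supremum (`value_le_value_add`).

**Integrability.** All of this needs exponential moments of `ν`, and they are what the variance
bound provides: for a fixed small `s` the laws of `Z_{s,y}` are the exponential tilts of `ν` damped
by a Gaussian factor `exp (-r z² / 2)`, so the variance bound bounds the second derivative of the
cumulant generating function uniformly, and the resulting Gaussian bound survives the limit `s → 0`
in which the damping disappears (`integrable_exp_mul_terminalLaw`). The running maximum of Brownian
motion is integrable by Doob's inequality (`exists_integrable_runningMax`).
-/

/-! ### Regularity of the gain function -/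

namespace RandomizedBridge

theorem contDiff_one_integral_of_continuous {f : ℝ → ℝ} (hf : Continuous f) :
    ContDiff ℝ 1 fun t ↦ ∫ u in (0 : ℝ)..t, f u := by
  have h (t : ℝ) : HasDerivAt (fun t ↦ ∫ u in (0 : ℝ)..t, f u) (f t) t :=
    intervalIntegral.integral_hasDerivAt_right (hf.intervalIntegrable _ _)
      hf.stronglyMeasurable.stronglyMeasurableAtFilter hf.continuousAt
  rw [contDiff_one_iff_deriv]
  refine ⟨fun t ↦ (h t).differentiableAt, ?_⟩
  rwa [show deriv (fun t ↦ ∫ u in (0 : ℝ)..t, f u) = f from funext fun t ↦ (h t).deriv]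

theorem exists_bound_lipschitz_of_contDiff {f : ℝ → ℝ} (hf : ContDiff ℝ 1 f) (T : ℝ) :
    ∃ A : ℝ, 0 ≤ A ∧ (∀ t ∈ Icc 0 T, |f t| ≤ A) ∧
      ∀ t ∈ Icc 0 T, ∀ t' ∈ Icc 0 T, |f t - f t'| ≤ A * |t - t'| := by
  obtain ⟨A₁, h₁⟩ := isCompact_Icc.exists_bound_of_continuousOn (s := Icc 0 T)
    hf.continuous.continuousOn
  obtain ⟨A₂, h₂⟩ := isCompact_Icc.exists_bound_of_continuousOn (s := Icc 0 T)
    (hf.continuous_deriv le_rfl).continuousOn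
  refine ⟨max 0 (max A₁ A₂), le_max_left _ _, fun t ht ↦ ?_, fun t ht t' ht' ↦ ?_⟩
  · exact (h₁ t ht).trans (by simp)
  · exact (convex_Icc (0 : ℝ) T).norm_image_sub_le_of_norm_deriv_le
      (fun x _ ↦ (hf.differentiable one_ne_zero) x)
      (fun x hx ↦ (h₂ x hx).trans (by simp)) ht' ht

/-- The continuous extension of `f` from `[0, T]` to the line, constant outside `[0, T]`. -/
def clampExtend (T : ℝ) (f : ℝ → ℝ) (t : ℝ) : ℝ := f (max 0 (min T t))

theorem continuous_clampExtend {T : ℝ} (hT : 0 ≤ T) {f : ℝ → ℝ} (hf : ContinuousOn f (Icc 0 T)) :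
    Continuous (clampExtend T f) :=
  hf.comp_continuous (by fun_prop) fun t ↦ ⟨le_max_left _ _, max_le hT (min_le_left _ _)⟩

theorem clampExtend_of_mem {T t : ℝ} (f : ℝ → ℝ) (ht : t ∈ Icc 0 T) : clampExtend T f t = f t := by
  simp [clampExtend, ht.1, ht.2]

theorem propagator_clampExtend {T t : ℝ} (β : ℝ → ℝ) (ht : t ∈ Icc 0 T) :
    propagator (clampExtend T β) 0 t = propagator β 0 t := by
  unfold propagator
  congr 1
  refine intervalIntegral.integral_congr fun u hu ↦ clampExtend_of_mem _ ?_
  rw [uIcc_of_le ht.1] at hu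
  exact ⟨hu.1, hu.2.trans ht.2⟩

theorem meanFn_clampExtend {T t : ℝ} (α β : ℝ → ℝ) (ht : t ∈ Icc 0 T) :
    meanFn (clampExtend T α) (clampExtend T β) t = meanFn α β t := by
  unfold meanFn
  rw [propagator_clampExtend β ht]
  congr 1
  refine intervalIntegral.integral_congr fun u hu ↦ ?_
  rw [uIcc_of_le ht.1] at hu
  have hu' : u ∈ Icc 0 T := ⟨hu.1, hu.2.trans ht.2⟩
  simp only [propagator_clampExtend β hu', clampExtend_of_mem α hu']

theorem clock_clampExtend {T t : ℝ} (β ζ : ℝ → ℝ) (ht : t ∈ Icc 0 T) :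
    clock (clampExtend T β) (clampExtend T ζ) t = clock β ζ t := by
  unfold clock
  refine intervalIntegral.integral_congr fun u hu ↦ ?_
  rw [uIcc_of_le ht.1] at hu
  have hu' : u ∈ Icc 0 T := ⟨hu.1, hu.2.trans ht.2⟩
  simp only [propagator_clampExtend β hu', clampExtend_of_mem ζ hu']

theorem propagator_pos (β : ℝ → ℝ) (t t' : ℝ) : 0 < propagator β t t' := Real.exp_pos _

theorem contDiff_propagator {β : ℝ → ℝ} (hβ : Continuous β) : ContDiff ℝ 1 (propagator β 0) :=
  (contDiff_one_integral_of_continuous hβ).exp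

theorem contDiff_meanFn {α β : ℝ → ℝ} (hα : Continuous α) (hβ : Continuous β) :
    ContDiff ℝ 1 (meanFn α β) :=
  (contDiff_propagator hβ).mul (contDiff_one_integral_of_continuous
    (hα.div₀ (contDiff_propagator hβ).continuous fun t ↦ (propagator_pos β 0 t).ne'))

/-- The clock increases at least linearly, so that its inverse is Lipschitz continuous. -/
theorem exists_mul_le_clock_sub {T : ℝ} (hT : 0 < T) {β ζ : ℝ → ℝ}
    (hβ : ContinuousOn β (Icc 0 T)) (hζ : ContinuousOn ζ (Icc 0 T))
    (hζ_pos : ∀ t ∈ Icc 0 T, 0 < ζ t) :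
    ContinuousOn (clock β ζ) (Icc 0 T) ∧ ∃ c : ℝ, 0 < c ∧ ∀ t ∈ Icc 0 T, ∀ t' ∈ Icc 0 T, t ≤ t' →
      c * (t' - t) ≤ clock β ζ t' - clock β ζ t := by
  have hβ' := continuous_clampExtend hT.le hβ
  have hζ' := continuous_clampExtend hT.le hζ
  set f : ℝ → ℝ := fun u ↦ clampExtend T ζ u ^ 2 / propagator (clampExtend T β) 0 u ^ 2 with hf
  have hfc : Continuous f := (hζ'.pow 2).div₀ ((contDiff_propagator hβ').continuous.pow 2)
    fun t ↦ (pow_pos (propagator_pos _ 0 t) 2).ne'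
  have hclock : EqOn (clock β ζ) (fun t ↦ ∫ u in (0 : ℝ)..t, f u) (Icc 0 T) := fun t ht ↦
    (clock_clampExtend β ζ ht).symm
  refine ⟨(contDiff_one_integral_of_continuous hfc).continuous.continuousOn.congr hclock, ?_⟩
  obtain ⟨t₀, ht₀, hmin⟩ := isCompact_Icc.exists_isMinOn (nonempty_Icc.2 hT.le)
    (hfc.continuousOn (s := Icc 0 T))
  have hpos : 0 < f t₀ := by
    have h := hζ_pos t₀ ht₀
    rw [← clampExtend_of_mem ζ ht₀] at h
    exact div_pos (pow_pos h 2) (pow_pos (propagator_pos _ 0 t₀) 2)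
  refine ⟨f t₀, hpos, fun t ht t' ht' htt' ↦ ?_⟩
  rw [hclock ht, hclock ht']
  simp only
  rw [intervalIntegral.integral_interval_sub_left (hfc.intervalIntegrable _ _)
    (hfc.intervalIntegrable _ _)]
  calc f t₀ * (t' - t) = ∫ _ in t..t', f t₀ := by simp [mul_comm]
    _ ≤ ∫ u in t..t', f u := intervalIntegral.integral_mono_on htt' (by simp)
        (hfc.intervalIntegrable _ _) fun u hu ↦ hmin ⟨ht.1.trans hu.1, hu.2.trans ht'.2⟩

theorem clockInv_mem_and_clock_eq {T : ℝ} (hT : 0 < T) {β ζ : ℝ → ℝ}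
    (hβ : ContinuousOn β (Icc 0 T)) (hζ : ContinuousOn ζ (Icc 0 T))
    (hζ_pos : ∀ t ∈ Icc 0 T, 0 < ζ t) {s : ℝ} (hs : s ∈ Icc (0 : ℝ) 1) :
    clockInv β ζ T s ∈ Icc 0 T ∧ clock β ζ (clockInv β ζ T s) = s * clock β ζ T := by
  obtain ⟨hc, c, hc0, hle⟩ := exists_mul_le_clock_sub hT hβ hζ hζ_pos
  have h0 : clock β ζ 0 = 0 := by simp [clock]
  have hTpos : 0 ≤ clock β ζ T := by
    have := hle 0 ⟨le_rfl, hT.le⟩ T ⟨hT.le, le_rfl⟩ hT.le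
    rw [h0] at this
    nlinarith
  have hmem : s * clock β ζ T ∈ clock β ζ '' Icc 0 T := by
    refine intermediate_value_Icc hT.le hc ⟨?_, ?_⟩
    · rw [h0]; exact mul_nonneg hs.1 hTpos
    · exact mul_le_of_le_one_left hTpos hs.2
  exact ⟨Function.invFunOn_mem hmem, Function.invFunOn_eq hmem⟩

theorem exists_lipschitz_clockInv {T : ℝ} (hT : 0 < T) {β ζ : ℝ → ℝ}
    (hβ : ContinuousOn β (Icc 0 T)) (hζ : ContinuousOn ζ (Icc 0 T))
    (hζ_pos : ∀ t ∈ Icc 0 T, 0 < ζ t) :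
    ∃ A : ℝ, 0 ≤ A ∧ ∀ s ∈ Icc (0 : ℝ) 1, ∀ s' ∈ Icc (0 : ℝ) 1,
      |clockInv β ζ T s - clockInv β ζ T s'| ≤ A * |s - s'| := by
  obtain ⟨-, c, hc0, hle⟩ := exists_mul_le_clock_sub hT hβ hζ hζ_pos
  have hexp : ∀ t ∈ Icc 0 T, ∀ t' ∈ Icc 0 T,
      c * |t - t'| ≤ |clock β ζ t - clock β ζ t'| := by
    intro t ht t' ht'
    rcases le_total t t' with h | h
    · rw [abs_sub_comm t, abs_sub_comm (clock β ζ t), abs_of_nonneg (sub_nonneg.2 h)]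
      exact (hle t ht t' ht' h).trans (le_abs_self _)
    · rw [abs_of_nonneg (sub_nonneg.2 h)]
      exact (hle t' ht' t ht h).trans (le_abs_self _)
  refine ⟨|clock β ζ T| / c, by positivity, fun s hs s' hs' ↦ ?_⟩
  obtain ⟨h₁, h₂⟩ := clockInv_mem_and_clock_eq hT hβ hζ hζ_pos hs
  obtain ⟨h₁', h₂'⟩ := clockInv_mem_and_clock_eq hT hβ hζ hζ_pos hs'
  have := hexp _ h₁ _ h₁'
  rw [h₂, h₂', ← sub_mul, abs_mul] at this
  rw [div_mul_eq_mul_div, le_div_iff₀ hc0]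
  linarith

/-- A common bound and Lipschitz constant of the two coefficients of the gain function. -/
structure GainBound (a₀ a₁ : ℝ → ℝ) (A : ℝ) : Prop where
  pos : 0 < A
  shift_le : ∀ s ∈ Icc (0 : ℝ) 1, |a₀ s| ≤ A
  slope_le : ∀ s ∈ Icc (0 : ℝ) 1, |a₁ s| ≤ A
  shift_lip : ∀ s ∈ Icc (0 : ℝ) 1, ∀ s' ∈ Icc (0 : ℝ) 1, |a₀ s - a₀ s'| ≤ A * |s - s'|
  slope_lip : ∀ s ∈ Icc (0 : ℝ) 1, ∀ s' ∈ Icc (0 : ℝ) 1, |a₁ s - a₁ s'| ≤ A * |s - s'|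

theorem exists_gainBound {T : ℝ} (hT : 0 < T) {α β ζ : ℝ → ℝ} (hα : ContinuousOn α (Icc 0 T))
    (hβ : ContinuousOn β (Icc 0 T)) (hζ : ContinuousOn ζ (Icc 0 T))
    (hζ_pos : ∀ t ∈ Icc 0 T, 0 < ζ t) :
    ∃ A, GainBound (gainShift α β ζ T) (gainSlope β ζ T) A := by
  have hα' := continuous_clampExtend hT.le hα
  have hβ' := continuous_clampExtend hT.le hβ
  obtain ⟨C, hC0, hC⟩ := exists_lipschitz_clockInv hT hβ hζ hζ_pos
  obtain ⟨A₀, hA₀, hb₀, hl₀⟩ := exists_bound_lipschitz_of_contDiff (contDiff_meanFn hα' hβ') T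
  obtain ⟨A₁, hA₁, hb₁, hl₁⟩ := exists_bound_lipschitz_of_contDiff
    ((contDiff_propagator hβ').mul contDiff_const (g := fun _ ↦ √(clock β ζ T))) T
  have hmem := fun s (hs : s ∈ Icc (0 : ℝ) 1) ↦
    (clockInv_mem_and_clock_eq hT hβ hζ hζ_pos hs).1
  have e₀ : ∀ s ∈ Icc (0 : ℝ) 1, gainShift α β ζ T s =
      meanFn (clampExtend T α) (clampExtend T β) (clockInv β ζ T s) := fun s hs ↦
    (meanFn_clampExtend α β (hmem s hs)).symm
  have e₁ : ∀ s ∈ Icc (0 : ℝ) 1, gainSlope β ζ T s =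
      propagator (clampExtend T β) 0 (clockInv β ζ T s) * √(clock β ζ T) := fun s hs ↦ by
    rw [propagator_clampExtend β (hmem s hs)]; rfl
  have aux : ∀ a, 0 ≤ a → a ≤ A₀ + A₁ → a * C ≤ (A₀ + A₁) * (C + 1) + 1 ∧
      a ≤ (A₀ + A₁) * (C + 1) + 1 := fun a ha h ↦ ⟨by nlinarith, by nlinarith⟩
  have a0 := aux A₀ hA₀ (by linarith)
  have a1 := aux A₁ hA₁ (by linarith)
  refine ⟨(A₀ + A₁) * (C + 1) + 1, by positivity, fun s hs ↦ ?_, fun s hs ↦ ?_,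
    fun s hs s' hs' ↦ ?_, fun s hs s' hs' ↦ ?_⟩
  · rw [e₀ s hs]; exact (hb₀ _ (hmem s hs)).trans a0.2
  · rw [e₁ s hs]; exact (hb₁ _ (hmem s hs)).trans a1.2
  · rw [e₀ s hs, e₀ s' hs']
    calc _ ≤ A₀ * (C * |s - s'|) :=
          (hl₀ _ (hmem s hs) _ (hmem s' hs')).trans (by gcongr; exact hC s hs s' hs')
      _ ≤ _ := by rw [← mul_assoc]; gcongr; exact a0.1
  · rw [e₁ s hs, e₁ s' hs']
    calc _ ≤ A₁ * (C * |s - s'|) :=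
          (hl₁ _ (hmem s hs) _ (hmem s' hs')).trans (by gcongr; exact hC s hs s' hs')
      _ ≤ _ := by rw [← mul_assoc]; gcongr; exact a1.1

end RandomizedBridge

/-! ### Exponential moments of the terminal density -/

namespace RandomizedBridge

/-- The terminal law, that is, the probability measure with density `ν`. -/
noncomputable def terminalLaw (ν : ℝ → ℝ) : Measure ℝ :=
  volume.withDensity fun z ↦ ENNReal.ofReal (ν z)

theorem isProbabilityMeasure_terminalLaw {ν : ℝ → ℝ}
    (hν_one : ∫⁻ z, ENNReal.ofReal (ν z) = 1) : IsProbabilityMeasure (terminalLaw ν) :=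
  ⟨by simp [terminalLaw, hν_one]⟩

/-- The exponent of the likelihood ratio `φ(z; y, 1-s) / φ(z; x₀, 1)`. -/
noncomputable def pinExponent (x₀ s y z : ℝ) : ℝ :=
  (z - x₀) ^ 2 / 2 - (z - y) ^ 2 / (2 * (1 - s))

@[fun_prop]
theorem continuous_pinExponent (x₀ s y : ℝ) : Continuous (pinExponent x₀ s y) := by
  unfold pinExponent
  fun_prop

theorem exists_gaussianPDFReal_div_eq (x₀ : ℝ) {s : ℝ} (hs : s < 1) :
    ∃ k : ℝ, 0 < k ∧ ∀ y z, gaussianPDFReal y (1 - s).toNNReal z / gaussianPDFReal x₀ 1 z =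
      k * Real.exp (pinExponent x₀ s y z) := by
  have hs' : 0 < 1 - s := by linarith
  refine ⟨(√(2 * Real.pi * (1 - s)))⁻¹ / (√(2 * Real.pi * 1))⁻¹, by positivity, fun y z ↦ ?_⟩
  have e : pinExponent x₀ s y z = -(z - y) ^ 2 / (2 * (1 - s)) - -(z - x₀) ^ 2 / (2 * 1) := by
    unfold pinExponent; ring
  simp only [gaussianPDFReal_def, Real.coe_toNNReal _ hs'.le, NNReal.coe_one]
  rw [e, Real.exp_sub, mul_div_mul_comm]

/-- The law of the pinning point is an exponential tilt of the terminal law. -/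
theorem pinningLaw_eq_tilted {ν : ℝ → ℝ} (hν_meas : Measurable ν) (hν_nonneg : ∀ z, 0 ≤ ν z)
    (x₀ : ℝ) {s : ℝ} (hs : s < 1) (y : ℝ) :
    pinningLaw ν x₀ s y = (terminalLaw ν).tilted (pinExponent x₀ s y) := by
  obtain ⟨k, hk, hpdf⟩ := exists_gaussianPDFReal_div_eq x₀ hs
  have hint : ∫ z, Real.exp (pinExponent x₀ s y z) ∂terminalLaw ν =
      ∫ z, Real.exp (pinExponent x₀ s y z) * ν z := by
    rw [terminalLaw, integral_withDensity_eq_integral_toReal_smul (by fun_prop) (by simp)]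
    refine integral_congr_ae (.of_forall fun z ↦ ?_)
    simp [ENNReal.toReal_ofReal (hν_nonneg z), mul_comm]
  rw [pinningLaw, Measure.tilted, terminalLaw,
    ← withDensity_mul _ (by fun_prop) (by fun_prop)]
  congr 1
  funext z
  rw [Pi.mul_apply, ← ENNReal.ofReal_mul (hν_nonneg z)]
  congr 1
  have hpsi : psi ν x₀ s y = k * ∫ z, Real.exp (pinExponent x₀ s y z) * ν z := by
    unfold psi
    simp_rw [hpdf, mul_assoc]
    exact integral_const_mul _ _
  rw [pinningDensity, hpdf, hpsi, ← hint, terminalLaw, mul_assoc,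
    mul_div_mul_left _ _ hk.ne']
  ring

/-- A random variable whose variance is at most `L` under all its exponential tilts is
sub-Gaussian about its mean: the variance of the tilts is the second derivative of the cumulant
generating function. -/
theorem mgf_le_of_variance_tilted_le {Ω : Type*} [MeasurableSpace Ω] {p : Measure Ω}
    [IsProbabilityMeasure p] {X : Ω → ℝ} (hX : ∀ t, Integrable (fun ω ↦ Real.exp (t * X ω)) p)
    {L : ℝ} (hL : ∀ t, variance X (p.tilted fun ω ↦ t * X ω) ≤ L) {t : ℝ} (ht : 0 < t) :
    ∫ ω, Real.exp (t * X ω) ∂p ≤ Real.exp (t * ∫ ω, X ω ∂p + L * t ^ 2 / 2) := by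
  set m := ∫ ω, X ω ∂p with hm
  set X' : Ω → ℝ := fun ω ↦ X ω - m with hX'
  have hexp' : ∀ t, Integrable (fun ω ↦ Real.exp (t * X' ω)) p := fun t ↦ by
    simp_rw [hX', mul_sub, Real.exp_sub]
    exact (hX t).div_const _
  have huniv : integrableExpSet X' p = univ := eq_univ_of_forall hexp'
  have hmem : ∀ t, t ∈ interior (integrableExpSet X' p) := by simp [huniv]
  have hXint : Integrable X p := by
    have : (0 : ℝ) ∈ interior (integrableExpSet X p) := by
      rw [show integrableExpSet X p = univ from eq_univ_of_forall hX]; simp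
    exact integrable_of_mem_interior_integrableExpSet this
  have hmean : ∫ ω, X' ω ∂p = 0 := by
    rw [hX', integral_sub hXint (integrable_const _)]; simp [hm]
  obtain ⟨u, -, hu⟩ := exists_cgf_eq_iteratedDeriv_two_cgf_mul ht hmean fun t _ ↦ hmem t
  have htilt : (p.tilted fun ω ↦ u * X' ω) = p.tilted fun ω ↦ u * X ω := by
    have := tilted_tilted (hX u) (fun _ ↦ -(u * m))
    have hp := isProbabilityMeasure_tilted (hX u)
    rw [tilted_const] at this
    rw [this]
    congr 1
    funext ω
    simp only [hX', Pi.add_apply]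
    ring
  have hvar : iteratedDeriv 2 (cgf X' p) u ≤ L := by
    rw [← variance_tilted_mul (hmem u), htilt]
    have hp := isProbabilityMeasure_tilted (hX u)
    rw [hX', variance_sub_const]
    · exact hL u
    · exact hXint.aestronglyMeasurable.mono_ac (tilted_absolutelyContinuous _ _)
  have hmgf : mgf X' p t ≤ Real.exp (L * t ^ 2 / 2) := by
    rw [← exp_cgf (hexp' t), Real.exp_le_exp, hu]
    gcongr
  have hsplit : ∫ ω, Real.exp (t * X ω) ∂p = Real.exp (t * m) * mgf X' p t := by
    rw [mgf, ← integral_const_mul]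
    refine integral_congr_ae (.of_forall fun ω ↦ ?_)
    simp only [hX', ← Real.exp_add]
    congr 1
    ring
  rw [hsplit, Real.exp_add]
  gcongr

/-- The mean of a square integrable random variable is controlled by its variance together with
the mass that it puts on a bounded interval. -/
theorem abs_integral_le_of_mass {p : Measure ℝ} [IsProbabilityMeasure p]
    (hp : MemLp (fun z : ℝ ↦ z) 2 p) {A c L : ℝ} (hc : 0 < c) (hL : 0 < L)
    (hmass : ENNReal.ofReal c ≤ p (Icc (-A) A)) (hvar : variance (fun z : ℝ ↦ z) p ≤ L) :
    |∫ z, z ∂p| ≤ A + √(2 * L / c) := by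
  by_contra! hcon
  set m := ∫ z, z ∂p
  have hx : 0 < √(2 * L / c) := by positivity
  have hsub : Icc (-A) A ⊆ {z : ℝ | √(2 * L / c) ≤ |z - m|} := by
    intro z hz
    have h1 := abs_sub_abs_le_abs_sub m z
    have h2 : |z| ≤ A := abs_le.2 ⟨hz.1, hz.2⟩
    rw [abs_sub_comm] at h1
    have h3 : √(2 * L / c) ≤ |z - m| := by linarith
    exact h3
  have h := hmass.trans ((measure_mono hsub).trans (meas_ge_le_variance_div_sq hp hx))
  have hle : variance (fun z : ℝ ↦ z) p / √(2 * L / c) ^ 2 ≤ c / 2 := by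
    rw [Real.sq_sqrt (by positivity), div_le_iff₀ (by positivity)]
    calc _ ≤ L := hvar
      _ = _ := by field_simp
  have := (ENNReal.ofReal_le_ofReal_iff (by positivity)).1
    (h.trans (ENNReal.ofReal_le_ofReal hle))
  linarith

theorem integrable_exp_damped {p : Measure ℝ} [IsFiniteMeasure p] {r : ℝ} (hr : 0 < r) (t : ℝ) :
    Integrable (fun z : ℝ ↦ Real.exp (t * z - r * z ^ 2 / 2)) p := by
  refine .of_bound (by fun_prop) (Real.exp (t ^ 2 / (2 * r))) (.of_forall fun z ↦ ?_)
  rw [Real.norm_of_nonneg (Real.exp_pos _).le, Real.exp_le_exp, le_div_iff₀ (by positivity)]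
  nlinarith [sq_nonneg (t - r * z)]

theorem tilted_add_const {α : Type*} [MeasurableSpace α] {μ : Measure α} [NeZero μ] {f : α → ℝ}
    (hf : Integrable (fun x ↦ Real.exp (f x)) μ) (c : ℝ) :
    μ.tilted (fun x ↦ f x + c) = μ.tilted f := by
  have hp := isProbabilityMeasure_tilted hf
  rw [← tilted_const (μ.tilted f) c, tilted_tilted hf]
  rfl

theorem exists_half_le_measure_Icc (p : Measure ℝ) [IsProbabilityMeasure p] :
    ∃ A : ℝ, 0 ≤ A ∧ 1 / 2 ≤ p (Icc (-A) A) := by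
  have hmono : Monotone fun n : ℕ ↦ Icc (-(n : ℝ)) n := fun m n h ↦
    Icc_subset_Icc (by simpa using h) (by simpa using h)
  have hlim := tendsto_measure_iUnion_atTop (μ := p) hmono
  have hU : ⋃ n : ℕ, Icc (-(n : ℝ)) n = univ := by
    refine eq_univ_of_forall fun z ↦ mem_iUnion.2 ?_
    obtain ⟨n, hn⟩ := exists_nat_ge |z|
    exact ⟨n, (abs_le.1 hn).1, (abs_le.1 hn).2⟩
  rw [hU, measure_univ] at hlim
  obtain ⟨n, hn⟩ := (hlim.eventually (lt_mem_nhds (by simp : (1 / 2 : ENNReal) < 1))).exists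
  exact ⟨n, by positivity, hn.le⟩

theorem pinExponent_eq_damped (x₀ : ℝ) {s : ℝ} (hs : s < 1) (t z : ℝ) :
    pinExponent x₀ s ((1 - s) * (x₀ + t)) z =
      t * z - s / (1 - s) * z ^ 2 / 2 + (x₀ ^ 2 / 2 - (1 - s) * (x₀ + t) ^ 2 / 2) := by
  have : 1 - s ≠ 0 := by linarith
  unfold pinExponent
  field_simp
  ring

/-- The terminal law has all exponential moments. For small `s > 0` the laws of the pinning points
`Z_{s,y}` are the exponential tilts of the terminal law damped by `exp (-r z² / 2)`, where
`r = s / (1 - s)`; as their variances are bounded uniformly in `s` and `y`, the exponential moments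
of the damped laws are bounded uniformly in `r`, and `r` can be sent to zero. -/
theorem integrable_exp_mul_terminalLaw {ν : ℝ → ℝ} {x₀ : ℝ} (hν_meas : Measurable ν)
    (hν_nonneg : ∀ z, 0 ≤ ν z) (hν_one : ∫⁻ z, ENNReal.ofReal (ν z) = 1)
    (hν_reg : RegularTerminalDensity ν x₀) (t : ℝ) :
    Integrable (fun z : ℝ ↦ Real.exp (t * z)) (terminalLaw ν) := by
  have hν := isProbabilityMeasure_terminalLaw hν_one
  obtain ⟨A, hA0, hA⟩ := exists_half_le_measure_Icc (terminalLaw ν)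
  obtain ⟨L, hL0, hL⟩ := hν_reg (1 / 2) (by norm_num)
  set c : ℝ := Real.exp (-(A ^ 2 / 2)) / 2 with hc
  set M : ℝ := A + √(2 * L / c) with hM
  have key : ∀ s : ℝ, 0 < s → s ≤ 1 / 2 →
      ∫ z, Real.exp (t * z - s / (1 - s) * z ^ 2 / 2) ∂terminalLaw ν ≤
        Real.exp (|t| * M + L * t ^ 2 / 2) := by
    intro s hs hs2
    set r := s / (1 - s) with hr
    have hr0 : 0 < r := div_pos hs (by linarith)
    have hr1 : r ≤ 1 := (div_le_one (by linarith)).2 (by linarith)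
    have hint := fun t ↦ integrable_exp_damped (p := terminalLaw ν) hr0 t
    have hint0 : Integrable (fun z : ℝ ↦ Real.exp (-(r * z ^ 2 / 2))) (terminalLaw ν) := by
      simpa using hint 0
    set p := (terminalLaw ν).tilted fun z ↦ -(r * z ^ 2 / 2) with hp
    have hprob : IsProbabilityMeasure p := isProbabilityMeasure_tilted hint0
    have htilt (u : ℝ) : p.tilted (fun z ↦ u * z) =
        pinningLaw ν x₀ s ((1 - s) * (x₀ + u)) := by
      rw [hp, tilted_tilted hint0, pinningLaw_eq_tilted hν_meas hν_nonneg x₀ (by linarith)]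
      simp_rw [show pinExponent x₀ s ((1 - s) * (x₀ + u)) = fun z ↦ (u * z - r * z ^ 2 / 2) + _ from
        funext fun z ↦ pinExponent_eq_damped x₀ (by linarith) u z]
      rw [tilted_add_const (hint u)]
      congr 1
      funext z
      simp only [Pi.add_apply]
      ring
    have hexp (u : ℝ) : Integrable (fun z ↦ Real.exp (u * z)) p := by
      rw [hp, integrable_tilted_iff hint0]
      refine (hint u).congr (.of_forall fun z ↦ ?_)
      simp only [smul_eq_mul, ← Real.exp_add]
      congr 1
      ring
    have hvar (u : ℝ) : variance (fun z ↦ z) (p.tilted fun z ↦ u * z) ≤ L := by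
      rw [htilt]
      exact ENNReal.toReal_le_of_le_ofReal hL0.le (hL s ⟨hs, by linarith⟩ _)
    have hmem : ∀ u, u ∈ interior (integrableExpSet (fun z ↦ z) p) := by
      rw [show integrableExpSet (fun z ↦ z) p = univ from eq_univ_of_forall hexp]; simp
    have hL2 : MemLp (fun z : ℝ ↦ z) 2 p := by
      simpa using memLp_of_mem_interior_integrableExpSet (hmem 0) 2
    have hnorm : ∫ z, Real.exp (-(r * z ^ 2 / 2)) ∂terminalLaw ν ≤ 1 := by
      calc _ ≤ ∫ _, (1 : ℝ) ∂terminalLaw ν :=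
            integral_mono hint0 (integrable_const _) fun z ↦ by
              simp only [Real.exp_le_one_iff, Left.neg_nonpos_iff]; positivity
        _ = 1 := by simp
    have hnorm0 : 0 < ∫ z, Real.exp (-(r * z ^ 2 / 2)) ∂terminalLaw ν := integral_exp_pos hint0
    have hmass : ENNReal.ofReal c ≤ p (Icc (-A) A) := by
      calc ENNReal.ofReal c = ENNReal.ofReal (Real.exp (-(A ^ 2 / 2))) * (1 / 2) := by
            rw [hc, ENNReal.ofReal_div_of_pos (by norm_num)]
            simp [div_eq_mul_inv]
        _ ≤ ENNReal.ofReal (Real.exp (-(A ^ 2 / 2))) * terminalLaw ν (Icc (-A) A) := by gcongr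
        _ = ∫⁻ _ in Icc (-A) A, ENNReal.ofReal (Real.exp (-(A ^ 2 / 2))) ∂terminalLaw ν := by
            simp
        _ ≤ p (Icc (-A) A) := by
            rw [hp, tilted_apply]
            refine setLIntegral_mono' measurableSet_Icc fun z hz ↦ ENNReal.ofReal_le_ofReal ?_
            have hz2 : z ^ 2 ≤ A ^ 2 := sq_le_sq' hz.1 hz.2
            calc Real.exp (-(A ^ 2 / 2)) ≤ Real.exp (-(r * z ^ 2 / 2)) := by
                  rw [Real.exp_le_exp]; nlinarith [sq_nonneg z]
              _ ≤ _ := le_div_self (Real.exp_pos _).le hnorm0 hnorm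
    have hvar0 : variance (fun z ↦ z) p ≤ L := by
      have := hvar 0
      simpa using this
    have hmean : |∫ z, z ∂p| ≤ M := abs_integral_le_of_mass hL2 (by positivity) hL0 hmass hvar0
    have hbound : ∫ z, Real.exp (t * z) ∂p ≤ Real.exp (|t| * M + L * t ^ 2 / 2) := by
      rcases lt_trichotomy t 0 with ht | rfl | ht
      · have h := mgf_le_of_variance_tilted_le (p := p) (X := fun z ↦ -z) (L := L)
          (fun u ↦ by simpa using hexp (-u)) (fun u ↦ by
            have := hvar (-u)
            rw [variance_fun_neg]
            simpa using this) (neg_pos.2 ht)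
        simp only [neg_mul_neg, neg_sq] at h
        refine h.trans (Real.exp_le_exp.2 ?_)
        rw [integral_neg, abs_of_neg ht, neg_mul_neg]
        nlinarith [neg_abs_le (∫ z, z ∂p)]
      · have : 0 ≤ M := (abs_nonneg _).trans hmean
        simp
      · refine (mgf_le_of_variance_tilted_le hexp hvar ht).trans (Real.exp_le_exp.2 ?_)
        rw [abs_of_pos ht]
        nlinarith [le_abs_self (∫ z, z ∂p)]
    refine le_trans ?_ hbound
    rw [hp, integral_exp_tilted, le_div_iff₀ hnorm0]
    have heq : (fun z ↦ -(r * z ^ 2 / 2)) + (fun z ↦ t * z) =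
        fun z ↦ t * z - r * z ^ 2 / 2 := by
      funext z
      simp only [Pi.add_apply]
      ring
    rw [heq]
    exact mul_le_of_le_one_right (integral_nonneg fun z ↦ (Real.exp_pos _).le) hnorm
  -- let `s = 1 / (n + 2)` tend to zero
  have hfin : ∫⁻ z, ENNReal.ofReal (Real.exp (t * z)) ∂terminalLaw ν ≤
      ENNReal.ofReal (Real.exp (|t| * M + L * t ^ 2 / 2)) := by
    set s : ℕ → ℝ := fun n ↦ 1 / ((n : ℝ) + 2) with hsdef
    have hs0 (n : ℕ) : 0 < s n := by positivity
    have hs2 (n : ℕ) : s n ≤ 1 / 2 := by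
      exact one_div_le_one_div_of_le (by norm_num) (by linarith [(Nat.cast_nonneg n : (0 : ℝ) ≤ n)])
    have hslim : Filter.Tendsto s Filter.atTop (nhds 0) := by
      have h := tendsto_const_div_atTop_nhds_zero_nat (1 : ℝ)
      refine ((Filter.tendsto_add_atTop_iff_nat 2).2 h).congr fun n ↦ ?_
      simp [hsdef]
    have hptw (z : ℝ) : Filter.Tendsto (fun n ↦ ENNReal.ofReal
        (Real.exp (t * z - s n / (1 - s n) * z ^ 2 / 2))) Filter.atTop
        (nhds (ENNReal.ofReal (Real.exp (t * z)))) := by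
      refine (ENNReal.continuous_ofReal.tendsto _).comp ((Real.continuous_exp.tendsto _).comp ?_)
      have h1 : Filter.Tendsto (fun n ↦ t * z - s n / (1 - s n) * z ^ 2 / 2) Filter.atTop
          (nhds (t * z - 0 / (1 - 0) * z ^ 2 / 2)) :=
        tendsto_const_nhds.sub (((hslim.div (tendsto_const_nhds.sub hslim)
          (by norm_num)).mul_const _).div_const _)
      simpa using h1
    calc _ = ∫⁻ z, Filter.liminf (fun n ↦ ENNReal.ofReal
          (Real.exp (t * z - s n / (1 - s n) * z ^ 2 / 2))) Filter.atTop ∂terminalLaw ν :=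
          lintegral_congr fun z ↦ (hptw z).liminf_eq.symm
      _ ≤ Filter.liminf (fun n ↦ ∫⁻ z, ENNReal.ofReal
          (Real.exp (t * z - s n / (1 - s n) * z ^ 2 / 2)) ∂terminalLaw ν) Filter.atTop :=
          lintegral_liminf_le fun n ↦ by fun_prop
      _ ≤ Filter.liminf (fun _ : ℕ ↦ ENNReal.ofReal (Real.exp (|t| * M + L * t ^ 2 / 2)))
          Filter.atTop := by
          refine Filter.liminf_le_liminf (.of_forall fun n ↦ ?_)
          rw [← ofReal_integral_eq_lintegral_ofReal (integrable_exp_damped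
            (div_pos (hs0 n) (by linarith [hs2 n])) t) (.of_forall fun z ↦ (Real.exp_pos _).le)]
          exact ENNReal.ofReal_le_ofReal (key _ (hs0 n) (hs2 n))
      _ = _ := by simp
  refine ⟨by fun_prop, ?_⟩
  rw [hasFiniteIntegral_iff_ofReal (.of_forall fun z ↦ (Real.exp_pos _).le)]
  exact hfin.trans_lt ENNReal.ofReal_lt_top

end RandomizedBridge

/-! ### The running maximum of Brownian motion -/

namespace RandomizedBridge

section SampledMax

variable {Ω : Type*} {B : ℝ≥0 → Ω → ℝ}

/-- The maximum of `|B|` over the first `n + 1` sampling times. -/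
noncomputable def sampledMax (B : ℝ≥0 → Ω → ℝ) (f : ℕ → ℝ≥0) (n : ℕ) (ω : Ω) : ℝ :=
  (Finset.range (n + 1)).sup' Finset.nonempty_range_add_one fun k ↦ |B (f k) ω|

theorem sampledMax_nonneg (f : ℕ → ℝ≥0) (n : ℕ) (ω : Ω) : 0 ≤ sampledMax B f n ω :=
  (abs_nonneg (B (f 0) ω)).trans
    (Finset.le_sup' (fun k ↦ |B (f k) ω|) (Finset.mem_range.2 n.succ_pos))

/-- The dyadic sampling times of level `n`. -/
noncomputable def dyadicTime (n k : ℕ) : ℝ≥0 := k / 2 ^ n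

theorem monotone_dyadicTime (n : ℕ) : Monotone (dyadicTime n) := fun k l h ↦ by
  unfold dyadicTime
  gcongr

theorem monotone_sampledMax_dyadicTime (ω : Ω) :
    Monotone fun n ↦ sampledMax B (dyadicTime n) (2 ^ n) ω := by
  refine monotone_nat_of_le_succ fun n ↦ Finset.sup'_le _ _ fun k hk ↦ ?_
  have hk' : k * 2 ∈ Finset.range (2 ^ (n + 1) + 1) := by
    rw [Finset.mem_range] at hk ⊢
    rw [pow_succ]
    omega
  have e : dyadicTime (n + 1) (k * 2) = dyadicTime n k := by
    unfold dyadicTime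
    push_cast
    rw [pow_succ, mul_div_mul_right _ _ two_ne_zero]
  have := Finset.le_sup' (fun k ↦ |B (dyadicTime (n + 1) k) ω|) hk'
  simp only [e] at this
  exact this

theorem tendsto_dyadicTime (u : ℝ≥0) :
    Filter.Tendsto (fun n ↦ dyadicTime n ⌊u * 2 ^ n⌋₊) Filter.atTop (nhds u) := by
  have h := (tendsto_nat_floor_mul_div_atTop (R := ℝ) (a := u) u.2).comp
    (tendsto_pow_atTop_atTop_of_one_lt (one_lt_two (α := ℝ)))
  rw [← NNReal.tendsto_coe]
  refine h.congr fun n ↦ ?_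
  simp only [Function.comp, dyadicTime, NNReal.coe_div, NNReal.coe_natCast, NNReal.coe_pow,
    NNReal.coe_ofNat]
  congr 2

end SampledMax

section RunningMaximum

variable {Ω : Type*} [MeasurableSpace Ω] {P : Measure Ω} {B : ℝ≥0 → Ω → ℝ}

theorem integral_sq_eval (hBM : IsPreBrownianReal B P) (t : ℝ≥0) :
    ∫ ω, B t ω ^ 2 ∂P = t := by
  have := hBM.isGaussianProcess.isProbabilityMeasure
  have h := hBM.covariance_eval t t
  rw [covariance_self (hBM.aemeasurable t), variance_of_integral_eq_zero (hBM.aemeasurable t)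
    (hBM.integral_eval t)] at h
  simpa using h

theorem memLp_two_eval (hBM : IsPreBrownianReal B P) (t : ℝ≥0) : MemLp (B t) 2 P :=
  (hBM.isGaussianProcess.hasGaussianLaw_eval t).memLp_two

/-- The square of a Brownian motion sampled along an increasing sequence of times is a
submartingale. -/
theorem submartingale_sq (hB : ∀ u, Measurable (B u)) (hBM : IsPreBrownianReal B P) {f : ℕ → ℝ≥0}
    (hf : Monotone f) :
    Submartingale (fun k ω ↦ B (f k) ω ^ 2)
      (Filtration.natural (fun k ↦ B (f k)) fun k ↦ (hB (f k)).stronglyMeasurable) P := by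
  have := hBM.isGaussianProcess.isProbabilityMeasure
  have hadp := Filtration.stronglyAdapted_natural
    (fun k ↦ (hB (f k)).stronglyMeasurable : ∀ k, StronglyMeasurable (B (f k)))
  set 𝒢 := Filtration.natural (fun k ↦ B (f k)) fun k ↦ (hB (f k)).stronglyMeasurable with h𝒢
  refine submartingale_of_setIntegral_le_succ (fun k ↦ (hadp k).pow 2)
    (fun k ↦ (memLp_two_eval hBM _).integrable_sq) fun i A hA ↦ ?_
  have hA' : MeasurableSet A := 𝒢.le i A hA
  set t₀ := f i with ht₀
  obtain ⟨t, ht⟩ := exists_add_of_le (hf i.le_succ)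
  -- the increment is independent of the past and centred
  have hindep : ∫ ω, (B (t₀ + t) ω - B t₀ ω) * A.indicator (B t₀) ω ∂P = 0 := by
    have hcomap : 𝒢 i ≤ MeasurableSpace.comap (fun ω (t : Iic t₀) ↦ B t ω) inferInstance := by
      rw [h𝒢, Filtration.natural]
      refine iSup₂_le fun j hj ↦ ?_
      refine Measurable.comap_le ?_
      exact (measurable_pi_apply (⟨f j, hf hj⟩ : Iic t₀)).comp
        (comap_measurable fun ω (t : Iic t₀) ↦ B t ω)
    have hmeas : Measurable[𝒢 i] (A.indicator (B t₀)) :=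
      Measurable.indicator (hadp i).measurable hA
    have h1 : Indep (MeasurableSpace.comap (fun ω ↦ B (t₀ + t) ω - B t₀ ω) inferInstance)
        (MeasurableSpace.comap (A.indicator (B t₀)) inferInstance) P := by
      refine indep_of_indep_of_le_right (indep_of_indep_of_le_left
        ((IndepFun_iff_Indep _ _ _).1 (hBM.indepFun_shift t₀)) ?_)
        (hmeas.comap_le.trans hcomap)
      exact ((measurable_pi_apply t).comp
        (comap_measurable fun ω t ↦ B (t₀ + t) ω - B t₀ ω)).comap_le
    have h2 : IndepFun (fun ω ↦ B (t₀ + t) ω - B t₀ ω) (A.indicator (B t₀)) P :=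
      (IndepFun_iff_Indep _ _ _).2 h1
    have h3 := h2.integral_mul_eq_mul_integral
      ((hB _).sub (hB _)).aestronglyMeasurable
      (((hB t₀).indicator hA').aestronglyMeasurable)
    have h4 : ∫ ω, (B (t₀ + t) ω - B t₀ ω) ∂P = 0 := by
      rw [integral_sub (hBM.integrable_eval _) (hBM.integrable_eval _), hBM.integral_eval,
        hBM.integral_eval, sub_zero]
    simpa [h4] using h3
  have hI : MemLp (fun ω ↦ B (t₀ + t) ω - B t₀ ω) 2 P :=
    (memLp_two_eval hBM _).sub (memLp_two_eval hBM _)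
  have hprod : Integrable (fun ω ↦ (B (t₀ + t) ω - B t₀ ω) * A.indicator (B t₀) ω) P :=
    hI.integrable_mul ((memLp_two_eval hBM t₀).indicator hA')
  have hsq := (memLp_two_eval hBM t₀).integrable_sq
  rw [ht]
  calc ∫ ω in A, B t₀ ω ^ 2 ∂P
      = ∫ ω, A.indicator (fun ω ↦ B t₀ ω ^ 2) ω +
          2 * ((B (t₀ + t) ω - B t₀ ω) * A.indicator (B t₀) ω) ∂P := by
        rw [integral_add (hsq.indicator hA') (hprod.const_mul 2), integral_const_mul, hindep,
          integral_indicator hA', mul_zero, add_zero]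
    _ ≤ ∫ ω, A.indicator (fun ω ↦ B (t₀ + t) ω ^ 2) ω ∂P := by
        refine integral_mono ((hsq.indicator hA').add (hprod.const_mul 2))
          ((memLp_two_eval hBM _).integrable_sq.indicator hA') fun ω ↦ ?_
        by_cases hω : ω ∈ A
        · simp only [hω, indicator_of_mem]
          nlinarith [sq_nonneg (B (t₀ + t) ω - B t₀ ω)]
        · simp [hω]
    _ = ∫ ω in A, B (t₀ + t) ω ^ 2 ∂P := integral_indicator hA'

theorem measurable_sampledMax (hB : ∀ u, Measurable (B u)) (f : ℕ → ℝ≥0) (n : ℕ) :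
    Measurable (sampledMax B f n) := by
  unfold sampledMax
  exact Finset.measurable_range_sup'' fun k _ ↦ (hB (f k)).norm

theorem measure_le_sampledMax (hB : ∀ u, Measurable (B u)) (hBM : IsPreBrownianReal B P)
    {f : ℕ → ℝ≥0} (hf : Monotone f) {n : ℕ} (hn : f n ≤ 1) {x : ℝ} (hx : 0 < x) :
    P {ω | x ≤ sampledMax B f n ω} ≤ ENNReal.ofReal (x ^ (-2 : ℝ)) := by
  have := hBM.isGaussianProcess.isProbabilityMeasure
  have hdoob := maximal_ineq (submartingale_sq hB hBM hf) (fun k ω ↦ sq_nonneg _)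
    (ε := (x ^ 2).toNNReal) n
  simp only [Real.coe_toNNReal _ (sq_nonneg x)] at hdoob
  have hset : {ω | x ≤ sampledMax B f n ω} ⊆ {ω | x ^ 2 ≤
      (Finset.range (n + 1)).sup' Finset.nonempty_range_add_one fun k ↦ B (f k) ω ^ 2} := by
    intro ω hω
    have hω' : x ≤ sampledMax B f n ω := hω
    rw [sampledMax, Finset.le_sup'_iff] at hω'
    obtain ⟨k, hk, hle⟩ := hω'
    rw [mem_ofPred_eq, Finset.le_sup'_iff]
    refine ⟨k, hk, ?_⟩
    rw [← sq_abs (B (f k) ω)]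
    gcongr
  have hx2 : ENNReal.ofReal (x ^ 2) ≠ 0 := by simpa using hx.ne'
  refine (measure_mono hset).trans ?_
  rw [Real.rpow_neg hx.le, Real.rpow_two, ENNReal.ofReal_inv_of_pos (by positivity),
    ← one_div, ENNReal.le_div_iff_mul_le (.inl hx2) (.inl ENNReal.ofReal_ne_top), mul_comm]
  refine hdoob.trans ?_
  rw [← ENNReal.ofReal_one]
  refine ENNReal.ofReal_le_ofReal ?_
  calc _ ≤ ∫ ω, B (f n) ω ^ 2 ∂P := setIntegral_le_integral
        (memLp_two_eval hBM _).integrable_sq (.of_forall fun ω ↦ sq_nonneg _)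
    _ ≤ 1 := by rw [integral_sq_eval hBM]; exact_mod_cast hn

theorem lintegral_sampledMax_le (hB : ∀ u, Measurable (B u)) (hBM : IsPreBrownianReal B P)
    {f : ℕ → ℝ≥0} (hf : Monotone f) {n : ℕ} (hn : f n ≤ 1) :
    ∫⁻ ω, ENNReal.ofReal (sampledMax B f n ω) ∂P ≤ 2 := by
  have := hBM.isGaussianProcess.isProbabilityMeasure
  rw [lintegral_eq_lintegral_meas_le P (.of_forall fun ω ↦ sampledMax_nonneg f n ω)
    (measurable_sampledMax hB f n).aemeasurable,
    ← Ioc_union_Ioi_eq_Ioi (zero_le_one (α := ℝ)),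
    lintegral_union measurableSet_Ioi (Ioc_disjoint_Ioi le_rfl), ← one_add_one_eq_two]
  refine add_le_add ?_ ?_
  · calc _ ≤ ∫⁻ _ in Ioc (0 : ℝ) 1, 1 := lintegral_mono fun _ ↦ prob_le_one
      _ = 1 := by simp
  · calc _ ≤ ∫⁻ x in Ioi (1 : ℝ), ENNReal.ofReal (x ^ (-2 : ℝ)) :=
          setLIntegral_mono' measurableSet_Ioi fun x hx ↦
            measure_le_sampledMax hB hBM hf hn (zero_lt_one.trans hx)
      _ = ENNReal.ofReal (∫ x in Ioi (1 : ℝ), x ^ (-2 : ℝ)) := by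
          rw [ofReal_integral_eq_lintegral_ofReal
            (integrableOn_Ioi_rpow_of_lt (by norm_num) zero_lt_one)]
          exact (ae_restrict_iff' measurableSet_Ioi).2 (.of_forall fun x hx ↦
            Real.rpow_nonneg (zero_lt_one.trans hx).le _)
      _ ≤ 1 := by
          rw [integral_Ioi_rpow_of_lt (by norm_num) zero_lt_one]
          norm_num

/-- The running maximum of `|B|` over `[0, 1]` is integrable. -/
theorem exists_integrable_runningMax (hB : ∀ u, Measurable (B u)) (hBM : IsBrownianReal B P) :
    ∃ S : Ω → ℝ, Integrable S P ∧ (∀ ω, 0 ≤ S ω) ∧ ∀ᵐ ω ∂P, ∀ u ≤ 1, |B u ω| ≤ S ω := by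
  have hpre := hBM.toIsPreBrownianReal
  set F : ℕ → Ω → ENNReal := fun n ω ↦ ENNReal.ofReal (sampledMax B (dyadicTime n) (2 ^ n) ω)
    with hF
  have hFm (n : ℕ) : Measurable (F n) := (measurable_sampledMax hB _ _).ennreal_ofReal
  have hle : ∫⁻ ω, ⨆ n, F n ω ∂P ≤ 2 := by
    rw [lintegral_iSup hFm fun m n h ω ↦
      ENNReal.ofReal_le_ofReal (monotone_sampledMax_dyadicTime ω h)]
    exact iSup_le fun n ↦ lintegral_sampledMax_le hB hpre (monotone_dyadicTime n)
      (by simp [dyadicTime])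
  have hfin : ∫⁻ ω, ⨆ n, F n ω ∂P ≠ ⊤ := (hle.trans_lt (by simp)).ne
  refine ⟨fun ω ↦ (⨆ n, F n ω).toReal,
    integrable_toReal_of_lintegral_ne_top (Measurable.iSup hFm).aemeasurable hfin,
    fun ω ↦ ENNReal.toReal_nonneg, ?_⟩
  filter_upwards [hBM.cont, ae_lt_top (Measurable.iSup hFm) hfin] with ω hcont hω u hu
  refine le_of_tendsto ((hcont.abs.tendsto u).comp (tendsto_dyadicTime u)) (.of_forall fun n ↦ ?_)
  have hk : ⌊u * 2 ^ n⌋₊ ∈ Finset.range (2 ^ n + 1) := by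
    rw [Finset.mem_range, Nat.lt_succ_iff]
    refine Nat.floor_le_of_le ?_
    push_cast
    exact mul_le_of_le_one_left (by positivity) hu
  have h1 : |B (dyadicTime n ⌊u * 2 ^ n⌋₊) ω| ≤ sampledMax B (dyadicTime n) (2 ^ n) ω :=
    Finset.le_sup' (fun k ↦ |B (dyadicTime n k) ω|) hk
  refine h1.trans ?_
  rw [← ENNReal.ofReal_le_iff_le_toReal hω.ne]
  exact le_iSup (fun n ↦ F n ω) n

end RunningMaximum

end RandomizedBridge

/-! ### Brownian bridges and their independence of the end point -/

namespace RandomizedBridge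

/-- The bridge of length `T` associated with the path `x`, continued constantly after time `T`. -/
noncomputable def bridgePath (T : ℝ≥0) (x : ℝ≥0 → ℝ) (v : ℝ≥0) : ℝ :=
  x (min v T) - ((min v T : ℝ≥0) : ℝ) / T * x T

theorem measurable_bridgePath (T : ℝ≥0) : Measurable (bridgePath T) := by
  unfold bridgePath
  fun_prop

theorem bridgePath_of_le {T v : ℝ≥0} (h : v ≤ T) (x : ℝ≥0 → ℝ) :
    bridgePath T x v = x v - v / T * x T := by
  rw [bridgePath, min_eq_left h]

theorem abs_bridgePath_le {T v : ℝ≥0} {x : ℝ≥0 → ℝ} {S : ℝ} (hx : ∀ u ≤ T, |x u| ≤ S) :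
    |bridgePath T x v| ≤ 2 * S := by
  have h1 := hx (min v T) (min_le_right _ _)
  have h2 := hx T le_rfl
  have hle : ((min v T : ℝ≥0) : ℝ) / T ≤ 1 :=
    div_le_one_of_le₀ (by exact_mod_cast min_le_right v T) T.2
  have h0 : 0 ≤ ((min v T : ℝ≥0) : ℝ) / T := by positivity
  rw [bridgePath]
  refine (abs_sub _ _).trans ?_
  rw [abs_mul, abs_of_nonneg h0]
  nlinarith [abs_nonneg (x T)]

theorem measurePreserving_prodProdProdComm {α β γ δ : Type*} [MeasurableSpace α]
    [MeasurableSpace β] [MeasurableSpace γ] [MeasurableSpace δ] (μa : Measure α) (μb : Measure β)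
    (μc : Measure γ) (μd : Measure δ) [SFinite μa] [SFinite μb] [SFinite μc] [SFinite μd] :
    MeasurePreserving (fun p : (α × β) × (γ × δ) ↦ ((p.1.1, p.2.1), (p.1.2, p.2.2)))
      ((μa.prod μb).prod (μc.prod μd)) ((μa.prod μc).prod (μb.prod μd)) := by
  have h1 := measurePreserving_prodAssoc μa μb (μc.prod μd)
  have h2 := (MeasurePreserving.id μa).prod (measurePreserving_prodAssoc μb μc μd).symm
  have h3 := (MeasurePreserving.id μa).prod
    ((Measure.measurePreserving_swap (μ := μb) (ν := μc)).prod (MeasurePreserving.id μd))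
  have h4 := (MeasurePreserving.id μa).prod (measurePreserving_prodAssoc μc μb μd)
  have h5 := (measurePreserving_prodAssoc μa μc (μb.prod μd)).symm
  exact h5.comp (h4.comp (h3.comp (h2.comp h1)))

section Law

variable {Ω : Type*} [MeasurableSpace Ω] {P : Measure Ω} {B X Y : ℝ≥0 → Ω → ℝ}

theorem map_path_eq (hX : IsPreBrownianReal X P) (hY : IsPreBrownianReal Y P)
    (hXm : ∀ u, Measurable (X u)) (hYm : ∀ u, Measurable (Y u)) :
    P.map (fun ω ↦ (X · ω)) = P.map (fun ω ↦ (Y · ω)) := by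
  have := hX.isGaussianProcess.isProbabilityMeasure
  rw [map_eq_iff_forall_finset_map_restrict_eq (measurable_pi_lambda _ hXm).aemeasurable
    (measurable_pi_lambda _ hYm).aemeasurable]
  exact fun I ↦ (hX.hasLaw I).map_eq.trans (hY.hasLaw I).map_eq.symm

/-- The law of the Brownian bridge of length `T`. -/
noncomputable def bridgeLaw (P : Measure Ω) (B : ℝ≥0 → Ω → ℝ) (T : ℝ≥0) : Measure (ℝ≥0 → ℝ) :=
  P.map fun ω ↦ bridgePath T (B · ω)

theorem map_bridgePath_eq (hX : IsPreBrownianReal X P) (hB : IsPreBrownianReal B P)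
    (hXm : ∀ u, Measurable (X u)) (hBm : ∀ u, Measurable (B u)) (T : ℝ≥0) :
    P.map (fun ω ↦ bridgePath T (X · ω)) = bridgeLaw P B T := by
  have h := congrArg (Measure.map (bridgePath T)) (map_path_eq hX hB hXm hBm)
  rwa [Measure.map_map (measurable_bridgePath T) (measurable_pi_lambda _ hXm),
    Measure.map_map (measurable_bridgePath T) (measurable_pi_lambda _ hBm)] at h

theorem measurable_bridgePath_comp (hBm : ∀ u, Measurable (B u)) (T : ℝ≥0) :
    Measurable fun ω ↦ bridgePath T (B · ω) :=
  (measurable_bridgePath T).comp (measurable_pi_lambda _ hBm)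

/-- A Brownian bridge is independent of the end point of the Brownian motion from which it is
built. -/
theorem indepFun_bridgePath_eval (hX : IsPreBrownianReal X P) (hXm : ∀ u, Measurable (X u))
    {T : ℝ≥0} (hT : 0 < T) : IndepFun (fun ω ↦ bridgePath T (X · ω)) (X T) P := by
  have := hX.isGaussianProcess.isProbabilityMeasure
  have hjoint : IsGaussianProcess (Sum.elim (fun v ω ↦ bridgePath T (X · ω) v)
      (fun (_ : Unit) ω ↦ X T ω)) P := by
    apply hX.isGaussianProcess.of_isGaussianProcess
    rintro (v | _)
    · exact ⟨{min v T, T},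
        { toFun x := x ⟨min v T, by simp⟩ - ((min v T : ℝ≥0) : ℝ) / T * x ⟨T, by simp⟩
          map_add' x y := by simp; ring
          map_smul' c x := by simp; ring }, by simp [bridgePath]⟩
    · exact ⟨{T},
        { toFun x := x ⟨T, by simp⟩
          map_add' x y := by simp
          map_smul' c x := by simp }, by simp⟩
  have h := hjoint.indepFun_of_covariance_eq_zero
    (fun v ↦ ((measurable_pi_apply v).comp (measurable_bridgePath_comp hXm T)).aemeasurable)
    (fun _ ↦ (hXm T).aemeasurable) (fun v _ ↦ by
      have hT' : (T : ℝ) ≠ 0 := by exact_mod_cast hT.ne'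
      simp only [bridgePath]
      rw [covariance_fun_sub_left (memLp_two_eval hX _) ((memLp_two_eval hX _).const_mul _)
        (memLp_two_eval hX _), covariance_const_mul_left, hX.covariance_fun_eval,
        hX.covariance_fun_eval, min_self, min_eq_left (min_le_right v T)]
      field_simp
      simp)
  exact h.comp measurable_id (measurable_pi_apply ())

theorem gaussianReal_prod_map_linear {v w : ℝ≥0} (a c : ℝ) {r : ℝ≥0}
    (hr : (r : ℝ) = a ^ 2 * v + c ^ 2 * w) :
    ((gaussianReal 0 v).prod (gaussianReal 0 w)).map (fun p ↦ a * p.1 + c * p.2) =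
      gaussianReal 0 r := by
  have h1 : HasLaw (fun p : ℝ × ℝ ↦ a * p.1) (gaussianReal 0 (.mk (a ^ 2) (sq_nonneg _) * v))
      ((gaussianReal 0 v).prod (gaussianReal 0 w)) := by
    refine ⟨by fun_prop, ?_⟩
    rw [show (fun p : ℝ × ℝ ↦ a * p.1) = (a * ·) ∘ Prod.fst from rfl,
      ← Measure.map_map (by fun_prop) (by fun_prop), Measure.map_fst_prod, measure_univ, one_smul,
      gaussianReal_map_const_mul, mul_zero]
  have h2 : HasLaw (fun p : ℝ × ℝ ↦ c * p.2) (gaussianReal 0 (.mk (c ^ 2) (sq_nonneg _) * w))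
      ((gaussianReal 0 v).prod (gaussianReal 0 w)) := by
    refine ⟨by fun_prop, ?_⟩
    rw [show (fun p : ℝ × ℝ ↦ c * p.2) = (c * ·) ∘ Prod.snd from rfl,
      ← Measure.map_map (by fun_prop) (by fun_prop), Measure.map_snd_prod, measure_univ, one_smul,
      gaussianReal_map_const_mul, mul_zero]
  have hind : IndepFun (fun p : ℝ × ℝ ↦ a * p.1) (fun p : ℝ × ℝ ↦ c * p.2)
      ((gaussianReal 0 v).prod (gaussianReal 0 w)) :=
    indepFun_prod (by fun_prop) (by fun_prop)
  have h := gaussianReal_add_gaussianReal_of_indepFun hind h1.map_eq h2.map_eq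
  rw [add_zero] at h
  refine h.trans ?_
  congr 1
  ext
  rw [hr]
  rfl

/-- The rescaled initial piece of `B`, up to time `l`. -/
noncomputable def headPath (B : ℝ≥0 → Ω → ℝ) (l : ℝ≥0) (u : ℝ≥0) (ω : Ω) : ℝ :=
  (√(l : ℝ))⁻¹ * B (l * u) ω

/-- The increments of `B` after time `l`. -/
def tailPath (B : ℝ≥0 → Ω → ℝ) (l : ℝ≥0) (u : ℝ≥0) (ω : Ω) : ℝ := B (l + u) ω - B l ω

theorem measurable_headPath (hBm : ∀ u, Measurable (B u)) (l u : ℝ≥0) :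
    Measurable (headPath B l u) := (hBm _).const_mul _

theorem measurable_tailPath (hBm : ∀ u, Measurable (B u)) (l u : ℝ≥0) :
    Measurable (tailPath B l u) := (hBm _).sub (hBm _)

theorem indepFun_headPath_tailPath (hB : IsPreBrownianReal B P) (l d : ℝ≥0) :
    IndepFun (fun ω ↦ (bridgePath 1 (headPath B l · ω), headPath B l 1 ω))
      (fun ω ↦ (bridgePath d (tailPath B l · ω), tailPath B l d ω)) P := by
  have h := (hB.indepFun_shift l).symm
  have hmul (v : ℝ≥0) : l * min v 1 ≤ l := mul_le_of_le_one_right zero_le (min_le_right _ _)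
  exact h.comp (φ := fun x : Iic l → ℝ ↦ ((fun v : ℝ≥0 ↦ (√(l : ℝ))⁻¹ * x ⟨l * min v 1, hmul v⟩ -
      ((min v 1 : ℝ≥0) : ℝ) / (1 : ℝ≥0) * ((√(l : ℝ))⁻¹ * x ⟨l * 1, (mul_one l).le⟩)),
      (√(l : ℝ))⁻¹ * x ⟨l * 1, (mul_one l).le⟩))
    (ψ := fun x : ℝ≥0 → ℝ ↦ (bridgePath d x, x d)) (by fun_prop)
    ((measurable_bridgePath d).prodMk (measurable_pi_apply d))

theorem isProbabilityMeasure_bridgeLaw [IsProbabilityMeasure P] (hBm : ∀ u, Measurable (B u))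
    (T : ℝ≥0) : IsProbabilityMeasure (bridgeLaw P B T) :=
  Measure.isProbabilityMeasure_map (measurable_bridgePath_comp hBm T).aemeasurable

/-- The decomposition of a Brownian motion on `[0, l + d]` into a bridge on `[0, l]`, a bridge on
`[l, l + d]` and the two increments, which are independent. The law of the bridges, after
rescaling the first one, does not depend on `l`. -/
theorem map_bridges_eq (hB : IsPreBrownianReal B P) (hBm : ∀ u, Measurable (B u)) {l d : ℝ≥0}
    (hl : 0 < l) (hd : 0 < d) (a c : ℝ) {r : ℝ≥0} (hr : (r : ℝ) = a ^ 2 + c ^ 2 * d) :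
    P.map (fun ω ↦ ((bridgePath 1 (headPath B l · ω), bridgePath d (tailPath B l · ω)),
      a * headPath B l 1 ω + c * tailPath B l d ω)) =
      ((bridgeLaw P B 1).prod (bridgeLaw P B d)).prod (gaussianReal 0 r) := by
  have := hB.isGaussianProcess.isProbabilityMeasure
  have := isProbabilityMeasure_bridgeLaw (P := P) hBm 1
  have := isProbabilityMeasure_bridgeLaw (P := P) hBm d
  have hH : IsPreBrownianReal (headPath B l) P := hB.smul hl.ne'
  have hT : IsPreBrownianReal (tailPath B l) P := hB.shift l
  have hHm := measurable_headPath hBm l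
  have hTm := measurable_tailPath hBm l
  have mH1 := measurable_bridgePath_comp hHm 1
  have mT1 := measurable_bridgePath_comp hTm d
  have e1 : P.map (fun ω ↦ (bridgePath 1 (headPath B l · ω), headPath B l 1 ω)) =
      (bridgeLaw P B 1).prod (gaussianReal 0 1) := by
    rw [(indepFun_iff_map_prod_eq_prod_map_map mH1.aemeasurable (hHm 1).aemeasurable).1
      (indepFun_bridgePath_eval hH hHm one_pos), map_bridgePath_eq hH hB hHm hBm,
      (hH.hasLaw_eval 1).map_eq]
  have e2 : P.map (fun ω ↦ (bridgePath d (tailPath B l · ω), tailPath B l d ω)) =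
      (bridgeLaw P B d).prod (gaussianReal 0 d) := by
    rw [(indepFun_iff_map_prod_eq_prod_map_map mT1.aemeasurable (hTm d).aemeasurable).1
      (indepFun_bridgePath_eval hT hTm hd), map_bridgePath_eq hT hB hTm hBm,
      (hT.hasLaw_eval d).map_eq]
  have e3 := (indepFun_iff_map_prod_eq_prod_map_map (mH1.prodMk (hHm 1)).aemeasurable
      (mT1.prodMk (hTm d)).aemeasurable).1 (indepFun_headPath_tailPath hB l d)
  rw [e1, e2] at e3
  have hmp := (MeasurePreserving.id ((bridgeLaw P B 1).prod (bridgeLaw P B d))).prod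
    (⟨by fun_prop, gaussianReal_prod_map_linear (v := 1) (w := d) a c (r := r) (by simpa using hr)⟩ :
      MeasurePreserving (fun p : ℝ × ℝ ↦ a * p.1 + c * p.2)
        ((gaussianReal 0 1).prod (gaussianReal 0 d)) (gaussianReal 0 r))
  have hall := hmp.comp (measurePreserving_prodProdProdComm (bridgeLaw P B 1) (gaussianReal 0 1)
    (bridgeLaw P B d) (gaussianReal 0 d))
  rw [← hall.map_eq, ← e3, Measure.map_map hall.measurable
    ((mH1.prodMk (hHm 1)).prodMk (mT1.prodMk (hTm d)))]
  rfl

end Law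

end RandomizedBridge

/-! ### The canonical description of the randomized bridge -/

namespace RandomizedBridge

/-- The canonical sample space. A point `((b₁, b₂), (w, z))` consists of a rescaled bridge `b₁` on
the first piece of the time interval, a bridge `b₂` on the second piece, the standardized
displacement `w` over the first piece, and the pinning point `z`. -/
abbrev Canon : Type := ((ℝ≥0 → ℝ) × (ℝ≥0 → ℝ)) × (ℝ × ℝ)

/-- The elapsed time that corresponds to the canonical time `v`: the canonical interval `[0, 1]` is
mapped linearly onto `[0, l]`, and `[1, 1 + d]` is translated onto `[l, l + d]`. -/
noncomputable def canonTime (l v : ℝ≥0) : ℝ≥0 := if v ≤ 1 then l * v else l + (v - 1)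

/-- What is observed of the canonical sample point at the canonical time `v`. On the first piece
this is the rescaled path. On the second piece, what the position at its beginning contributes to
the bridge is left out: it is already known, and it is the only part that involves the starting
point. -/
noncomputable def canonObs (d v : ℝ≥0) (e : Canon) : ℝ :=
  if v ≤ 1 then e.2.1 * v + e.1.1 v else e.2.2 * ((v - 1 : ℝ≥0) / d) + e.1.2 (v - 1)

/-- The position of the bridge started from `y`, at the canonical time `v`. -/
noncomputable def canonBridge (l d : ℝ≥0) (y : ℝ) (v : ℝ≥0) (e : Canon) : ℝ :=
  if v ≤ 1 then y + √(l : ℝ) * canonObs d v e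
  else (y + √(l : ℝ) * canonObs d 1 e) * (1 - (v - 1 : ℝ≥0) / d) + canonObs d v e

theorem measurable_canonObs (d v : ℝ≥0) : Measurable (canonObs d v) := by
  unfold canonObs
  split_ifs <;> fun_prop

theorem measurable_canonBridge (l d : ℝ≥0) (y : ℝ) (v : ℝ≥0) :
    Measurable (canonBridge l d y v) := by
  have := measurable_canonObs d
  unfold canonBridge
  split_ifs <;> fun_prop

/-- The filtration generated by the canonical observations. -/
noncomputable def canonFiltration (d : ℝ≥0) :
    Filtration ℝ≥0 (inferInstance : MeasurableSpace Canon) :=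
  Filtration.natural (canonObs d) fun v ↦ (measurable_canonObs d v).stronglyMeasurable

theorem measurable_canonObs_filtration (d : ℝ≥0) {r v : ℝ≥0} (h : r ≤ v) :
    Measurable[canonFiltration d v] (canonObs d r) :=
  ((Filtration.stronglyAdapted_natural
    fun v ↦ (measurable_canonObs d v).stronglyMeasurable) r).measurable.mono
      ((canonFiltration d).mono h) le_rfl

theorem measurable_canonBridge_filtration (l d : ℝ≥0) (y : ℝ) {r v : ℝ≥0} (h : r ≤ v) :
    Measurable[canonFiltration d v] (canonBridge l d y r) := by
  have h1 := measurable_canonObs_filtration d h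
  unfold canonBridge
  split_ifs with hr
  · exact (h1.const_mul _).const_add _
  · have h2 := measurable_canonObs_filtration d ((lt_of_not_ge hr).le.trans h)
    exact (((h2.const_mul _).const_add _).mul_const _).add h1

theorem canonTime_zero (l : ℝ≥0) : canonTime l 0 = 0 := by simp [canonTime]

theorem canonTime_one_add {l d : ℝ≥0} (hd : 0 < d) : canonTime l (1 + d) = l + d := by
  simp [canonTime, hd.ne']

theorem canonTime_one (l : ℝ≥0) : canonTime l 1 = l := by simp [canonTime]

theorem coe_canonTime (l v : ℝ≥0) :
    (canonTime l v : ℝ) = if v ≤ 1 then (l : ℝ) * v else l + (v - 1) := by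
  unfold canonTime
  split_ifs with h
  · simp
  · rw [NNReal.coe_add, NNReal.coe_sub (lt_of_not_ge h).le, NNReal.coe_one]

theorem monotone_canonTime (l : ℝ≥0) : Monotone (canonTime l) := fun u v h ↦ by
  rw [← NNReal.coe_le_coe, coe_canonTime, coe_canonTime]
  have h' : (u : ℝ) ≤ v := h
  split_ifs with h1 h2 h2
  · gcongr
  · have h1' : (u : ℝ) ≤ 1 := h1
    have h2' : (1 : ℝ) ≤ v := (lt_of_not_ge h2).le
    nlinarith [l.2]
  · exact absurd (h.trans h2) h1
  · linarith

theorem canonTime_sub_le {l : ℝ≥0} (hl : l ≤ 1) {u v : ℝ≥0} (h : u ≤ v) :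
    (canonTime l v : ℝ) - canonTime l u ≤ v - u := by
  have hl' : (l : ℝ) ≤ 1 := hl
  have h' : (u : ℝ) ≤ v := h
  rw [coe_canonTime, coe_canonTime]
  split_ifs with h1 h2 h2
  · nlinarith
  · exact absurd (h.trans h1) h2
  · have h2' : (u : ℝ) ≤ 1 := h2
    nlinarith [l.2]
  · linarith

theorem exists_canonTime_eq {l t v : ℝ≥0} (hl : 0 < l) (h : t ≤ canonTime l v) :
    ∃ r ≤ v, canonTime l r = t := by
  by_cases ht : t ≤ l
  · refine ⟨min v (t / l), min_le_left _ _, ?_⟩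
    have htl : t / l ≤ 1 := div_le_one_of_le₀ ht zero_le
    have hc : canonTime l (t / l) = t := by
      rw [canonTime, if_pos htl, mul_div_cancel₀ _ hl.ne']
    rcases le_total v (t / l) with h1 | h1
    · rw [min_eq_left h1]
      exact le_antisymm ((monotone_canonTime l h1).trans_eq hc) h
    · rw [min_eq_right h1, hc]
  · have hlt := lt_of_not_ge ht
    have hv : ¬ v ≤ 1 := fun hv ↦ ht (h.trans ((monotone_canonTime l hv).trans_eq (canonTime_one l)))
    have hr : ¬ 1 + (t - l) ≤ 1 := by simpa [tsub_eq_zero_iff_le] using hlt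
    refine ⟨1 + (t - l), ?_, ?_⟩
    · rw [canonTime, if_neg hv] at h
      rw [← NNReal.coe_le_coe] at h ⊢
      push_cast [hlt.le, (lt_of_not_ge hv).le] at h ⊢
      linarith
    · rw [canonTime, if_neg hr, add_tsub_cancel_left, add_tsub_cancel_of_le hlt.le]

section Map

variable {Ω : Type*}

/-- The map that sends a sample point of the randomized bridge to the canonical sample point. -/
noncomputable def canonMap (B : ℝ≥0 → Ω → ℝ) (l d : ℝ≥0) (s y : ℝ) (ω : Ω × ℝ) : Canon :=
  ((bridgePath 1 (headPath B l · ω.1), bridgePath d (tailPath B l · ω.1)),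
    ((√(l : ℝ))⁻¹ * (bridge B s y l ω - y), ω.2))

theorem canonObs_canonMap_of_le (B : ℝ≥0 → Ω → ℝ) {l d : ℝ≥0} (hl : 0 < l) {s : ℝ}
    (hs : (l : ℝ) + d = 1 - s) (y : ℝ) {v : ℝ≥0} (hv : v ≤ 1) (ω : Ω × ℝ) :
    canonObs d v (canonMap B l d s y ω) = (√(l : ℝ))⁻¹ * (bridge B s y (l * v) ω - y) := by
  have hl' : (0 : ℝ) < l := hl
  have hD : 1 - s ≠ 0 := by rw [← hs]; positivity
  simp only [canonObs, if_pos hv, canonMap, bridgePath_of_le hv, headPath, bridge, mul_one,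
    NNReal.coe_mul, NNReal.coe_one, div_one]
  ring

theorem canonObs_canonMap_of_lt (B : ℝ≥0 → Ω → ℝ) {l d : ℝ≥0} (hl : 0 < l) (hd : 0 < d) {s : ℝ}
    (hs : (l : ℝ) + d = 1 - s) (y : ℝ) {v : ℝ≥0} (hv : 1 < v) (hvd : v ≤ 1 + d) (ω : Ω × ℝ) :
    canonObs d v (canonMap B l d s y ω) =
      bridge B s y (l + (v - 1)) ω - bridge B s y l ω * (1 - (v - 1 : ℝ≥0) / d) := by
  have hl' : (0 : ℝ) < l := hl
  have hd' : (0 : ℝ) < d := hd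
  have hD : (l : ℝ) + d ≠ 0 := by positivity
  have hv' : v - 1 ≤ d := by rw [tsub_le_iff_left]; exact hvd
  have hDn : (1 - s).toNNReal = l + d := by
    rw [← hs, ← NNReal.coe_add, Real.toNNReal_coe]
  simp only [canonObs, if_neg (not_le.2 hv), canonMap, bridgePath_of_le hv', tailPath, bridge,
    NNReal.coe_add, hDn]
  rw [← hs]
  field_simp
  ring

/-- At corresponding times the randomized bridge is the canonical bridge. -/
theorem bridge_canonTime (B : ℝ≥0 → Ω → ℝ) {l d : ℝ≥0} (hl : 0 < l) (hd : 0 < d) {s : ℝ}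
    (hs : (l : ℝ) + d = 1 - s) (y : ℝ) {v : ℝ≥0} (hvd : v ≤ 1 + d) (ω : Ω × ℝ) :
    bridge B s y (canonTime l v) ω = canonBridge l d y v (canonMap B l d s y ω) := by
  have hl' : √(l : ℝ) ≠ 0 := (Real.sqrt_pos.2 hl).ne'
  unfold canonBridge canonTime
  split_ifs with hv
  · rw [canonObs_canonMap_of_le B hl hs y hv, mul_inv_cancel_left₀ hl']
    ring
  · rw [canonObs_canonMap_of_lt B hl hd hs y (lt_of_not_ge hv) hvd,
      canonObs_canonMap_of_le B hl hs y le_rfl, mul_one, mul_inv_cancel_left₀ hl']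
    ring

variable [MeasurableSpace Ω] {B : ℝ≥0 → Ω → ℝ}

theorem measurable_canonMap (hB : ∀ u, Measurable (B u)) (l d : ℝ≥0) (s y : ℝ) :
    Measurable (canonMap B l d s y) := by
  have h1 := measurable_bridgePath_comp (measurable_headPath hB l) 1
  have h2 := measurable_bridgePath_comp (measurable_tailPath hB l) d
  have h3 := (stronglyMeasurable_bridge hB s y l).measurable
  exact ((h1.comp measurable_fst).prodMk (h2.comp measurable_fst)).prodMk
    (((h3.sub_const y).const_mul _).prodMk measurable_snd)

/-- The natural filtration of the randomized bridge is the pull-back of the canonical filtration,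
which does not depend on the starting point. -/
theorem natural_bridge_eq_comap (hB : ∀ u, Measurable (B u)) {l d : ℝ≥0} (hl : 0 < l) (hd : 0 < d)
    {s : ℝ} (hs : (l : ℝ) + d = 1 - s) (y : ℝ) {v : ℝ≥0} (hvd : v ≤ 1 + d) :
    Filtration.natural (bridge B s y) (stronglyMeasurable_bridge hB s y) (canonTime l v) =
      (canonFiltration d v).comap (canonMap B l d s y) := by
  have hadp := Filtration.stronglyAdapted_natural (stronglyMeasurable_bridge hB s y)
  set F := Filtration.natural (bridge B s y) (stronglyMeasurable_bridge hB s y) with hF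
  refine le_antisymm ?_ ?_
  · rw [hF, Filtration.natural]
    refine iSup₂_le fun t ht ↦ ?_
    obtain ⟨r, hr, rfl⟩ := exists_canonTime_eq hl ht
    rw [show bridge B s y (canonTime l r) = canonBridge l d y r ∘ canonMap B l d s y from
        funext fun ω ↦ bridge_canonTime B hl hd hs y (hr.trans hvd) ω]
    exact ((measurable_canonBridge_filtration l d y hr).comp (comap_measurable _)).comap_le
  · rw [canonFiltration, Filtration.natural]
    simp only [MeasurableSpace.comap_iSup, MeasurableSpace.comap_comp]
    refine iSup₂_le fun r hr ↦ ?_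
    refine Measurable.comap_le ?_
    have hmeas {t : ℝ≥0} (ht : t ≤ canonTime l v) : Measurable[F (canonTime l v)] (bridge B s y t) :=
      (hadp t).measurable.mono (F.mono ht) le_rfl
    by_cases h1 : r ≤ 1
    · rw [show canonObs d r ∘ canonMap B l d s y =
          fun ω ↦ (√(l : ℝ))⁻¹ * (bridge B s y (l * r) ω - y) from
        funext fun ω ↦ canonObs_canonMap_of_le B hl hs y h1 ω]
      refine ((hmeas ?_).sub_const y).const_mul _
      exact le_trans (by rw [canonTime, if_pos h1]) (monotone_canonTime l hr)
    · have h1' := lt_of_not_ge h1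
      rw [show canonObs d r ∘ canonMap B l d s y = fun ω ↦ bridge B s y (l + (r - 1)) ω -
          bridge B s y l ω * (1 - (r - 1 : ℝ≥0) / d) from
        funext fun ω ↦ canonObs_canonMap_of_lt B hl hd hs y h1' (hr.trans hvd) ω]
      refine (hmeas ?_).sub ((hmeas ?_).mul_const _)
      · exact le_trans (by rw [canonTime, if_neg h1]) (monotone_canonTime l hr)
      · exact le_trans (canonTime_one l).ge (monotone_canonTime l (h1'.le.trans hr))

end Map

end RandomizedBridge

/-! ### Stopping rules on a time grid -/

namespace RandomizedBridge

/-- The `k`-th of the `n + 1` points of the uniform grid on the canonical interval `[0, 1 + d]`. -/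
noncomputable def gridTime (d : ℝ≥0) (n k : ℕ) : ℝ≥0 := (1 + d) * (k / n)

theorem gridTime_zero (d : ℝ≥0) (n : ℕ) : gridTime d n 0 = 0 := by simp [gridTime]

theorem gridTime_self (d : ℝ≥0) {n : ℕ} (hn : n ≠ 0) : gridTime d n n = 1 + d := by
  simp [gridTime, hn]

theorem monotone_gridTime (d : ℝ≥0) (n : ℕ) : Monotone (gridTime d n) := fun i j h ↦ by
  unfold gridTime
  gcongr

theorem gridTime_le (d : ℝ≥0) {n k : ℕ} (hk : k ≤ n) : gridTime d n k ≤ 1 + d := by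
  unfold gridTime
  refine mul_le_of_le_one_right zero_le (div_le_one_of_le₀ ?_ zero_le)
  exact_mod_cast hk

theorem gridTime_succ_sub (d : ℝ≥0) (n k : ℕ) :
    (gridTime d n (k + 1) : ℝ) - gridTime d n k = (1 + d) / n := by
  unfold gridTime
  push_cast
  ring

/-- A stopping rule on the time grid: `τ e` is the index of the grid point at which to stop, and
the decision to stop at a grid point is based on the canonical observations up to that point. -/
structure IsGridRule (d : ℝ≥0) (n : ℕ) (τ : Canon → ℕ) : Prop where
  le : ∀ e, τ e ≤ n
  measurableSet_eq : ∀ k ≤ n, MeasurableSet[canonFiltration d (gridTime d n k)] {e | τ e = k}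

theorem IsGridRule.measurable {d : ℝ≥0} {n : ℕ} {τ : Canon → ℕ} (hτ : IsGridRule d n τ) :
    Measurable τ := by
  refine measurable_to_countable' fun k ↦ ?_
  by_cases hk : k ≤ n
  · exact (canonFiltration d).le _ _ (hτ.measurableSet_eq k hk)
  · rw [show τ ⁻¹' {k} = ∅ from eq_empty_of_forall_notMem fun e he ↦ hk (he ▸ hτ.le e)]
    exact MeasurableSet.empty

/-- The payoff for stopping at the canonical time `v`, for a gain function with coefficients
`a₀`, `a₁`. -/
noncomputable def canonPayoff (a₀ a₁ : ℝ → ℝ) (l d : ℝ≥0) (s y : ℝ) (v : ℝ≥0) (e : Canon) : ℝ :=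
  a₀ (s + canonTime l v) + a₁ (s + canonTime l v) * canonBridge l d y v e

theorem measurable_canonPayoff (a₀ a₁ : ℝ → ℝ) (l d : ℝ≥0) (s y : ℝ) (v : ℝ≥0) :
    Measurable (canonPayoff a₀ a₁ l d s y v) :=
  ((measurable_canonBridge l d y v).const_mul _).const_add _

theorem measurable_eval_index {E : Type*} [MeasurableSpace E] {f : ℕ → E → ℝ} {τ : E → ℕ}
    (hτ : Measurable τ) (hf : ∀ k, Measurable (f k)) : Measurable fun e ↦ f (τ e) e := by
  have h : Measurable fun p : ℕ × E ↦ f p.1 p.2 := measurable_from_prod_countable_right hf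
  exact h.comp (hτ.prodMk measurable_id)

theorem IsGridRule.measurable_canonPayoff {d : ℝ≥0} {n : ℕ} {τ : Canon → ℕ}
    (hτ : IsGridRule d n τ) (a₀ a₁ : ℝ → ℝ) (l : ℝ≥0) (s y : ℝ) :
    Measurable fun e ↦ canonPayoff a₀ a₁ l d s y (gridTime d n (τ e)) e :=
  measurable_eval_index (f := fun k e ↦ canonPayoff a₀ a₁ l d s y (gridTime d n k) e)
    hτ.measurable fun k ↦ RandomizedBridge.measurable_canonPayoff a₀ a₁ l d s y (gridTime d n k)

section Transfer

variable {Ω : Type*} {B : ℝ≥0 → Ω → ℝ}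

/-- The stopping time of the randomized bridge defined by a grid rule. -/
noncomputable def ruleTime (B : ℝ≥0 → Ω → ℝ) (l d : ℝ≥0) (s y : ℝ) (n : ℕ) (τ : Canon → ℕ)
    (ω : Ω × ℝ) : WithTop ℝ≥0 :=
  (canonTime l (gridTime d n (τ (canonMap B l d s y ω))) : ℝ≥0)

theorem payoff_ruleTime (α β ζ : ℝ → ℝ) (T : ℝ) {l d : ℝ≥0} (hl : 0 < l) (hd : 0 < d)
    {s : ℝ} (hs : (l : ℝ) + d = 1 - s) (y : ℝ) {n : ℕ} {τ : Canon → ℕ}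
    (hτ : IsGridRule d n τ) (ω : Ω × ℝ) :
    payoff α β ζ T B s y (ruleTime B l d s y n τ) ω =
      canonPayoff (gainShift α β ζ T) (gainSlope β ζ T) l d s y
        (gridTime d n (τ (canonMap B l d s y ω))) (canonMap B l d s y ω) := by
  change gain α β ζ T (s + canonTime l (gridTime d n (τ (canonMap B l d s y ω))))
    (bridge B s y (canonTime l (gridTime d n (τ (canonMap B l d s y ω)))) ω) = _
  rw [gain, canonPayoff, bridge_canonTime B hl hd hs y (gridTime_le d (hτ.le _))]

variable [MeasurableSpace Ω]

theorem IsGridRule.isAdmissible (hB : ∀ u, Measurable (B u)) {l d : ℝ≥0} (hl : 0 < l) (hd : 0 < d)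
    {s : ℝ} (hs : (l : ℝ) + d = 1 - s) (y : ℝ) {n : ℕ} {τ : Canon → ℕ}
    (hτ : IsGridRule d n τ) : IsAdmissible hB s y (ruleTime B l d s y n τ) := by
  refine ⟨fun t ↦ ?_, fun ω ↦ ?_⟩
  · have e : {ω | ruleTime B l d s y n τ ω ≤ t} =
        ⋃ k ∈ {k | k ≤ n ∧ canonTime l (gridTime d n k) ≤ t},
          canonMap B l d s y ⁻¹' {e | τ e = k} := by
      ext ω
      simp only [ruleTime, WithTop.coe_le_coe, mem_ofPred_eq, mem_iUnion, mem_preimage, exists_prop]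
      exact ⟨fun h ↦ ⟨_, ⟨hτ.le _, h⟩, rfl⟩, fun ⟨k, hk, hk'⟩ ↦ hk' ▸ hk.2⟩
    rw [e]
    refine MeasurableSet.biUnion (to_countable _) fun k hk ↦ ?_
    refine (Filtration.natural (bridge B s y) (stronglyMeasurable_bridge hB s y)).mono hk.2 _ ?_
    rw [natural_bridge_eq_comap hB hl hd hs y (gridTime_le d hk.1)]
    exact ⟨_, hτ.measurableSet_eq k hk.1, rfl⟩
  · rw [ruleTime, WithTop.coe_le_coe, ← hs, ← NNReal.coe_add, Real.toNNReal_coe,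
      ← canonTime_one_add hd]
    exact monotone_canonTime l (gridTime_le d (hτ.le _))

/-- Rounding up an admissible stopping time to the grid gives a grid rule. -/
theorem exists_isGridRule_of_isAdmissible (hB : ∀ u, Measurable (B u)) {l d : ℝ≥0} (hl : 0 < l)
    (hl1 : l ≤ 1) (hd : 0 < d) {s : ℝ} (hs : (l : ℝ) + d = 1 - s) (y : ℝ)
    {σ : Ω × ℝ → WithTop ℝ≥0} (hσ : IsAdmissible hB s y σ) {n : ℕ} (hn : n ≠ 0) :
    ∃ τ, IsGridRule d n τ ∧ ∀ ω,
      |(canonTime l (gridTime d n (τ (canonMap B l d s y ω))) : ℝ) - (σ ω).untopA| ≤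
        (1 + d) / n := by
  classical
  have hA (j : ℕ) (hj : j ≤ n) : ∃ A, MeasurableSet[canonFiltration d (gridTime d n j)] A ∧
      canonMap B l d s y ⁻¹' A = {ω | σ ω ≤ canonTime l (gridTime d n j)} := by
    have h := hσ.1 (canonTime l (gridTime d n j))
    rw [natural_bridge_eq_comap hB hl hd hs y (gridTime_le d hj)] at h
    exact h
  choose! A hAm hA using hA
  -- `A j` is the canonical form of the event that `σ` has occurred by the `j`-th grid point; the
  -- rule stops at the first `j` for which this is the case
  have hex (e : Canon) : ∃ j, e ∈ A j ∨ j = n := ⟨n, .inr rfl⟩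
  refine ⟨fun e ↦ Nat.find (hex e), ⟨fun e ↦ Nat.find_min' _ (.inr rfl), fun k hk ↦ ?_⟩,
    fun ω ↦ ?_⟩
  · have e1 : {e | Nat.find (hex e) = k} =
        (A k ∪ {_e | k = n}) ∩ ⋂ j ∈ {j | j < k}, (A j)ᶜ := by
      ext e
      simp only [mem_ofPred_eq, Nat.find_eq_iff, mem_inter_iff, mem_union, mem_iInter, mem_compl_iff,
        not_or]
      refine and_congr_right fun _ ↦ forall₂_congr fun j hj ↦ ?_
      exact and_iff_left (hj.trans_le hk).ne
    rw [e1]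
    refine ((hAm k hk).union (MeasurableSet.const _)).inter
      (MeasurableSet.biInter (to_countable _) fun j hj ↦ ?_)
    exact (canonFiltration d).mono (monotone_gridTime d n (le_of_lt hj)) _
      (hAm j ((le_of_lt hj).trans hk)).compl
  · set k := Nat.find (hex (canonMap B l d s y ω)) with hk
    have hkn : k ≤ n := Nat.find_min' _ (.inr rfl)
    have hmem (j : ℕ) (hj : j ≤ n) :
        canonMap B l d s y ω ∈ A j ↔ σ ω ≤ canonTime l (gridTime d n j) := by
      rw [← mem_preimage, hA j hj]; rfl
    have hσ' : σ ω ≤ (l + d : ℝ≥0) := by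
      have := hσ.2 ω
      rwa [← hs, ← NNReal.coe_add, Real.toNNReal_coe] at this
    obtain ⟨t, ht⟩ := WithTop.ne_top_iff_exists.1 (hσ'.trans_lt (WithTop.coe_lt_top _)).ne
    rw [← ht] at hσ' hmem ⊢
    simp only [WithTop.coe_le_coe] at hσ' hmem
    rw [show (t : WithTop ℝ≥0).untopA = t from rfl]
    have hle : t ≤ canonTime l (gridTime d n k) := by
      rcases Nat.find_spec (hex (canonMap B l d s y ω)) with h | h
      · exact (hmem k hkn).1 h
      · rw [← hk] at h
        rw [h, gridTime_self d hn, canonTime_one_add hd]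
        exact hσ'
    have hle' : (t : ℝ) ≤ canonTime l (gridTime d n k) := hle
    rw [abs_of_nonneg (sub_nonneg.2 hle')]
    rcases Nat.eq_zero_or_pos k with h0 | hpos
    · rw [h0, gridTime_zero, canonTime_zero, NNReal.coe_zero]
      have : (0 : ℝ) ≤ (1 + d) / n := by positivity
      linarith [t.2]
    · obtain ⟨j, hj⟩ := Nat.exists_eq_succ_of_ne_zero hpos.ne'
      have hnot : ¬ (canonMap B l d s y ω ∈ A j ∨ j = n) :=
        Nat.find_min (hex (canonMap B l d s y ω)) (by rw [← hk, hj]; exact j.lt_succ_self)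
      have hlt : canonTime l (gridTime d n j) < t :=
        lt_of_not_ge fun h ↦ hnot (.inl ((hmem j (by omega)).2 h))
      have hlt' : (canonTime l (gridTime d n j) : ℝ) < t := hlt
      have h1 := canonTime_sub_le hl1 (monotone_gridTime d n j.le_succ)
      have h2 := gridTime_succ_sub d n j
      rw [hj]
      simp only [Nat.succ_eq_add_one] at h1 ⊢
      linarith

end Transfer

end RandomizedBridge

/-! ### The law of the canonical sample point -/

namespace RandomizedBridge

theorem pinExponent_le (x₀ : ℝ) {s : ℝ} (hs : s ∈ Ico (0 : ℝ) 1) (y z : ℝ) :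
    pinExponent x₀ s y z ≤ (y - x₀) * z + x₀ ^ 2 / 2 := by
  have h : (z - y) ^ 2 / 2 ≤ (z - y) ^ 2 / (2 * (1 - s)) := by
    have := hs.1
    have := hs.2
    gcongr
    linarith
  unfold pinExponent
  nlinarith [sq_nonneg y]

theorem integrable_exp_pinExponent {p : Measure ℝ} [IsProbabilityMeasure p]
    (hexp : ∀ t, Integrable (fun z : ℝ ↦ Real.exp (t * z)) p) (x₀ : ℝ) {s : ℝ}
    (hs : s ∈ Ico (0 : ℝ) 1) (y : ℝ) :
    Integrable (fun z ↦ Real.exp (pinExponent x₀ s y z)) p := by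
  refine ((hexp (y - x₀)).mul_const (Real.exp (x₀ ^ 2 / 2))).mono' (by fun_prop)
    (.of_forall fun z ↦ ?_)
  rw [Real.norm_of_nonneg (Real.exp_pos _).le, ← Real.exp_add, Real.exp_le_exp]
  exact pinExponent_le x₀ hs y z

/-- The exponent of the joint density of the standardized displacement and the pinning point with
respect to Lebesgue measure times the terminal law. -/
noncomputable def jointExponent (x₀ : ℝ) (l d : ℝ≥0) (y : ℝ) (p : ℝ × ℝ) : ℝ :=
  -p.1 ^ 2 / 2 - (p.2 - y - √(l : ℝ) * p.1) ^ 2 / (2 * d) + (p.2 - x₀) ^ 2 / 2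

@[fun_prop]
theorem continuous_jointExponent (x₀ : ℝ) (l d : ℝ≥0) (y : ℝ) :
    Continuous (jointExponent x₀ l d y) := by
  unfold jointExponent
  fun_prop

/-- Completing the square: given the pinning point `z`, the standardized displacement is normal
with mean `√l (z - y) / (1 - s)` and variance `d / (1 - s)`. -/
theorem jointExponent_eq (x₀ : ℝ) {l d : ℝ≥0} (hl : 0 < l) (hd : 0 < d) {s : ℝ}
    (hs : (l : ℝ) + d = 1 - s) (y w z : ℝ) :
    jointExponent x₀ l d y (w, z) =
      -(w - √(l : ℝ) / (1 - s) * (z - y)) ^ 2 / (2 * (d / (1 - s))) + pinExponent x₀ s y z := by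
  have hl' : (0 : ℝ) < l := hl
  have hd' : (0 : ℝ) < d := hd
  have hsq : √(l : ℝ) ^ 2 = l := Real.sq_sqrt l.2
  unfold jointExponent pinExponent
  rw [← hs]
  set q := √(l : ℝ)
  rw [← hsq]
  have : q ^ 2 + (d : ℝ) ≠ 0 := by positivity
  field_simp
  ring

/-- The joint law of the standardized displacement and the pinning point: adding the conditional
mean to an independent centred normal variable of variance `d / (l + d)` produces the density with
exponent `jointExponent`. -/
theorem map_shear_eq_tilted {p : Measure ℝ} [IsProbabilityMeasure p] (x₀ : ℝ) {l d : ℝ≥0}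
    (hl : 0 < l) (hd : 0 < d) {s : ℝ} (hs : (l : ℝ) + d = 1 - s) (y : ℝ)
    (hint : Integrable (fun z ↦ Real.exp (pinExponent x₀ s y z)) p) :
    ((gaussianReal 0 (d / (l + d))).prod (p.tilted (pinExponent x₀ s y))).map
      (fun q ↦ (√(l : ℝ) / (1 - s) * (q.2 - y) + q.1, q.2)) =
      ((volume : Measure ℝ).prod p).tilted (jointExponent x₀ l d y) ∧
    Integrable (fun q ↦ Real.exp (jointExponent x₀ l d y q)) ((volume : Measure ℝ).prod p) := by
  have hprob := isProbabilityMeasure_tilted hint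
  set r : ℝ≥0 := d / (l + d) with hr
  have hr0 : r ≠ 0 := by positivity
  have hrr : (r : ℝ) = d / (1 - s) := by rw [hr, ← hs]; push_cast; rfl
  set Φ : ℝ × ℝ → ℝ × ℝ := fun q ↦ (√(l : ℝ) / (1 - s) * (q.2 - y) + q.1, q.2) with hΦ
  have hΦm : Measurable Φ := by fun_prop
  set c := ∫ z, Real.exp (pinExponent x₀ s y z) ∂p with hc
  have hc0 : 0 < c := integral_exp_pos hint
  set C : ℝ := (√(2 * Real.pi * r))⁻¹ / c with hC
  have hC0 : 0 < C := by
    have : (0 : ℝ) < r := by positivity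
    positivity
  set ρ := ((gaussianReal 0 r).prod (p.tilted (pinExponent x₀ s y))).map Φ with hρ
  have hρprob : IsProbabilityMeasure ρ := Measure.isProbabilityMeasure_map hΦm.aemeasurable
  have hdens : ρ = ((volume : Measure ℝ).prod p).withDensity
      fun q ↦ ENNReal.ofReal (C * Real.exp (jointExponent x₀ l d y q)) := by
    refine Measure.ext_of_lintegral _ fun f hf ↦ ?_
    have hfΦ : Measurable fun q ↦ f (Φ q) := hf.comp hΦm
    rw [hρ, lintegral_map hf hΦm, lintegral_prod_symm' _ hfΦ, lintegral_tilted,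
      lintegral_withDensity_eq_lintegral_mul _ (by fun_prop) hf,
      lintegral_prod_symm' _ (by fun_prop)]
    refine lintegral_congr fun z ↦ ?_
    rw [gaussianReal_of_var_ne_zero _ hr0,
      lintegral_withDensity_eq_lintegral_mul _ (measurable_gaussianPDF _ _) (by fun_prop),
      ← lintegral_const_mul _ (by fun_prop)]
    rw [← lintegral_sub_right_eq_self _ (√(l : ℝ) / (1 - s) * (z - y))]
    refine lintegral_congr fun w ↦ ?_
    simp only [Pi.mul_apply, hΦ, add_sub_cancel, gaussianPDF]
    rw [← mul_assoc, ← ENNReal.ofReal_mul (by positivity)]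
    congr 2
    rw [jointExponent_eq x₀ hl hd hs, Real.exp_add, hC, gaussianPDFReal_def, ← hrr, ← hc]
    simp only [sub_zero]
    ring
  have hone : ∫⁻ q, ENNReal.ofReal (C * Real.exp (jointExponent x₀ l d y q))
      ∂((volume : Measure ℝ).prod p) = 1 := by
    have h := measure_univ (μ := ρ)
    rwa [hdens, withDensity_apply _ MeasurableSet.univ, setLIntegral_univ] at h
  have hintC : Integrable (fun q ↦ C * Real.exp (jointExponent x₀ l d y q))
      ((volume : Measure ℝ).prod p) := by
    refine ⟨by fun_prop, ?_⟩
    rw [hasFiniteIntegral_iff_ofReal (.of_forall fun q ↦ by positivity), hone]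
    exact ENNReal.one_lt_top
  have hJ : Integrable (fun q ↦ Real.exp (jointExponent x₀ l d y q))
      ((volume : Measure ℝ).prod p) := by
    simpa [← mul_assoc, hC0.ne'] using hintC.const_mul C⁻¹
  refine ⟨?_, hJ⟩
  have hval : C * ∫ q, Real.exp (jointExponent x₀ l d y q) ∂((volume : Measure ℝ).prod p) = 1 := by
    rw [← ofReal_integral_eq_lintegral_ofReal hintC (.of_forall fun q ↦ by positivity),
      integral_const_mul] at hone
    simpa using hone
  rw [hdens, Measure.tilted]
  congr 1
  funext q
  rw [eq_comm, div_eq_mul_inv, ← eq_inv_of_mul_eq_one_left hval, mul_comm]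

/-- The standardized displacement is the sum of its conditional mean given the pinning point and a
combination of the increments of `B` over the two pieces. -/
theorem displacement_eq {Ω : Type*} (B : ℝ≥0 → Ω → ℝ) {l d : ℝ≥0} (hl : 0 < l) (hd : 0 < d) {s : ℝ}
    (hs : (l : ℝ) + d = 1 - s) (y : ℝ) (ω : Ω × ℝ) :
    (√(l : ℝ))⁻¹ * (bridge B s y l ω - y) = √(l : ℝ) / (1 - s) * (ω.2 - y) +
      (d / (1 - s) * headPath B l 1 ω.1 + -(√(l : ℝ) / (1 - s)) * tailPath B l d ω.1) := by
  have hl' : (0 : ℝ) < l := hl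
  have hd' : (0 : ℝ) < d := hd
  have hsq : √(l : ℝ) ^ 2 = l := Real.sq_sqrt l.2
  have hq : 0 < √(l : ℝ) := Real.sqrt_pos.2 hl'
  have hDn : (1 - s).toNNReal = l + d := by
    rw [← hs, ← NNReal.coe_add, Real.toNNReal_coe]
  simp only [bridge, headPath, tailPath, hDn, mul_one]
  rw [← hs]
  set q := √(l : ℝ)
  rw [← hsq]
  have : q ^ 2 + (d : ℝ) ≠ 0 := by positivity
  field_simp
  ring

section Law

variable {Ω : Type*} [MeasurableSpace Ω] {P : Measure Ω} {B : ℝ≥0 → Ω → ℝ}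

/-- The law of the canonical sample point: the two bridges are independent of each other and of
the pair of the displacement and the pinning point, and only the law of this pair depends on the
starting point. -/
theorem map_canonMap_eq (hB : ∀ u, Measurable (B u)) (hBM : IsPreBrownianReal B P) {ν : ℝ → ℝ}
    (hν_meas : Measurable ν) (hν_nonneg : ∀ z, 0 ≤ ν z) [IsProbabilityMeasure (terminalLaw ν)]
    (x₀ : ℝ) {l d : ℝ≥0} (hl : 0 < l) (hd : 0 < d) {s : ℝ} (hs : (l : ℝ) + d = 1 - s) (y : ℝ)
    (hint : Integrable (fun z ↦ Real.exp (pinExponent x₀ s y z)) (terminalLaw ν)) :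
    (bridgeMeasure P ν x₀ s y).map (canonMap B l d s y) =
      ((bridgeLaw P B 1).prod (bridgeLaw P B d)).prod
        (((volume : Measure ℝ).prod (terminalLaw ν)).tilted (jointExponent x₀ l d y)) := by
  have := hBM.isGaussianProcess.isProbabilityMeasure
  have hκ₁ := isProbabilityMeasure_bridgeLaw (P := P) hB 1
  have hκ₂ := isProbabilityMeasure_bridgeLaw (P := P) hB d
  have hD : (0 : ℝ) < 1 - s := by
    rw [← hs]
    exact_mod_cast add_pos hl hd
  have hprob := isProbabilityMeasure_tilted hint
  have hpin := pinningLaw_eq_tilted hν_meas hν_nonneg x₀ (by linarith : s < 1) y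
  set pin := (terminalLaw ν).tilted (pinExponent x₀ s y)
  set κ := (bridgeLaw P B 1).prod (bridgeLaw P B d)
  have hr : ((d / (l + d) : ℝ≥0) : ℝ) = (d / (1 - s)) ^ 2 + (-(√(l : ℝ) / (1 - s))) ^ 2 * d := by
    have hd' : (0 : ℝ) < d := hd
    have hne : (l : ℝ) + d ≠ 0 := by positivity
    rw [neg_sq, div_pow (√(l : ℝ)), Real.sq_sqrt (NNReal.coe_nonneg l), ← hs]
    push_cast
    field_simp
    ring
  set ψ : Ω → ((ℝ≥0 → ℝ) × (ℝ≥0 → ℝ)) × ℝ := fun ω ↦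
    ((bridgePath 1 (headPath B l · ω), bridgePath d (tailPath B l · ω)),
      d / (1 - s) * headPath B l 1 ω + -(√(l : ℝ) / (1 - s)) * tailPath B l d ω) with hψ
  have hψm : Measurable ψ :=
    ((measurable_bridgePath_comp (measurable_headPath hB l) 1).prodMk
      (measurable_bridgePath_comp (measurable_tailPath hB l) d)).prodMk
      (((measurable_headPath hB l 1).const_mul _).add ((measurable_tailPath hB l d).const_mul _))
  have h1 : MeasurePreserving ψ P (κ.prod (gaussianReal 0 (d / (l + d)))) :=
    ⟨hψm, map_bridges_eq hBM hB hl hd _ _ hr⟩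
  have h2 := h1.prod (MeasurePreserving.id pin)
  have h3 := measurePreserving_prodAssoc κ (gaussianReal 0 (d / (l + d))) pin
  have h4 := (MeasurePreserving.id κ).prod
    (⟨by fun_prop, (map_shear_eq_tilted x₀ hl hd hs y hint).1⟩ :
      MeasurePreserving (fun q : ℝ × ℝ ↦ (√(l : ℝ) / (1 - s) * (q.2 - y) + q.1, q.2))
        ((gaussianReal 0 (d / (l + d))).prod pin)
        (((volume : Measure ℝ).prod (terminalLaw ν)).tilted (jointExponent x₀ l d y)))
  rw [bridgeMeasure, hpin, ← (h4.comp (h3.comp h2)).map_eq]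
  congr 1
  funext ω
  simp only [canonMap, displacement_eq B hl hd hs y ω]
  rfl

theorem prod_tilted_snd {α β : Type*} [MeasurableSpace α] [MeasurableSpace β] (κ : Measure α)
    [IsProbabilityMeasure κ] (m : Measure β) [SFinite m] {f : β → ℝ} (hf : Measurable f) :
    κ.prod (m.tilted f) = (κ.prod m).tilted fun q ↦ f q.2 := by
  have h : ∫ q : α × β, Real.exp (f q.2) ∂κ.prod m = ∫ x, Real.exp (f x) ∂m := by
    rw [integral_fun_snd (f := fun x ↦ Real.exp (f x))]
    simp
  rw [Measure.tilted, Measure.tilted, h, prod_withDensity_right (by fun_prop)]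

/-- The sample space on which the expected payoffs are compared: two independent Brownian motions,
the displacement and the pinning point. Its reference measure does not depend on the starting
point. -/
noncomputable def refMeasure (P : Measure Ω) (ν : ℝ → ℝ) : Measure ((Ω × Ω) × (ℝ × ℝ)) :=
  (P.prod P).prod ((volume : Measure ℝ).prod (terminalLaw ν))

/-- The canonical sample point obtained from two Brownian motions, a displacement and a pinning
point. -/
noncomputable def refMap (B : ℝ≥0 → Ω → ℝ) (d : ℝ≥0) (x : (Ω × Ω) × (ℝ × ℝ)) : Canon :=
  ((bridgePath 1 (B · x.1.1), bridgePath d (B · x.1.2)), x.2)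

theorem measurable_refMap (hB : ∀ u, Measurable (B u)) (d : ℝ≥0) : Measurable (refMap B d) :=
  ((((measurable_bridgePath_comp hB 1).comp measurable_fst).prodMk
    ((measurable_bridgePath_comp hB d).comp measurable_snd)).comp measurable_fst).prodMk
      measurable_snd

/-- Expectations under the law of the randomized bridge as integrals with respect to the reference
measure. -/
theorem integral_canonMap_eq (hB : ∀ u, Measurable (B u)) (hBM : IsPreBrownianReal B P) {ν : ℝ → ℝ}
    (hν_meas : Measurable ν) (hν_nonneg : ∀ z, 0 ≤ ν z) [IsProbabilityMeasure (terminalLaw ν)]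
    (x₀ : ℝ) {l d : ℝ≥0} (hl : 0 < l) (hd : 0 < d) {s : ℝ} (hs : (l : ℝ) + d = 1 - s) (y : ℝ)
    (hint : Integrable (fun z ↦ Real.exp (pinExponent x₀ s y z)) (terminalLaw ν))
    {F : Canon → ℝ} (hF : Measurable F) :
    ∫ ω, F (canonMap B l d s y ω) ∂bridgeMeasure P ν x₀ s y =
      (∫ x, Real.exp (jointExponent x₀ l d y x.2) * F (refMap B d x) ∂refMeasure P ν) /
        ∫ q, Real.exp (jointExponent x₀ l d y q) ∂((volume : Measure ℝ).prod (terminalLaw ν)) := by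
  have := hBM.isGaussianProcess.isProbabilityMeasure
  have hκ₁ := isProbabilityMeasure_bridgeLaw (P := P) hB 1
  have hκ₂ := isProbabilityMeasure_bridgeLaw (P := P) hB d
  set m := (volume : Measure ℝ).prod (terminalLaw ν) with hm
  have href : (refMeasure P ν).map (refMap B d) =
      ((bridgeLaw P B 1).prod (bridgeLaw P B d)).prod m := by
    have h1 : MeasurePreserving (fun ω ↦ bridgePath 1 (B · ω)) P (bridgeLaw P B 1) :=
      ⟨measurable_bridgePath_comp hB 1, rfl⟩
    have h2 : MeasurePreserving (fun ω ↦ bridgePath d (B · ω)) P (bridgeLaw P B d) :=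
      ⟨measurable_bridgePath_comp hB d, rfl⟩
    exact ((h1.prod h2).prod (MeasurePreserving.id m)).map_eq
  have hsnd : ∫ q : ((ℝ≥0 → ℝ) × (ℝ≥0 → ℝ)) × (ℝ × ℝ), Real.exp (jointExponent x₀ l d y q.2)
      ∂((bridgeLaw P B 1).prod (bridgeLaw P B d)).prod m =
      ∫ q, Real.exp (jointExponent x₀ l d y q) ∂m := by
    rw [integral_fun_snd (f := fun x ↦ Real.exp (jointExponent x₀ l d y x))]
    simp
  rw [← integral_map (measurable_canonMap hB l d s y).aemeasurable hF.aestronglyMeasurable,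
    map_canonMap_eq hB hBM hν_meas hν_nonneg x₀ hl hd hs y hint,
    prod_tilted_snd _ _ (continuous_jointExponent x₀ l d y).measurable, integral_tilted, hsnd,
    ← href, integral_map (measurable_refMap hB d).aemeasurable
      (Measurable.aestronglyMeasurable (by fun_prop)), ← integral_div]
  refine integral_congr_ae (.of_forall fun x ↦ ?_)
  simp only [smul_eq_mul, refMap]
  ring

end Law

end RandomizedBridge

/-! ### Pointwise bounds for the payoff and the joint density -/

namespace RandomizedBridge

theorem abs_canonObs_le {d v : ℝ≥0} (hd : 0 < d) (hv : v ≤ 1 + d) {e : Canon} {S₁ S₂ : ℝ}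
    (h₁ : ∀ u, |e.1.1 u| ≤ S₁) (h₂ : ∀ u, |e.1.2 u| ≤ S₂) :
    |canonObs d v e| ≤ |e.2.1| + |e.2.2| + S₁ + S₂ := by
  have hS₁ := (abs_nonneg _).trans (h₁ 0)
  have hS₂ := (abs_nonneg _).trans (h₂ 0)
  unfold canonObs
  split_ifs with h
  · have hv0 : (v : ℝ) ≤ 1 := h
    have h3 : |e.2.1 * v| ≤ |e.2.1| := by
      rw [abs_mul, NNReal.abs_eq]
      exact mul_le_of_le_one_right (abs_nonneg _) hv0
    linarith [abs_add_le (e.2.1 * v) (e.1.1 v), h₁ v, abs_nonneg e.2.2]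
  · have hu : ((v - 1 : ℝ≥0) : ℝ) / d ≤ 1 := by
      refine div_le_one_of_le₀ ?_ d.2
      exact_mod_cast tsub_le_iff_left.2 hv
    have h3 : |e.2.2 * (((v - 1 : ℝ≥0) : ℝ) / d)| ≤ |e.2.2| := by
      rw [abs_mul, abs_of_nonneg (by positivity : (0 : ℝ) ≤ ((v - 1 : ℝ≥0) : ℝ) / d)]
      exact mul_le_of_le_one_right (abs_nonneg _) hu
    linarith [abs_add_le (e.2.2 * (((v - 1 : ℝ≥0) : ℝ) / d)) (e.1.2 (v - 1)), h₂ (v - 1),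
      abs_nonneg e.2.1]

theorem abs_canonBridge_le {l d v : ℝ≥0} (hl : l ≤ 1) (hv : v ≤ 1 + d) {e : Canon}
    {N : ℝ} (hN : ∀ u ≤ 1 + d, |canonObs d u e| ≤ N) (y : ℝ) :
    |canonBridge l d y v e| ≤ |y| + 2 * N := by
  have hN0 := (abs_nonneg _).trans (hN 0 zero_le)
  have hr : √(l : ℝ) ≤ 1 := Real.sqrt_le_one.2 hl
  have hr0 := Real.sqrt_nonneg (l : ℝ)
  have key (u : ℝ≥0) (hu : u ≤ 1 + d) : |y + √(l : ℝ) * canonObs d u e| ≤ |y| + N := by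
    refine (abs_add_le _ _).trans ?_
    rw [abs_mul, abs_of_nonneg hr0]
    nlinarith [hN u hu, abs_nonneg (canonObs d u e)]
  unfold canonBridge
  split_ifs with h
  · linarith [key v hv]
  · have hu : ((v - 1 : ℝ≥0) : ℝ) / d ≤ 1 := by
      refine div_le_one_of_le₀ ?_ d.2
      exact_mod_cast tsub_le_iff_left.2 hv
    have hu0 : (0 : ℝ) ≤ ((v - 1 : ℝ≥0) : ℝ) / d := by positivity
    refine (abs_add_le _ _).trans ?_
    rw [abs_mul, abs_of_nonneg (sub_nonneg.2 hu)]
    nlinarith [key 1 le_self_add, hN v hv, abs_nonneg (y + √(l : ℝ) * canonObs d 1 e)]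

theorem abs_canonBridge_sub_le {l₁ l₂ d v : ℝ≥0} (hv : v ≤ 1 + d) {e : Canon}
    {N : ℝ} (hN : ∀ u ≤ 1 + d, |canonObs d u e| ≤ N) (y₁ y₂ : ℝ) :
    |canonBridge l₁ d y₁ v e - canonBridge l₂ d y₂ v e| ≤
      |y₁ - y₂| + |√(l₁ : ℝ) - √(l₂ : ℝ)| * N := by
  have key (u : ℝ≥0) (hu : u ≤ 1 + d) :
      |(y₁ - y₂) + (√(l₁ : ℝ) - √(l₂ : ℝ)) * canonObs d u e| ≤
        |y₁ - y₂| + |√(l₁ : ℝ) - √(l₂ : ℝ)| * N := by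
    refine (abs_add_le _ _).trans ?_
    rw [abs_mul]
    gcongr
    exact hN u hu
  unfold canonBridge
  split_ifs with h
  · refine le_trans (le_of_eq ?_) (key v hv)
    congr 1
    ring
  · have hu : ((v - 1 : ℝ≥0) : ℝ) / d ≤ 1 := by
      refine div_le_one_of_le₀ ?_ d.2
      exact_mod_cast tsub_le_iff_left.2 hv
    have hu0 : (0 : ℝ) ≤ ((v - 1 : ℝ≥0) : ℝ) / d := by positivity
    have e1 : (y₁ + √(l₁ : ℝ) * canonObs d 1 e) * (1 - (v - 1 : ℝ≥0) / d) + canonObs d v e -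
        ((y₂ + √(l₂ : ℝ) * canonObs d 1 e) * (1 - (v - 1 : ℝ≥0) / d) + canonObs d v e) =
        ((y₁ - y₂) + (√(l₁ : ℝ) - √(l₂ : ℝ)) * canonObs d 1 e) * (1 - (v - 1 : ℝ≥0) / d) := by
      ring
    rw [e1, abs_mul, abs_of_nonneg (sub_nonneg.2 hu)]
    exact (mul_le_of_le_one_right (abs_nonneg _) (by linarith)).trans (key 1 le_self_add)

theorem add_canonTime_mem {l d v : ℝ≥0} (hd : 0 < d) (hv : v ≤ 1 + d) {s : ℝ} (hs0 : 0 ≤ s)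
    (hs : (l : ℝ) + d = 1 - s) : s + canonTime l v ∈ Icc (0 : ℝ) 1 := by
  refine ⟨by positivity, ?_⟩
  have h : (canonTime l v : ℝ) ≤ ((l + d : ℝ≥0) : ℝ) := by
    exact_mod_cast (monotone_canonTime l hv).trans_eq (canonTime_one_add hd)
  push_cast at h
  linarith

/-- The clock times that correspond to one canonical time agree up to the difference of the starting
times; on the second piece they are equal, since both bridges end at time `1`. -/
theorem abs_add_canonTime_sub_le {l₁ l₂ d v : ℝ≥0} {s₁ s₂ : ℝ} (hs₁ : (l₁ : ℝ) + d = 1 - s₁)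
    (hs₂ : (l₂ : ℝ) + d = 1 - s₂) :
    |(s₁ + canonTime l₁ v) - (s₂ + canonTime l₂ v)| ≤ |s₁ - s₂| := by
  have h1 : s₁ = 1 - d - l₁ := by linarith
  have h2 : s₂ = 1 - d - l₂ := by linarith
  rw [coe_canonTime, coe_canonTime]
  split_ifs with h
  · have hv : (v : ℝ) ≤ 1 := h
    have e : s₁ + l₁ * v - (s₂ + l₂ * v) = (s₁ - s₂) * (1 - v) := by rw [h1, h2]; ring
    rw [e, abs_mul, abs_of_nonneg (sub_nonneg.2 hv)]
    exact mul_le_of_le_one_right (abs_nonneg _) (by linarith [v.2])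
  · have e : s₁ + (l₁ + ((v : ℝ) - 1)) - (s₂ + (l₂ + ((v : ℝ) - 1))) = 0 := by rw [h1, h2]; ring
    rw [e, abs_zero]
    exact abs_nonneg _

theorem abs_canonPayoff_le {a₀ a₁ : ℝ → ℝ} {A : ℝ} (hA : GainBound a₀ a₁ A) {l d v : ℝ≥0}
    (hd : 0 < d) (hv : v ≤ 1 + d) {s : ℝ} (hs0 : 0 ≤ s) (hs : (l : ℝ) + d = 1 - s) {e : Canon}
    {N : ℝ} (hN : ∀ u ≤ 1 + d, |canonObs d u e| ≤ N) (y : ℝ) :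
    |canonPayoff a₀ a₁ l d s y v e| ≤ A * (1 + |y| + 2 * N) := by
  have hmem := add_canonTime_mem hd hv hs0 hs
  have hl : l ≤ 1 := by
    have : (l : ℝ) ≤ 1 := by linarith [d.2]
    exact this
  have h1 := abs_canonBridge_le hl hv hN y
  refine (abs_add_le _ _).trans ?_
  rw [abs_mul]
  nlinarith [hA.shift_le _ hmem, hA.slope_le _ hmem, hA.pos,
    mul_le_mul (hA.slope_le _ hmem) h1 (abs_nonneg _) hA.pos.le]

theorem abs_canonPayoff_sub_le {a₀ a₁ : ℝ → ℝ} {A : ℝ} (hA : GainBound a₀ a₁ A)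
    {l₁ l₂ d v : ℝ≥0} (hd : 0 < d) (hv : v ≤ 1 + d) {s₁ s₂ : ℝ} (hs₁0 : 0 ≤ s₁) (hs₂0 : 0 ≤ s₂)
    (hs₁ : (l₁ : ℝ) + d = 1 - s₁) (hs₂ : (l₂ : ℝ) + d = 1 - s₂) {e : Canon}
    {N : ℝ} (hN : ∀ u ≤ 1 + d, |canonObs d u e| ≤ N) (y₁ y₂ : ℝ) :
    |canonPayoff a₀ a₁ l₁ d s₁ y₁ v e - canonPayoff a₀ a₁ l₂ d s₂ y₂ v e| ≤
      A * (|s₁ - s₂| * (1 + |y₁| + 2 * N) + (|y₁ - y₂| + |√(l₁ : ℝ) - √(l₂ : ℝ)| * N)) := by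
  have hm₁ := add_canonTime_mem hd hv hs₁0 hs₁
  have hm₂ := add_canonTime_mem hd hv hs₂0 hs₂
  have hl : l₁ ≤ 1 := by
    have : (l₁ : ℝ) ≤ 1 := by linarith [d.2]
    exact this
  have ht := abs_add_canonTime_sub_le hs₁ hs₂ (v := v)
  have hb := abs_canonBridge_le hl hv hN y₁
  have hb2 := abs_canonBridge_sub_le (l₁ := l₁) (l₂ := l₂) hv hN y₁ y₂
  unfold canonPayoff
  set t₁ := s₁ + canonTime l₁ v
  set t₂ := s₂ + canonTime l₂ v
  set Y₁ := canonBridge l₁ d y₁ v e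
  set Y₂ := canonBridge l₂ d y₂ v e
  have hA0 := hA.pos
  have h0 : |a₀ t₁ - a₀ t₂| ≤ A * |s₁ - s₂| :=
    (hA.shift_lip _ hm₁ _ hm₂).trans (by gcongr)
  have h1 : |a₁ t₁ - a₁ t₂| ≤ A * |s₁ - s₂| :=
    (hA.slope_lip _ hm₁ _ hm₂).trans (by gcongr)
  have e1 : a₀ t₁ + a₁ t₁ * Y₁ - (a₀ t₂ + a₁ t₂ * Y₂) =
      (a₀ t₁ - a₀ t₂) + ((a₁ t₁ - a₁ t₂) * Y₁ + a₁ t₂ * (Y₁ - Y₂)) := by ring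
  rw [e1]
  calc _ ≤ |a₀ t₁ - a₀ t₂| + (|a₁ t₁ - a₁ t₂| * |Y₁| + |a₁ t₂| * |Y₁ - Y₂|) := by
        refine (abs_add_le _ _).trans ?_
        gcongr
        refine (abs_add_le _ _).trans ?_
        rw [abs_mul, abs_mul]
    _ ≤ A * |s₁ - s₂| + ((A * |s₁ - s₂|) * (|y₁| + 2 * N) +
          A * (|y₁ - y₂| + |√(l₁ : ℝ) - √(l₂ : ℝ)| * N)) := by
        gcongr
        exact hA.slope_le _ hm₂
    _ = _ := by ring

theorem abs_sqrt_sub_sqrt_le {a b c : ℝ} (hc : 0 < c) (ha : c ≤ a) (hb : c ≤ b) :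
    |√a - √b| ≤ (√c)⁻¹ * |a - b| := by
  have hc' := Real.sqrt_pos.2 hc
  have h1 := Real.sqrt_le_sqrt ha
  have h2 := Real.sqrt_le_sqrt hb
  have e : a - b = (√a - √b) * (√a + √b) := by
    have := Real.mul_self_sqrt (hc.le.trans ha)
    have := Real.mul_self_sqrt (hc.le.trans hb)
    nlinarith
  rw [e, abs_mul, abs_of_nonneg (by positivity : 0 ≤ √a + √b), ← div_eq_inv_mul,
    le_div_iff₀ hc']
  nlinarith [abs_nonneg (√a - √b)]

theorem abs_exp_sub_exp_le (a b : ℝ) :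
    |Real.exp a - Real.exp b| ≤ |a - b| * (Real.exp a + Real.exp b) := by
  wlog h : b ≤ a generalizing a b
  · rw [abs_sub_comm, abs_sub_comm a, add_comm]
    exact this b a (le_of_not_ge h)
  rw [abs_of_nonneg (sub_nonneg.2 (Real.exp_le_exp.2 h)), abs_of_nonneg (sub_nonneg.2 h)]
  have h1 := Real.add_one_le_exp (b - a)
  have h2 : Real.exp b = Real.exp (b - a) * Real.exp a := by rw [← Real.exp_add]; ring_nf
  nlinarith [Real.exp_pos a, Real.exp_pos b, mul_nonneg (sub_nonneg.2 h) (Real.exp_pos b).le]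

theorem abs_jointExponent_sub_le (x₀ : ℝ) {l₁ l₂ d : ℝ≥0} (hd : 0 < d) (hl₁ : l₁ ≤ 1) (hl₂ : l₂ ≤ 1)
    {y₁ y₂ K : ℝ} (hy₁ : |y₁| ≤ K) (hy₂ : |y₂| ≤ K) (p : ℝ × ℝ) :
    |jointExponent x₀ l₁ d y₁ p - jointExponent x₀ l₂ d y₂ p| ≤
      (|y₁ - y₂| + |√(l₁ : ℝ) - √(l₂ : ℝ)| * |p.1|) * ((|p.2| + K + |p.1|) / d) := by
  obtain ⟨w, z⟩ := p
  have hd' : (0 : ℝ) < d := hd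
  have hu {l : ℝ≥0} (hl : l ≤ 1) {y : ℝ} (hy : |y| ≤ K) :
      |z - y - √(l : ℝ) * w| ≤ |z| + K + |w| := by
    have hr : √(l : ℝ) ≤ 1 := Real.sqrt_le_one.2 hl
    have h1 : |√(l : ℝ) * w| ≤ |w| := by
      rw [abs_mul, abs_of_nonneg (Real.sqrt_nonneg _)]
      exact mul_le_of_le_one_left (abs_nonneg _) hr
    linarith [abs_sub (z - y) (√(l : ℝ) * w), abs_sub z y]
  have e : jointExponent x₀ l₁ d y₁ (w, z) - jointExponent x₀ l₂ d y₂ (w, z) =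
      ((y₁ - y₂) + (√(l₁ : ℝ) - √(l₂ : ℝ)) * w) *
        (((z - y₁ - √(l₁ : ℝ) * w) + (z - y₂ - √(l₂ : ℝ) * w)) / (2 * d)) := by
    unfold jointExponent
    simp only
    field_simp
    ring
  rw [e, abs_mul]
  gcongr
  · refine (abs_add_le _ _).trans ?_
    rw [abs_mul]
  · rw [abs_div, abs_of_pos (by positivity : (0 : ℝ) < 2 * d), div_le_div_iff₀ (by positivity) hd']
    have := abs_add_le (z - y₁ - √(l₁ : ℝ) * w) (z - y₂ - √(l₂ : ℝ) * w)
    nlinarith [hu hl₁ hy₁, hu hl₂ hy₂]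

end RandomizedBridge

/-! ### Uniform moments of the joint density -/

namespace RandomizedBridge

/-- The weight `1 + |w| + |z|`, a power of which dominates the payoff and the derivative of the
exponent of the joint density. -/
def momentWeight (p : ℝ × ℝ) : ℝ := 1 + |p.1| + |p.2|

@[fun_prop]
theorem continuous_momentWeight : Continuous momentWeight := by
  unfold momentWeight
  fun_prop

theorem one_le_momentWeight (p : ℝ × ℝ) : 1 ≤ momentWeight p := by
  unfold momentWeight
  linarith [abs_nonneg p.1, abs_nonneg p.2]

theorem integrable_exp_neg_sq_add_abs :
    Integrable fun x : ℝ ↦ Real.exp (-x ^ 2 / 2 + |x|) := by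
  have h := (integrable_exp_neg_mul_sq (b := 1 / 4) (by norm_num)).mul_const (Real.exp 1)
  refine h.mono' (by fun_prop) (.of_forall fun x ↦ ?_)
  rw [Real.norm_of_nonneg (Real.exp_pos _).le, ← Real.exp_add, Real.exp_le_exp]
  nlinarith [sq_nonneg (|x| - 2), sq_abs x]

/-- The joint density, together with the weight, is dominated by the product of a Gaussian factor
in the deviation of the displacement from its conditional mean, and an exponential of the modulus
of the pinning point. -/
theorem exists_momentWeight_mul_exp_le (x₀ : ℝ) {d : ℝ≥0} (hd : 0 < d) (K : ℝ) :
    ∃ C c : ℝ, ∀ (l : ℝ≥0) (s y : ℝ), d ≤ l → s ∈ Ico (0 : ℝ) 1 →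
      (l : ℝ) + d = 1 - s → |y| ≤ K → ∀ w z : ℝ,
      momentWeight (w, z) ^ 3 * Real.exp (jointExponent x₀ l d y (w, z)) ≤
        Real.exp (-(w - √(l : ℝ) / (1 - s) * (z - y)) ^ 2 / 2 +
          |w - √(l : ℝ) / (1 - s) * (z - y)|) * Real.exp (C + c * |z|) := by
  have hd' : (0 : ℝ) < d := hd
  set q : ℝ := 1 / d with hq
  have hq0 : 0 < q := by positivity
  refine ⟨Real.log 6 + 1 + q * K + x₀ ^ 2 / 2, q + 1 + K + |x₀|,
    fun l s y hdl hs hls hy w z ↦ ?_⟩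
  have hl : 0 < l := hd.trans_le hdl
  have hl1 : √(l : ℝ) ≤ 1 := Real.sqrt_le_one.2 (by
    have : (l : ℝ) ≤ 1 := by linarith [hs.1]
    exact_mod_cast this)
  have hD : (d : ℝ) ≤ 1 - s := by linarith [l.2, hls]
  set μ := √(l : ℝ) / (1 - s) * (z - y) with hμ
  have hμle : |μ| ≤ q * (|z| + K) := by
    rw [hμ, abs_mul, abs_of_nonneg (div_nonneg (Real.sqrt_nonneg _) (hd'.le.trans hD))]
    have h1 : √(l : ℝ) / (1 - s) ≤ q := by
      rw [hq]
      exact div_le_div₀ zero_le_one hl1 hd' hD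
    exact mul_le_mul h1 ((abs_sub _ _).trans (by linarith)) (abs_nonneg _) hq0.le
  have hw : |w| ≤ |w - μ| + |μ| := by
    have := abs_add_le (w - μ) μ
    rwa [sub_add_cancel] at this
  have hcube : momentWeight (w, z) ^ 3 ≤ 6 * Real.exp (momentWeight (w, z)) := by
    have h := Real.pow_div_factorial_le_exp (momentWeight (w, z))
      (zero_le_one.trans (one_le_momentWeight _)) 3
    rw [div_le_iff₀ (by positivity)] at h
    norm_num [Nat.factorial] at h
    linarith
  have hexp : jointExponent x₀ l d y (w, z) ≤
      -(w - μ) ^ 2 / 2 + ((y - x₀) * z + x₀ ^ 2 / 2) := by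
    rw [jointExponent_eq x₀ hl hd hls y w z]
    refine add_le_add ?_ (pinExponent_le x₀ hs y z)
    rw [neg_div, neg_div, neg_le_neg_iff]
    have h1 : (d : ℝ) / (1 - s) ≤ 1 := div_le_one_of_le₀ hD (hd'.le.trans hD)
    have h2 : 0 < (d : ℝ) / (1 - s) := div_pos hd' (hd'.trans_le hD)
    gcongr
    linarith
  have hlin : (y - x₀) * z ≤ (K + |x₀|) * |z| := by
    refine (le_abs_self _).trans ?_
    rw [abs_mul]
    gcongr
    exact (abs_sub _ _).trans (by linarith)
  calc momentWeight (w, z) ^ 3 * Real.exp (jointExponent x₀ l d y (w, z))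
      ≤ (6 * Real.exp (momentWeight (w, z))) *
          Real.exp (-(w - μ) ^ 2 / 2 + ((y - x₀) * z + x₀ ^ 2 / 2)) := by gcongr
    _ = Real.exp (Real.log 6 + momentWeight (w, z) +
          (-(w - μ) ^ 2 / 2 + ((y - x₀) * z + x₀ ^ 2 / 2))) := by
        rw [Real.exp_add (_ + _), Real.exp_add (Real.log 6), Real.exp_log (by norm_num)]
    _ ≤ Real.exp ((-(w - μ) ^ 2 / 2 + |w - μ|) +
          (Real.log 6 + 1 + q * K + x₀ ^ 2 / 2 + (q + 1 + K + |x₀|) * |z|)) := by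
        rw [Real.exp_le_exp]
        unfold momentWeight
        simp only
        nlinarith
    _ = _ := Real.exp_add _ _

/-- The weighted joint densities have uniformly bounded integrals for starting points in a compact
set; the uniformity down to `s = 0` uses the exponential moments of the terminal law. -/
theorem exists_integral_momentWeight_le {p : Measure ℝ} [IsProbabilityMeasure p]
    (hexp : ∀ t, Integrable (fun z : ℝ ↦ Real.exp (t * z)) p) (x₀ : ℝ) {d : ℝ≥0} (hd : 0 < d)
    (K : ℝ) :
    ∃ M : ℝ, 0 ≤ M ∧ ∀ (l : ℝ≥0) (s y : ℝ), d ≤ l → s ∈ Ico (0 : ℝ) 1 →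
      (l : ℝ) + d = 1 - s → |y| ≤ K →
      Integrable (fun q ↦ momentWeight q ^ 3 * Real.exp (jointExponent x₀ l d y q))
        ((volume : Measure ℝ).prod p) ∧
      ∫ q, momentWeight q ^ 3 * Real.exp (jointExponent x₀ l d y q)
        ∂((volume : Measure ℝ).prod p) ≤ M := by
  obtain ⟨C, c, hle⟩ := exists_momentWeight_mul_exp_le x₀ hd K
  set f : ℝ → ℝ := fun x ↦ Real.exp (-x ^ 2 / 2 + |x|) with hf
  set g : ℝ → ℝ := fun z ↦ Real.exp (C + c * |z|) with hg
  have hfi : Integrable f := integrable_exp_neg_sq_add_abs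
  have hgi : Integrable g p := by
    have h := (integrable_exp_mul_abs (hexp c) (hexp (-c))).const_mul (Real.exp C)
    exact h.congr (.of_forall fun z ↦ (Real.exp_add _ _).symm)
  have hf0 (x : ℝ) : 0 ≤ f x := (Real.exp_pos _).le
  have hg0 (x : ℝ) : 0 ≤ g x := (Real.exp_pos _).le
  set M := (∫ x, f x) * ∫ z, g z ∂p with hM
  have hM0 : 0 ≤ M := mul_nonneg (integral_nonneg hf0) (integral_nonneg hg0)
  refine ⟨M, hM0, fun l s y hdl hs hls hy ↦ ?_⟩
  set F : ℝ × ℝ → ℝ := fun q ↦ momentWeight q ^ 3 * Real.exp (jointExponent x₀ l d y q) with hF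
  have hFm : Measurable F := by fun_prop
  have hF0 (q : ℝ × ℝ) : 0 ≤ F q :=
    mul_nonneg (pow_nonneg (zero_le_one.trans (one_le_momentWeight q)) 3) (Real.exp_pos _).le
  have hbound : ∫⁻ q, ENNReal.ofReal (F q) ∂((volume : Measure ℝ).prod p) ≤ ENNReal.ofReal M := by
    rw [lintegral_prod_symm' _ (by fun_prop)]
    calc _ ≤ ∫⁻ z, (∫⁻ w, ENNReal.ofReal (f (w - √(l : ℝ) / (1 - s) * (z - y)))) *
          ENNReal.ofReal (g z) ∂p := by
          refine lintegral_mono fun z ↦ ?_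
          rw [← lintegral_mul_const _ (by fun_prop)]
          refine lintegral_mono fun w ↦ ?_
          rw [← ENNReal.ofReal_mul (hf0 _)]
          exact ENNReal.ofReal_le_ofReal (hle l s y hdl hs hls hy w z)
      _ = ∫⁻ z, ENNReal.ofReal (∫ x, f x) * ENNReal.ofReal (g z) ∂p := by
          refine lintegral_congr fun z ↦ ?_
          rw [lintegral_sub_right_eq_self (fun w ↦ ENNReal.ofReal (f w)),
            ofReal_integral_eq_lintegral_ofReal hfi (.of_forall hf0)]
      _ = ENNReal.ofReal M := by
          rw [lintegral_const_mul _ (by fun_prop), ← ofReal_integral_eq_lintegral_ofReal hgi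
            (.of_forall hg0), ← ENNReal.ofReal_mul (integral_nonneg hf0)]
  have hFi : Integrable F ((volume : Measure ℝ).prod p) := by
    refine ⟨hFm.aestronglyMeasurable, ?_⟩
    rw [hasFiniteIntegral_iff_ofReal (.of_forall hF0)]
    exact hbound.trans_lt ENNReal.ofReal_lt_top
  refine ⟨hFi, ?_⟩
  rw [← ofReal_integral_eq_lintegral_ofReal hFi (.of_forall hF0)] at hbound
  exact (ENNReal.ofReal_le_ofReal_iff hM0).1 hbound

/-- The normalizing constants of the joint densities are bounded below, for starting points in a
compact set. -/
theorem exists_le_integral_exp_jointExponent {p : Measure ℝ} [IsProbabilityMeasure p]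
    (hexp : ∀ t, Integrable (fun z : ℝ ↦ Real.exp (t * z)) p) (x₀ : ℝ) {d : ℝ≥0} (hd : 0 < d)
    (K : ℝ) :
    ∃ c : ℝ, 0 < c ∧ ∀ (l : ℝ≥0) (s y : ℝ), d ≤ l → s ∈ Ico (0 : ℝ) 1 →
      (l : ℝ) + d = 1 - s → |y| ≤ K →
      Integrable (fun q ↦ Real.exp (jointExponent x₀ l d y q)) ((volume : Measure ℝ).prod p) ∧
      c ≤ ∫ q, Real.exp (jointExponent x₀ l d y q) ∂((volume : Measure ℝ).prod p) := by
  have hne : NeZero ((volume : Measure ℝ).prod p) := ⟨fun h ↦ by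
    have h1 := congrArg (fun m : Measure (ℝ × ℝ) ↦ m univ) h
    simp [← univ_prod_univ, Measure.prod_prod] at h1⟩
  set f : ℝ × ℝ → ℝ := fun q ↦ -q.1 ^ 2 / 2 - (|q.2| + K + |q.1|) ^ 2 / (2 * d) with hf
  have hle (l : ℝ≥0) (y : ℝ) (hl : l ≤ 1) (hy : |y| ≤ K) (q : ℝ × ℝ) :
      f q ≤ jointExponent x₀ l d y q := by
    have hr : √(l : ℝ) ≤ 1 := Real.sqrt_le_one.2 hl
    have h1 : |√(l : ℝ) * q.1| ≤ |q.1| := by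
      rw [abs_mul, abs_of_nonneg (Real.sqrt_nonneg _)]
      exact mul_le_of_le_one_left (abs_nonneg _) hr
    have h2 : |q.2 - y - √(l : ℝ) * q.1| ≤ |q.2| + K + |q.1| := by
      linarith [abs_sub (q.2 - y) (√(l : ℝ) * q.1), abs_sub q.2 y]
    have h3 : (q.2 - y - √(l : ℝ) * q.1) ^ 2 / (2 * d) ≤ (|q.2| + K + |q.1|) ^ 2 / (2 * d) := by
      rw [← sq_abs (q.2 - y - √(l : ℝ) * q.1)]
      gcongr
    simp only [hf, jointExponent]
    nlinarith [sq_nonneg (q.2 - x₀)]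
  have hint (l : ℝ≥0) (s y : ℝ) (hl : 0 < l) (hs : s ∈ Ico (0 : ℝ) 1)
      (hls : (l : ℝ) + d = 1 - s) :
      Integrable (fun q ↦ Real.exp (jointExponent x₀ l d y q)) ((volume : Measure ℝ).prod p) :=
    (map_shear_eq_tilted x₀ hl hd hls y (integrable_exp_pinExponent hexp x₀ hs y)).2
  have hle1 {l : ℝ≥0} {s : ℝ} (hs : s ∈ Ico (0 : ℝ) 1) (hls : (l : ℝ) + d = 1 - s) : l ≤ 1 := by
    have : (l : ℝ) ≤ 1 := by linarith [hs.1, d.2]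
    exact_mod_cast this
  by_cases hfi : Integrable (fun q ↦ Real.exp (f q)) ((volume : Measure ℝ).prod p)
  · refine ⟨∫ q, Real.exp (f q) ∂((volume : Measure ℝ).prod p), integral_exp_pos hfi,
      fun l s y hdl hs hls hy ↦ ?_⟩
    have h := hint l s y (hd.trans_le hdl) hs hls
    exact ⟨h, integral_mono hfi h fun q ↦ Real.exp_le_exp.2 (hle l y (hle1 hs hls) hy q)⟩
  -- `exp f` is dominated by the joint density of any admissible parameters, so it fails to be
  -- integrable only if there are none
  · refine ⟨1, one_pos, fun l s y hdl hs hls hy ↦ absurd ?_ hfi⟩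
    refine (hint l s y (hd.trans_le hdl) hs hls).mono' (by fun_prop) (.of_forall fun q ↦ ?_)
    rw [Real.norm_of_nonneg (Real.exp_pos _).le]
    exact Real.exp_le_exp.2 (hle l y (hle1 hs hls) hy q)

end RandomizedBridge

/-! ### Lipschitz dependence of the expected payoffs on the starting point -/

namespace RandomizedBridge

section PointwiseLipschitz

variable {a₀ a₁ : ℝ → ℝ} {A K x₀ : ℝ} {l₁ l₂ d : ℝ≥0} {s₁ s₂ y₁ y₂ : ℝ} {e : Canon} {S₁ S₂ : ℝ}

/-- `(s, y)` is a starting point with `|y| ≤ K` for which the time interval `[s, 1]` splits into a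
piece of length `l` and a piece of the fixed length `d ≤ l`. All points of a compact set are of this
form with common `d` and `K`. -/
structure IsStart (d : ℝ≥0) (K : ℝ) (l : ℝ≥0) (s y : ℝ) : Prop where
  le : d ≤ l
  mem : s ∈ Ico (0 : ℝ) 1
  eq : (l : ℝ) + d = 1 - s
  abs_le : |y| ≤ K

theorem IsStart.le_one {l : ℝ≥0} {s y : ℝ} (h : IsStart d K l s y) : l ≤ 1 := by
  have : (l : ℝ) ≤ 1 := by linarith [h.mem.1, d.2, h.eq]
  exact_mod_cast this

theorem IsStart.abs_sqrt_sub_le (hd : 0 < d) (hp₁ : IsStart d K l₁ s₁ y₁)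
    (hp₂ : IsStart d K l₂ s₂ y₂) :
    |√(l₁ : ℝ) - √(l₂ : ℝ)| ≤ (√(d : ℝ))⁻¹ * |s₁ - s₂| := by
  have hd' : (0 : ℝ) < d := hd
  have hl₁ : (d : ℝ) ≤ l₁ := hp₁.le
  have hl₂ : (d : ℝ) ≤ l₂ := hp₂.le
  have e : (l₁ : ℝ) - l₂ = -(s₁ - s₂) := by linarith [hp₁.eq, hp₂.eq]
  have h := abs_sqrt_sub_sqrt_le hd' hl₁ hl₂
  rwa [e, abs_neg] at h

theorem canonObs_le_weight (hd : 0 < d) (h₁ : ∀ u, |e.1.1 u| ≤ 2 * S₁)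
    (h₂ : ∀ u, |e.1.2 u| ≤ 2 * S₂) {u : ℝ≥0} (hu : u ≤ 1 + d) :
    |canonObs d u e| ≤ 2 * (momentWeight e.2 * (1 + S₁ + S₂)) := by
  have hS₁ : 0 ≤ S₁ := by linarith [(abs_nonneg _).trans (h₁ 0)]
  have hS₂ : 0 ≤ S₂ := by linarith [(abs_nonneg _).trans (h₂ 0)]
  refine (abs_canonObs_le hd hu h₁ h₂).trans ?_
  unfold momentWeight
  nlinarith [abs_nonneg e.2.1, abs_nonneg e.2.2, mul_nonneg (abs_nonneg e.2.1) hS₁,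
    mul_nonneg (abs_nonneg e.2.1) hS₂, mul_nonneg (abs_nonneg e.2.2) hS₁,
    mul_nonneg (abs_nonneg e.2.2) hS₂]

theorem one_le_weight (h₁ : ∀ u, |e.1.1 u| ≤ 2 * S₁) (h₂ : ∀ u, |e.1.2 u| ≤ 2 * S₂) :
    1 ≤ momentWeight e.2 * (1 + S₁ + S₂) := by
  have hS₁ : 0 ≤ S₁ := by linarith [(abs_nonneg _).trans (h₁ 0)]
  have hS₂ : 0 ≤ S₂ := by linarith [(abs_nonneg _).trans (h₂ 0)]
  nlinarith [one_le_momentWeight e.2]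

theorem abs_canonPayoff_le_weight (hA : GainBound a₀ a₁ A) (hK : 0 ≤ K) (hd : 0 < d)
    (hp₁ : IsStart d K l₁ s₁ y₁) (h₁ : ∀ u, |e.1.1 u| ≤ 2 * S₁) (h₂ : ∀ u, |e.1.2 u| ≤ 2 * S₂)
    {v : ℝ≥0} (hv : v ≤ 1 + d) :
    |canonPayoff a₀ a₁ l₁ d s₁ y₁ v e| ≤
      A * (K + 5) * (momentWeight e.2 * (1 + S₁ + S₂)) := by
  have h := abs_canonPayoff_le hA hd hv hp₁.mem.1 hp₁.eq
    (fun u hu ↦ canonObs_le_weight hd h₁ h₂ hu) y₁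
  have hW := one_le_weight h₁ h₂
  set W := momentWeight e.2 * (1 + S₁ + S₂)
  refine h.trans ?_
  rw [mul_assoc]
  refine mul_le_mul_of_nonneg_left ?_ hA.pos.le
  nlinarith [hp₁.abs_le]

theorem abs_canonPayoff_sub_le_weight (hA : GainBound a₀ a₁ A) (hK : 0 ≤ K) (hd : 0 < d)
    (hp₁ : IsStart d K l₁ s₁ y₁) (hp₂ : IsStart d K l₂ s₂ y₂)
    (h₁ : ∀ u, |e.1.1 u| ≤ 2 * S₁) (h₂ : ∀ u, |e.1.2 u| ≤ 2 * S₂) {v : ℝ≥0} (hv : v ≤ 1 + d) :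
    |canonPayoff a₀ a₁ l₁ d s₁ y₁ v e - canonPayoff a₀ a₁ l₂ d s₂ y₂ v e| ≤
      A * (K + 6 + 2 * (√(d : ℝ))⁻¹) * (|s₁ - s₂| + |y₁ - y₂|) *
        (momentWeight e.2 * (1 + S₁ + S₂)) := by
  have h := abs_canonPayoff_sub_le hA hd hv hp₁.mem.1 hp₂.mem.1 hp₁.eq hp₂.eq
    (fun u hu ↦ canonObs_le_weight hd h₁ h₂ hu) y₁ y₂
  have hsqrt := IsStart.abs_sqrt_sub_le hd hp₁ hp₂
  have hW := one_le_weight h₁ h₂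
  set W := momentWeight e.2 * (1 + S₁ + S₂)
  set r := (√(d : ℝ))⁻¹ with hr
  have hr0 : 0 ≤ r := by positivity
  refine h.trans ?_
  rw [mul_assoc, mul_assoc]
  refine mul_le_mul_of_nonneg_left ?_ hA.pos.le
  have ha := abs_nonneg (s₁ - s₂)
  have hb := abs_nonneg (y₁ - y₂)
  have i1 : |s₁ - s₂| * (1 + |y₁| + 2 * (2 * W)) ≤ |s₁ - s₂| * ((K + 5) * W) := by
    gcongr
    nlinarith [hp₁.abs_le]
  have i2 : |√(l₁ : ℝ) - √(l₂ : ℝ)| * (2 * W) ≤ |s₁ - s₂| * (2 * r * W) := by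
    calc _ ≤ r * |s₁ - s₂| * (2 * W) := by gcongr
      _ = _ := by ring
  have i3 : |y₁ - y₂| ≤ |y₁ - y₂| * W := le_mul_of_one_le_right hb hW
  have i4 : 0 ≤ |y₁ - y₂| * W := by positivity
  have i5 : 0 ≤ |s₁ - s₂| * W := by positivity
  nlinarith [mul_nonneg hK i4, mul_nonneg hr0 i4]

theorem abs_jointExponent_sub_le_weight (x₀ : ℝ) (hK : 0 ≤ K) (hd : 0 < d)
    (hp₁ : IsStart d K l₁ s₁ y₁) (hp₂ : IsStart d K l₂ s₂ y₂) (p : ℝ × ℝ) :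
    |jointExponent x₀ l₁ d y₁ p - jointExponent x₀ l₂ d y₂ p| ≤
      (1 + (√(d : ℝ))⁻¹) * ((1 + K) / d) * (|s₁ - s₂| + |y₁ - y₂|) * momentWeight p ^ 2 := by
  have h := abs_jointExponent_sub_le x₀ hd hp₁.le_one hp₂.le_one hp₁.abs_le hp₂.abs_le p
  have hsqrt := IsStart.abs_sqrt_sub_le hd hp₁ hp₂
  have hd' : (0 : ℝ) < d := hd
  set r := (√(d : ℝ))⁻¹ with hr
  have hr0 : 0 ≤ r := by positivity
  have hm := one_le_momentWeight p
  have hw : |p.1| ≤ momentWeight p := by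
    unfold momentWeight; linarith [abs_nonneg p.2]
  have hwz : |p.2| + |p.1| ≤ momentWeight p := by
    unfold momentWeight; linarith
  set m := momentWeight p
  have i1 : |y₁ - y₂| + |√(l₁ : ℝ) - √(l₂ : ℝ)| * |p.1| ≤
      (1 + r) * (|s₁ - s₂| + |y₁ - y₂|) * m := by
    calc _ ≤ |y₁ - y₂| * m + r * |s₁ - s₂| * m := by
          gcongr
          exact le_mul_of_one_le_right (abs_nonneg _) hm
      _ ≤ _ := by
          have j1 : 0 ≤ |s₁ - s₂| * m := by positivity
          have j2 : 0 ≤ r * (|y₁ - y₂| * m) := by positivity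
          nlinarith
  have i2 : (|p.2| + K + |p.1|) / d ≤ (1 + K) / d * m := by
    rw [div_mul_eq_mul_div]
    gcongr
    nlinarith
  calc _ ≤ _ := h
    _ ≤ ((1 + r) * (|s₁ - s₂| + |y₁ - y₂|) * m) * ((1 + K) / d * m) := by gcongr
    _ = _ := by ring

/-- The difference of two weighted payoffs `exp E * H`, where `m` plays the role of the moment
weight and `S` that of the size of the bridges. -/
theorem abs_exp_mul_sub_le {E₁ E₂ H₁ H₂ C₁ C₂ C₃ δ m S : ℝ} (hm : 1 ≤ m) (hS : 1 ≤ S)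
    (hC₂ : 0 ≤ C₂) (hδ : 0 ≤ δ)
    (hH : |H₁ - H₂| ≤ C₂ * δ * (m * S)) (hH₂ : |H₂| ≤ C₁ * (m * S))
    (hE : |E₁ - E₂| ≤ C₃ * δ * m ^ 2) :
    |Real.exp E₁ * H₁ - Real.exp E₂ * H₂| ≤
      (C₂ + C₁ * C₃) * δ * (S * (m ^ 3 * Real.exp E₁) + S * (m ^ 3 * Real.exp E₂)) := by
  have h1 := Real.exp_pos E₁
  have h2 := Real.exp_pos E₂
  have hmS : m * S ≤ S * m ^ 3 := by
    rw [mul_comm]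
    exact mul_le_mul_of_nonneg_left (le_self_pow₀ hm (by norm_num)) (by linarith)
  have e1 : Real.exp E₁ * H₁ - Real.exp E₂ * H₂ =
      Real.exp E₁ * (H₁ - H₂) + (Real.exp E₁ - Real.exp E₂) * H₂ := by ring
  have i1 : Real.exp E₁ * |H₁ - H₂| ≤
      C₂ * δ * (S * (m ^ 3 * Real.exp E₁) + S * (m ^ 3 * Real.exp E₂)) := by
    calc _ ≤ Real.exp E₁ * (C₂ * δ * (S * m ^ 3)) := by
          gcongr
          exact hH.trans (by gcongr)
      _ = C₂ * δ * (S * (m ^ 3 * Real.exp E₁)) := by ring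
      _ ≤ _ := by
          gcongr
          have : 0 ≤ S * (m ^ 3 * Real.exp E₂) := by positivity
          linarith
  have i2 : |Real.exp E₁ - Real.exp E₂| * |H₂| ≤
      C₁ * C₃ * δ * (S * (m ^ 3 * Real.exp E₁) + S * (m ^ 3 * Real.exp E₂)) := by
    calc _ ≤ ((C₃ * δ * m ^ 2) * (Real.exp E₁ + Real.exp E₂)) * (C₁ * (m * S)) := by
          have h0 : 0 ≤ C₃ * δ * m ^ 2 := (abs_nonneg _).trans hE
          refine mul_le_mul ((abs_exp_sub_exp_le _ _).trans ?_) hH₂ (abs_nonneg _) (by positivity)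
          gcongr
      _ = _ := by ring
  rw [e1]
  refine (abs_add_le _ _).trans ?_
  rw [abs_mul, abs_mul, abs_of_pos h1]
  linarith

theorem abs_div_sub_div_le {N₁ N₂ Z₁ Z₂ z₀ M a b : ℝ} (hz : 0 < z₀) (h₁ : z₀ ≤ Z₁) (h₂ : z₀ ≤ Z₂)
    (hN : |N₁ - N₂| ≤ a) (hZ : |Z₁ - Z₂| ≤ b) (hM : |N₂| ≤ M) :
    |N₁ / Z₁ - N₂ / Z₂| ≤ a / z₀ + M * b / (z₀ * z₀) := by
  have hZ₁ : 0 < Z₁ := hz.trans_le h₁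
  have hZ₂ : 0 < Z₂ := hz.trans_le h₂
  have ha := (abs_nonneg _).trans hN
  have hb := (abs_nonneg _).trans hZ
  have hM0 := (abs_nonneg _).trans hM
  have e : N₁ / Z₁ - N₂ / Z₂ = (N₁ - N₂) / Z₁ + N₂ * -(Z₁ - Z₂) / (Z₁ * Z₂) := by
    field_simp
    ring
  rw [e]
  refine (abs_add_le _ _).trans ?_
  rw [abs_div, abs_div, abs_mul, abs_neg, abs_of_pos hZ₁, abs_of_pos (mul_pos hZ₁ hZ₂)]
  gcongr

end PointwiseLipschitz

section Expected

variable {Ω : Type*} [MeasurableSpace Ω] {P : Measure Ω} {B : ℝ≥0 → Ω → ℝ}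

/-- The expected payoff of a stopping rule, written with respect to the reference measure. -/
noncomputable def expectedRulePayoff (P : Measure Ω) (B : ℝ≥0 → Ω → ℝ) (ν : ℝ → ℝ)
    (a₀ a₁ : ℝ → ℝ) (x₀ : ℝ) (l d : ℝ≥0) (s y : ℝ) (n : ℕ) (τ : Canon → ℕ) : ℝ :=
  (∫ x, Real.exp (jointExponent x₀ l d y x.2) *
      canonPayoff a₀ a₁ l d s y (gridTime d n (τ (refMap B d x))) (refMap B d x)
      ∂refMeasure P ν) /
    ∫ q, Real.exp (jointExponent x₀ l d y q) ∂((volume : Measure ℝ).prod (terminalLaw ν))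

/-- The expected payoffs of all stopping rules have a common Lipschitz constant, for starting
points in a compact set. -/
theorem exists_lipschitz_expectedRulePayoff (hB : ∀ u, Measurable (B u)) [IsProbabilityMeasure P]
    {S : Ω → ℝ} (hSi : Integrable S P) (hS0 : ∀ ω, 0 ≤ S ω)
    (hS : ∀ᵐ ω ∂P, ∀ u ≤ 1, |B u ω| ≤ S ω) {ν : ℝ → ℝ} [IsProbabilityMeasure (terminalLaw ν)]
    (hexp : ∀ t, Integrable (fun z : ℝ ↦ Real.exp (t * z)) (terminalLaw ν))
    {a₀ a₁ : ℝ → ℝ} {A : ℝ} (hA : GainBound a₀ a₁ A) (x₀ : ℝ) {d : ℝ≥0} (hd : 0 < d)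
    (hd1 : d ≤ 1) {K : ℝ} (hK : 0 ≤ K) :
    ∃ L : ℝ, 0 ≤ L ∧ ∀ (l₁ l₂ : ℝ≥0) (s₁ s₂ y₁ y₂ : ℝ), IsStart d K l₁ s₁ y₁ →
      IsStart d K l₂ s₂ y₂ → ∀ (n : ℕ) (τ : Canon → ℕ), IsGridRule d n τ →
      |expectedRulePayoff P B ν a₀ a₁ x₀ l₁ d s₁ y₁ n τ -
        expectedRulePayoff P B ν a₀ a₁ x₀ l₂ d s₂ y₂ n τ| ≤ L * (|s₁ - s₂| + |y₁ - y₂|) := by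
  obtain ⟨M, hM0, hM⟩ := exists_integral_momentWeight_le hexp x₀ hd K
  obtain ⟨c, hc0, hc⟩ := exists_le_integral_exp_jointExponent hexp x₀ hd K
  have hd' : (0 : ℝ) < d := hd
  have hA0 := hA.pos
  set C₁ := A * (K + 5) with hC₁
  set C₂ := A * (K + 6 + 2 * (√(d : ℝ))⁻¹) with hC₂
  set C₃ := (1 + (√(d : ℝ))⁻¹) * ((1 + K) / d) with hC₃
  have hC₁0 : 0 ≤ C₁ := by positivity
  have hC₂0 : 0 ≤ C₂ := by positivity
  have hC₃0 : 0 ≤ C₃ := by positivity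
  set m := (volume : Measure ℝ).prod (terminalLaw ν) with hm
  set σ : (Ω × Ω) × (ℝ × ℝ) → ℝ := fun x ↦ 1 + S x.1.1 + S x.1.2 with hσ
  have hσ1 (x) : 1 ≤ σ x := by
    have := hS0 x.1.1
    have := hS0 x.1.2
    simp only [hσ]
    linarith
  set Q₀ := ∫ ω : Ω × Ω, (1 + S ω.1 + S ω.2) ∂P.prod P with hQ₀
  have hQi : Integrable (fun ω : Ω × Ω ↦ 1 + S ω.1 + S ω.2) (P.prod P) :=
    ((integrable_const 1).add (hSi.comp_fst P)).add (hSi.comp_snd P)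
  have hQ0 : 0 ≤ Q₀ := integral_nonneg fun ω ↦ by
    have := hS0 ω.1
    have := hS0 ω.2
    simp only [Pi.zero_apply]
    positivity
  -- the dominating functions
  set Γ : ℝ≥0 → ℝ → (Ω × Ω) × (ℝ × ℝ) → ℝ := fun l y x ↦
    σ x * (momentWeight x.2 ^ 3 * Real.exp (jointExponent x₀ l d y x.2)) with hΓ
  have hΓi {l : ℝ≥0} {s y : ℝ} (hp : IsStart d K l s y) : Integrable (Γ l y) (refMeasure P ν) :=
    hQi.mul_prod (hM l s y hp.le hp.mem hp.eq hp.abs_le).1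
  have hΓM {l : ℝ≥0} {s y : ℝ} (hp : IsStart d K l s y) :
      ∫ x, Γ l y x ∂refMeasure P ν ≤ Q₀ * M := by
    have h := integral_prod_mul (μ := P.prod P) (ν := m) (fun ω : Ω × Ω ↦ 1 + S ω.1 + S ω.2)
      (fun q ↦ momentWeight q ^ 3 * Real.exp (jointExponent x₀ l d y q))
    refine h.le.trans ?_
    exact mul_le_mul_of_nonneg_left (hM l s y hp.le hp.mem hp.eq hp.abs_le).2 hQ0
  -- the bounds on the bridges hold almost everywhere
  have hae : ∀ᵐ x ∂refMeasure P ν, (∀ u, |(refMap B d x).1.1 u| ≤ 2 * S x.1.1) ∧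
      ∀ u, |(refMap B d x).1.2 u| ≤ 2 * S x.1.2 := by
    have h1 : ∀ᵐ x ∂refMeasure P ν, ∀ u ≤ 1, |B u x.1.1| ≤ S x.1.1 :=
      (Measure.quasiMeasurePreserving_fst.comp Measure.quasiMeasurePreserving_fst).ae hS
    have h2 : ∀ᵐ x ∂refMeasure P ν, ∀ u ≤ 1, |B u x.1.2| ≤ S x.1.2 :=
      (Measure.quasiMeasurePreserving_snd.comp Measure.quasiMeasurePreserving_fst).ae hS
    filter_upwards [h1, h2] with x hx1 hx2
    exact ⟨fun u ↦ abs_bridgePath_le hx1, fun u ↦ abs_bridgePath_le fun v hv ↦ hx2 v (hv.trans hd1)⟩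
  refine ⟨(C₂ + C₁ * C₃) * (Q₀ * M + Q₀ * M) / c + C₁ * (Q₀ * M) * (C₃ * (M + M)) / (c * c),
    by positivity, fun l₁ l₂ s₁ s₂ y₁ y₂ hp₁ hp₂ n τ hτ ↦ ?_⟩
  set δ := |s₁ - s₂| + |y₁ - y₂| with hδ
  have hδ0 : 0 ≤ δ := by positivity
  set H : ℝ≥0 → ℝ → ℝ → (Ω × Ω) × (ℝ × ℝ) → ℝ := fun l s y x ↦
    canonPayoff a₀ a₁ l d s y (gridTime d n (τ (refMap B d x))) (refMap B d x) with hH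
  have hgrid (x) : gridTime d n (τ (refMap B d x)) ≤ 1 + d := gridTime_le d (hτ.le _)
  have hHm (l : ℝ≥0) (s y : ℝ) : Measurable (H l s y) :=
    (hτ.measurable_canonPayoff a₀ a₁ l s y).comp (measurable_refMap hB d)
  have hHle {l : ℝ≥0} {s y : ℝ} (hp : IsStart d K l s y) : ∀ᵐ x ∂refMeasure P ν,
      ‖Real.exp (jointExponent x₀ l d y x.2) * H l s y x‖ ≤ C₁ * Γ l y x := by
    filter_upwards [hae] with x hx
    have h := abs_canonPayoff_le_weight hA hK hd hp hx.1 hx.2 (hgrid x)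
    have hm3 : momentWeight x.2 ≤ momentWeight x.2 ^ 3 :=
      le_self_pow₀ (one_le_momentWeight _) (by norm_num)
    rw [norm_mul, Real.norm_of_nonneg (Real.exp_pos _).le, Real.norm_eq_abs]
    calc _ ≤ Real.exp (jointExponent x₀ l d y x.2) * (C₁ * (momentWeight x.2 ^ 3 * σ x)) := by
          have := hσ1 x
          gcongr
          refine h.trans ?_
          exact mul_le_mul_of_nonneg_left (mul_le_mul_of_nonneg_right hm3 (by linarith)) hC₁0
      _ = _ := by simp only [hΓ]; ring
  have hHi {l : ℝ≥0} {s y : ℝ} (hp : IsStart d K l s y) :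
      Integrable (fun x ↦ Real.exp (jointExponent x₀ l d y x.2) * H l s y x) (refMeasure P ν) :=
    ((hΓi hp).const_mul C₁).mono' (Measurable.aestronglyMeasurable (by
      have := hHm l s y
      fun_prop)) (hHle hp)
  have hNum : |(∫ x, Real.exp (jointExponent x₀ l₁ d y₁ x.2) * H l₁ s₁ y₁ x ∂refMeasure P ν) -
      ∫ x, Real.exp (jointExponent x₀ l₂ d y₂ x.2) * H l₂ s₂ y₂ x ∂refMeasure P ν| ≤
      (C₂ + C₁ * C₃) * δ * (Q₀ * M + Q₀ * M) := by
    rw [← integral_sub (hHi hp₁) (hHi hp₂), ← Real.norm_eq_abs]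
    refine (norm_integral_le_of_norm_le (((hΓi hp₁).add (hΓi hp₂)).const_mul
      ((C₂ + C₁ * C₃) * δ)) ?_).trans ?_
    · filter_upwards [hae] with x hx
      exact abs_exp_mul_sub_le (one_le_momentWeight x.2) (hσ1 x) hC₂0 hδ0
        (abs_canonPayoff_sub_le_weight hA hK hd hp₁ hp₂ hx.1 hx.2 (hgrid x))
        (abs_canonPayoff_le_weight hA hK hd hp₂ hx.1 hx.2 (hgrid x))
        (abs_jointExponent_sub_le_weight x₀ hK hd hp₁ hp₂ x.2)
    · rw [integral_const_mul]
      refine mul_le_mul_of_nonneg_left ?_ (by positivity)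
      simp only [Pi.add_apply]
      rw [integral_add (hΓi hp₁) (hΓi hp₂)]
      exact add_le_add (hΓM hp₁) (hΓM hp₂)
  have hNum₂ : |∫ x, Real.exp (jointExponent x₀ l₂ d y₂ x.2) * H l₂ s₂ y₂ x ∂refMeasure P ν| ≤
      C₁ * (Q₀ * M) := by
    rw [← Real.norm_eq_abs]
    refine (norm_integral_le_of_norm_le ((hΓi hp₂).const_mul C₁) (hHle hp₂)).trans ?_
    rw [integral_const_mul]
    exact mul_le_mul_of_nonneg_left (hΓM hp₂) hC₁0
  have hM₁ := hM l₁ s₁ y₁ hp₁.le hp₁.mem hp₁.eq hp₁.abs_le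
  have hM₂ := hM l₂ s₂ y₂ hp₂.le hp₂.mem hp₂.eq hp₂.abs_le
  have hc₁ := hc l₁ s₁ y₁ hp₁.le hp₁.mem hp₁.eq hp₁.abs_le
  have hc₂ := hc l₂ s₂ y₂ hp₂.le hp₂.mem hp₂.eq hp₂.abs_le
  have hZ : |(∫ q, Real.exp (jointExponent x₀ l₁ d y₁ q) ∂m) -
      ∫ q, Real.exp (jointExponent x₀ l₂ d y₂ q) ∂m| ≤ C₃ * δ * (M + M) := by
    rw [← integral_sub hc₁.1 hc₂.1, ← Real.norm_eq_abs]
    refine (norm_integral_le_of_norm_le ((hM₁.1.add hM₂.1).const_mul (C₃ * δ))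
      (.of_forall fun q ↦ ?_)).trans ?_
    · have h := abs_exp_mul_sub_le (H₁ := 1) (H₂ := 1) (C₁ := 1) (C₂ := 0) (S := 1)
        (one_le_momentWeight q) le_rfl le_rfl hδ0 (by simp)
        (by simpa using one_le_momentWeight q)
        (abs_jointExponent_sub_le_weight x₀ hK hd hp₁ hp₂ q)
      simpa using h
    · rw [integral_const_mul]
      refine mul_le_mul_of_nonneg_left ?_ (by positivity)
      simp only [Pi.add_apply]
      rw [integral_add hM₁.1 hM₂.1]
      exact add_le_add hM₁.2 hM₂.2
  refine (abs_div_sub_div_le hc0 hc₁.2 hc₂.2 hNum hZ hNum₂).trans (le_of_eq ?_)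
  ring

end Expected

end RandomizedBridge

/-! ### Integrability of the payoffs and approximation by grid rules -/

namespace RandomizedBridge

section PinningLaw

variable {ν : ℝ → ℝ} [IsProbabilityMeasure (terminalLaw ν)]

theorem isProbabilityMeasure_pinningLaw (hν_meas : Measurable ν) (hν_nonneg : ∀ z, 0 ≤ ν z)
    (hexp : ∀ t, Integrable (fun z : ℝ ↦ Real.exp (t * z)) (terminalLaw ν)) (x₀ : ℝ) {s : ℝ}
    (hs : s ∈ Ico (0 : ℝ) 1) (y : ℝ) : IsProbabilityMeasure (pinningLaw ν x₀ s y) := by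
  rw [pinningLaw_eq_tilted hν_meas hν_nonneg x₀ hs.2 y]
  exact isProbabilityMeasure_tilted (integrable_exp_pinExponent hexp x₀ hs y)

theorem integrable_abs_pinningLaw (hν_meas : Measurable ν) (hν_nonneg : ∀ z, 0 ≤ ν z)
    (hexp : ∀ t, Integrable (fun z : ℝ ↦ Real.exp (t * z)) (terminalLaw ν)) (x₀ : ℝ) {s : ℝ}
    (hs : s ∈ Ico (0 : ℝ) 1) (y : ℝ) : Integrable (fun z : ℝ ↦ |z|) (pinningLaw ν x₀ s y) := by
  rw [pinningLaw_eq_tilted hν_meas hν_nonneg x₀ hs.2 y,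
    integrable_tilted_iff (integrable_exp_pinExponent hexp x₀ hs y)]
  have hg : Integrable (fun z ↦ Real.exp (x₀ ^ 2 / 2) *
      (Real.exp ((y - x₀ + 1) * z) + Real.exp ((y - x₀ - 1) * z))) (terminalLaw ν) :=
    ((hexp _).add (hexp _)).const_mul _
  refine hg.mono' (Continuous.aestronglyMeasurable ?_) (.of_forall fun z ↦ ?_)
  · have := continuous_pinExponent x₀ s y
    fun_prop
  · have h1 : |z| ≤ Real.exp z + Real.exp (-z) := by
      have := Real.add_one_le_exp z
      have := Real.add_one_le_exp (-z)
      have := Real.exp_pos z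
      have := Real.exp_pos (-z)
      exact abs_le'.2 ⟨by linarith, by linarith⟩
    have h2 := Real.exp_le_exp.2 (pinExponent_le x₀ hs y z)
    rw [norm_smul, Real.norm_of_nonneg (Real.exp_pos _).le, Real.norm_of_nonneg (abs_nonneg z)]
    calc _ ≤ Real.exp ((y - x₀) * z + x₀ ^ 2 / 2) * (Real.exp z + Real.exp (-z)) := by gcongr
      _ = _ := by
        rw [mul_add, mul_add, ← Real.exp_add, ← Real.exp_add, ← Real.exp_add, ← Real.exp_add]
        ring_nf

end PinningLaw

theorem GainBound.continuousOn_shift {a₀ a₁ : ℝ → ℝ} {A : ℝ} (hA : GainBound a₀ a₁ A) :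
    ContinuousOn a₀ (Icc 0 1) :=
  (LipschitzOnWith.of_dist_le_mul (K := ⟨A, hA.pos.le⟩) hA.shift_lip).continuousOn

theorem GainBound.continuousOn_slope {a₀ a₁ : ℝ → ℝ} {A : ℝ} (hA : GainBound a₀ a₁ A) :
    ContinuousOn a₁ (Icc 0 1) :=
  (LipschitzOnWith.of_dist_le_mul (K := ⟨A, hA.pos.le⟩) hA.slope_lip).continuousOn

section Bridge

variable {Ω : Type*} {B : ℝ≥0 → Ω → ℝ} {s : ℝ}

theorem continuous_bridge {ω : Ω × ℝ} (hω : Continuous (B · ω.1)) (s y : ℝ) :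
    Continuous fun u ↦ bridge B s y u ω := by
  unfold bridge
  fun_prop

theorem abs_bridge_le (hs : s ∈ Ico (0 : ℝ) 1) (y : ℝ) {ω : Ω × ℝ} {S : ℝ}
    (hS : ∀ u ≤ 1, |B u ω.1| ≤ S) {u : ℝ≥0} (hu : u ≤ (1 - s).toNNReal) :
    |bridge B s y u ω| ≤ |y| + |ω.2| + 2 * S := by
  have hs' : 0 < 1 - s := by linarith [hs.2]
  have hu' : (u : ℝ) ≤ 1 - s := by
    rw [← Real.coe_toNNReal _ hs'.le]
    exact_mod_cast hu
  have h1 : (1 - s).toNNReal ≤ 1 := by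
    rw [Real.toNNReal_le_one]
    linarith [hs.1]
  have hr0 : 0 ≤ (u : ℝ) / (1 - s) := by positivity
  have hr1 : (u : ℝ) / (1 - s) ≤ 1 := (div_le_one hs').2 hu'
  have hBu := hS u (hu.trans h1)
  have hBs := hS _ h1
  unfold bridge
  set r := (u : ℝ) / (1 - s)
  have e : y + (ω.2 - y) * r + (B u ω.1 - r * B (1 - s).toNNReal ω.1) =
      (1 - r) * y + r * ω.2 + B u ω.1 + -(r * B (1 - s).toNNReal ω.1) := by ring
  rw [e]
  refine (abs_add_le _ _).trans ?_
  have i1 : |(1 - r) * y| ≤ |y| := by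
    rw [abs_mul, abs_of_nonneg (by linarith)]
    exact mul_le_of_le_one_left (abs_nonneg _) (by linarith)
  have i2 : |r * ω.2| ≤ |ω.2| := by
    rw [abs_mul, abs_of_nonneg hr0]
    exact mul_le_of_le_one_left (abs_nonneg _) hr1
  have i3 : |-(r * B (1 - s).toNNReal ω.1)| ≤ S := by
    rw [abs_neg, abs_mul, abs_of_nonneg hr0]
    exact (mul_le_of_le_one_left (abs_nonneg _) hr1).trans hBs
  linarith [abs_add_le ((1 - r) * y + r * ω.2) (B u ω.1), abs_add_le ((1 - r) * y) (r * ω.2)]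

theorem add_mem_Icc_of_le (hs : s ∈ Ico (0 : ℝ) 1) {u : ℝ≥0} (hu : u ≤ (1 - s).toNNReal) :
    s + u ∈ Icc (0 : ℝ) 1 := by
  have hs' : 0 < 1 - s := by linarith [hs.2]
  have hu' : (u : ℝ) ≤ 1 - s := by
    rw [← Real.coe_toNNReal _ hs'.le]
    exact_mod_cast hu
  exact ⟨add_nonneg hs.1 u.2, by linarith⟩

theorem continuousOn_gain_bridge {α β ζ : ℝ → ℝ} {T A : ℝ}
    (hA : GainBound (gainShift α β ζ T) (gainSlope β ζ T) A) (hs : s ∈ Ico (0 : ℝ) 1) (y : ℝ)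
    {ω : Ω × ℝ} (hω : Continuous (B · ω.1)) :
    ContinuousOn (fun u : ℝ≥0 ↦ gain α β ζ T (s + u) (bridge B s y u ω))
      (Iic (1 - s).toNNReal) := by
  have hc : ContinuousOn (fun u : ℝ≥0 ↦ s + (u : ℝ)) (Iic (1 - s).toNNReal) := by fun_prop
  have hm : MapsTo (fun u : ℝ≥0 ↦ s + (u : ℝ)) (Iic (1 - s).toNNReal) (Icc 0 1) :=
    fun u hu ↦ add_mem_Icc_of_le hs hu
  exact (hA.continuousOn_shift.comp hc hm).add
    ((hA.continuousOn_slope.comp hc hm).mul (continuous_bridge hω s y).continuousOn)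

variable [MeasurableSpace Ω]

theorem IsAdmissible.untopA_le {hB : ∀ u, Measurable (B u)} {y : ℝ} {σ : Ω × ℝ → WithTop ℝ≥0}
    (hσ : IsAdmissible hB s y σ) (ω : Ω × ℝ) : (σ ω).untopA ≤ (1 - s).toNNReal := by
  have h := hσ.2 ω
  have hne : σ ω ≠ ⊤ := ne_top_of_le_ne_top WithTop.coe_ne_top h
  rw [WithTop.untopA_eq_untop hne]
  exact (WithTop.untop_le_iff hne).2 h

theorem abs_payoff_le {α β ζ : ℝ → ℝ} {T A : ℝ}
    (hA : GainBound (gainShift α β ζ T) (gainSlope β ζ T) A) (hs : s ∈ Ico (0 : ℝ) 1) (y : ℝ)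
    {hB : ∀ u, Measurable (B u)} {σ : Ω × ℝ → WithTop ℝ≥0} (hσ : IsAdmissible hB s y σ)
    {ω : Ω × ℝ} {S : ℝ} (hS : ∀ u ≤ 1, |B u ω.1| ≤ S) :
    |payoff α β ζ T B s y σ ω| ≤ A * (1 + (|y| + |ω.2| + 2 * S)) := by
  have hu := hσ.untopA_le ω
  have hm := add_mem_Icc_of_le hs hu
  have hb := abs_bridge_le hs y hS hu
  change |gainShift α β ζ T _ + gainSlope β ζ T _ * bridge B s y _ ω| ≤ _
  refine (abs_add_le _ _).trans ?_
  rw [abs_mul, mul_add, mul_one]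
  exact add_le_add (hA.shift_le _ hm)
    (mul_le_mul (hA.slope_le _ hm) hb (abs_nonneg _) hA.pos.le)

end Bridge

section Payoff

variable {Ω : Type*} [MeasurableSpace Ω] {P : Measure Ω} [IsProbabilityMeasure P]
  {B : ℝ≥0 → Ω → ℝ} {α β ζ : ℝ → ℝ} {T A : ℝ} {ν : ℝ → ℝ} [IsProbabilityMeasure (terminalLaw ν)]

/-- All payoffs at one starting point are dominated by a single integrable random variable. -/
theorem exists_integrable_abs_payoff_le (hB : ∀ u, Measurable (B u)) (hBM : IsBrownianReal B P)
    (hA : GainBound (gainShift α β ζ T) (gainSlope β ζ T) A) (hν_meas : Measurable ν)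
    (hν_nonneg : ∀ z, 0 ≤ ν z)
    (hexp : ∀ t, Integrable (fun z : ℝ ↦ Real.exp (t * z)) (terminalLaw ν)) (x₀ : ℝ) {s : ℝ}
    (hs : s ∈ Ico (0 : ℝ) 1) (y : ℝ) :
    ∃ D : Ω × ℝ → ℝ, Integrable D (bridgeMeasure P ν x₀ s y) ∧
      ∀ σ, IsAdmissible hB s y σ →
        ∀ᵐ ω ∂bridgeMeasure P ν x₀ s y, ‖payoff α β ζ T B s y σ ω‖ ≤ D ω := by
  obtain ⟨S, hSi, -, hS⟩ := exists_integrable_runningMax hB hBM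
  have := isProbabilityMeasure_pinningLaw hν_meas hν_nonneg hexp x₀ hs y
  refine ⟨fun ω ↦ A * (1 + (|y| + |ω.2| + 2 * S ω.1)), ?_, fun σ hσ ↦ ?_⟩
  · exact ((integrable_const 1).add (((integrable_const |y|).add
      ((integrable_abs_pinningLaw hν_meas hν_nonneg hexp x₀ hs y).comp_snd P)).add
      ((hSi.comp_fst _).const_mul 2))).const_mul A
  · have h : ∀ᵐ ω ∂bridgeMeasure P ν x₀ s y, ∀ u ≤ 1, |B u ω.1| ≤ S ω.1 :=
      Measure.quasiMeasurePreserving_fst.ae hS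
    filter_upwards [h] with ω hω
    exact abs_payoff_le hA hs y hσ hω

/-- Every admissible stopping time is a limit of grid rules, in the sense that the expected payoffs
converge. -/
theorem integrable_payoff_and_exists_tendsto (hB : ∀ u, Measurable (B u))
    (hBM : IsBrownianReal B P) (hA : GainBound (gainShift α β ζ T) (gainSlope β ζ T) A)
    (hν_meas : Measurable ν) (hν_nonneg : ∀ z, 0 ≤ ν z)
    (hexp : ∀ t, Integrable (fun z : ℝ ↦ Real.exp (t * z)) (terminalLaw ν)) (x₀ : ℝ) {l d : ℝ≥0}
    (hl : 0 < l) (hd : 0 < d) {s : ℝ} (hs : s ∈ Ico (0 : ℝ) 1) (hld : (l : ℝ) + d = 1 - s) (y : ℝ)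
    {σ : Ω × ℝ → WithTop ℝ≥0} (hσ : IsAdmissible hB s y σ) :
    Integrable (payoff α β ζ T B s y σ) (bridgeMeasure P ν x₀ s y) ∧
    ∃ τ : ℕ → Canon → ℕ, (∀ n, IsGridRule d (n + 1) (τ n)) ∧
      Filter.Tendsto (fun n ↦ ∫ ω, payoff α β ζ T B s y (ruleTime B l d s y (n + 1) (τ n)) ω
        ∂bridgeMeasure P ν x₀ s y) Filter.atTop
        (nhds (∫ ω, payoff α β ζ T B s y σ ω ∂bridgeMeasure P ν x₀ s y)) := by
  obtain ⟨D, hDi, hD⟩ :=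
    exists_integrable_abs_payoff_le hB hBM hA hν_meas hν_nonneg hexp x₀ hs y
  have hl1 : l ≤ 1 := by
    have : (l : ℝ) ≤ 1 := by linarith [hs.1, d.2]
    exact_mod_cast this
  choose τ hτ hclose using fun n : ℕ ↦
    exists_isGridRule_of_isAdmissible hB hl hl1 hd hld y hσ n.succ_ne_zero
  have hadm (n : ℕ) := (hτ n).isAdmissible hB hl hd hld y
  have hmeas (n : ℕ) : Measurable (payoff α β ζ T B s y (ruleTime B l d s y (n + 1) (τ n))) := by
    rw [funext (payoff_ruleTime α β ζ T hl hd hld y (hτ n))]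
    exact ((hτ n).measurable_canonPayoff _ _ l s y).comp (measurable_canonMap hB l d s y)
  have := isProbabilityMeasure_pinningLaw hν_meas hν_nonneg hexp x₀ hs y
  have hcont : ∀ᵐ ω ∂bridgeMeasure P ν x₀ s y, Continuous (B · ω.1) :=
    Measure.quasiMeasurePreserving_fst.ae hBM.cont
  have hlim : ∀ᵐ ω ∂bridgeMeasure P ν x₀ s y, Filter.Tendsto
      (fun n ↦ payoff α β ζ T B s y (ruleTime B l d s y (n + 1) (τ n)) ω) Filter.atTop
      (nhds (payoff α β ζ T B s y σ ω)) := by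
    filter_upwards [hcont] with ω hω
    have hz : Filter.Tendsto (fun n : ℕ ↦ (1 + d : ℝ) / ((n + 1 : ℕ) : ℝ)) Filter.atTop (nhds 0) :=
      (tendsto_const_div_atTop_nhds_zero_nat _).comp (Filter.tendsto_add_atTop_nat 1)
    have ht : Filter.Tendsto (fun n ↦ (ruleTime B l d s y (n + 1) (τ n) ω).untopA) Filter.atTop
        (nhds (σ ω).untopA) := by
      rw [tendsto_iff_dist_tendsto_zero]
      exact squeeze_zero (fun _ ↦ dist_nonneg) (fun n ↦ hclose n ω) hz
    exact ((continuousOn_gain_bridge hA hs y hω) _ (hσ.untopA_le ω)).tendsto.comp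
      (tendsto_nhdsWithin_iff.2 ⟨ht, .of_forall fun n ↦ (hadm n).untopA_le ω⟩)
  refine ⟨hDi.mono' (aestronglyMeasurable_of_tendsto_ae _
    (fun n ↦ (hmeas n).aestronglyMeasurable) hlim) (hD σ hσ), τ, hτ, ?_⟩
  exact tendsto_integral_of_dominated_convergence D (fun n ↦ (hmeas n).aestronglyMeasurable) hDi
    (fun n ↦ hD _ (hadm n)) hlim

theorem integrable_payoff (hB : ∀ u, Measurable (B u))
    (hBM : IsBrownianReal B P) (hA : GainBound (gainShift α β ζ T) (gainSlope β ζ T) A)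
    (hν_meas : Measurable ν) (hν_nonneg : ∀ z, 0 ≤ ν z)
    (hexp : ∀ t, Integrable (fun z : ℝ ↦ Real.exp (t * z)) (terminalLaw ν)) (x₀ : ℝ) {s : ℝ}
    (hs : s ∈ Ico (0 : ℝ) 1) (y : ℝ) {σ : Ω × ℝ → WithTop ℝ≥0} (hσ : IsAdmissible hB s y σ) :
    Integrable (payoff α β ζ T B s y σ) (bridgeMeasure P ν x₀ s y) := by
  have hs' : 0 < 1 - s := by linarith [hs.2]
  have hd : 0 < ((1 - s) / 2).toNNReal := Real.toNNReal_pos.2 (by linarith)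
  refine (integrable_payoff_and_exists_tendsto hB hBM hA hν_meas hν_nonneg hexp x₀ hd hd hs
    ?_ y hσ).1
  rw [Real.coe_toNNReal _ (by linarith)]
  ring

theorem bddAbove_expectedPayoffs (hB : ∀ u, Measurable (B u))
    (hBM : IsBrownianReal B P) (hA : GainBound (gainShift α β ζ T) (gainSlope β ζ T) A)
    (hν_meas : Measurable ν) (hν_nonneg : ∀ z, 0 ≤ ν z)
    (hexp : ∀ t, Integrable (fun z : ℝ ↦ Real.exp (t * z)) (terminalLaw ν)) (x₀ : ℝ) {s : ℝ}
    (hs : s ∈ Ico (0 : ℝ) 1) (y : ℝ) : BddAbove (expectedPayoffs α β ζ T ν x₀ P hB s y) := by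
  obtain ⟨D, hDi, hD⟩ :=
    exists_integrable_abs_payoff_le hB hBM hA hν_meas hν_nonneg hexp x₀ hs y
  refine ⟨∫ ω, D ω ∂bridgeMeasure P ν x₀ s y, ?_⟩
  rintro _ ⟨σ, hσ, rfl⟩
  exact (Real.le_norm_self _).trans (norm_integral_le_of_norm_le hDi (hD σ hσ))

end Payoff

/-! ### Comparison of the values at two starting points -/

section Comparison

variable {Ω : Type*} [MeasurableSpace Ω] {P : Measure Ω} {B : ℝ≥0 → Ω → ℝ} {α β ζ : ℝ → ℝ}
  {T : ℝ} {ν : ℝ → ℝ}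

theorem expectedPayoffs_nonempty (hB : ∀ u, Measurable (B u)) (x₀ s y : ℝ) :
    (expectedPayoffs α β ζ T ν x₀ P hB s y).Nonempty :=
  ⟨_, fun _ ↦ ((0 : ℝ≥0) : WithTop ℝ≥0),
    ⟨isStoppingTime_const _ 0, fun _ ↦ WithTop.coe_le_coe.2 zero_le⟩, rfl⟩

theorem integral_payoff_ruleTime (hB : ∀ u, Measurable (B u)) (hBM : IsBrownianReal B P)
    [IsProbabilityMeasure (terminalLaw ν)]
    (hν_meas : Measurable ν) (hν_nonneg : ∀ z, 0 ≤ ν z)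
    (hexp : ∀ t, Integrable (fun z : ℝ ↦ Real.exp (t * z)) (terminalLaw ν)) (x₀ : ℝ) {l d : ℝ≥0}
    (hl : 0 < l) (hd : 0 < d) {s : ℝ} (hs : s ∈ Ico (0 : ℝ) 1) (hld : (l : ℝ) + d = 1 - s) (y : ℝ)
    {n : ℕ} {τ : Canon → ℕ} (hτ : IsGridRule d n τ) :
    ∫ ω, payoff α β ζ T B s y (ruleTime B l d s y n τ) ω ∂bridgeMeasure P ν x₀ s y =
      expectedRulePayoff P B ν (gainShift α β ζ T) (gainSlope β ζ T) x₀ l d s y n τ := by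
  rw [funext (payoff_ruleTime α β ζ T hl hd hld y hτ)]
  exact integral_canonMap_eq hB hBM.toIsPreBrownianReal hν_meas hν_nonneg x₀ hl hd hld y
    (integrable_exp_pinExponent hexp x₀ hs y) (hτ.measurable_canonPayoff _ _ l s y)

/-- If no grid rule loses more than `c` when it is transferred from one starting point to another,
then neither does the value. -/
theorem value_le_value_add [IsProbabilityMeasure P]
    [IsProbabilityMeasure (terminalLaw ν)] (hB : ∀ u, Measurable (B u))
    (hBM : IsBrownianReal B P) {A : ℝ} (hA : GainBound (gainShift α β ζ T) (gainSlope β ζ T) A)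
    (hν_meas : Measurable ν) (hν_nonneg : ∀ z, 0 ≤ ν z)
    (hexp : ∀ t, Integrable (fun z : ℝ ↦ Real.exp (t * z)) (terminalLaw ν)) {x₀ : ℝ}
    {d l₁ l₂ : ℝ≥0} {K s₁ s₂ y₁ y₂ c : ℝ} (hd : 0 < d) (hp₁ : IsStart d K l₁ s₁ y₁)
    (hp₂ : IsStart d K l₂ s₂ y₂)
    (hc : ∀ (n : ℕ) (τ : Canon → ℕ), IsGridRule d n τ →
      |expectedRulePayoff P B ν (gainShift α β ζ T) (gainSlope β ζ T) x₀ l₁ d s₁ y₁ n τ -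
        expectedRulePayoff P B ν (gainShift α β ζ T) (gainSlope β ζ T) x₀ l₂ d s₂ y₂ n τ| ≤ c) :
    value α β ζ T ν x₀ P hB s₁ y₁ ≤ value α β ζ T ν x₀ P hB s₂ y₂ + c := by
  refine csSup_le (expectedPayoffs_nonempty hB x₀ s₁ y₁) ?_
  rintro _ ⟨σ, hσ, rfl⟩
  obtain ⟨-, τ, hτ, hlim⟩ := integrable_payoff_and_exists_tendsto hB hBM hA hν_meas hν_nonneg hexp
    x₀ (hd.trans_le hp₁.le) hd hp₁.mem hp₁.eq y₁ hσ
  refine le_of_tendsto hlim (.of_forall fun n ↦ ?_)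
  have hl₂ := hd.trans_le hp₂.le
  have h2 : ∫ ω, payoff α β ζ T B s₂ y₂ (ruleTime B l₂ d s₂ y₂ (n + 1) (τ n)) ω
      ∂bridgeMeasure P ν x₀ s₂ y₂ ≤ value α β ζ T ν x₀ P hB s₂ y₂ :=
    le_csSup (bddAbove_expectedPayoffs hB hBM hA hν_meas hν_nonneg hexp x₀ hp₂.mem y₂)
      ⟨_, (hτ n).isAdmissible hB hl₂ hd hp₂.eq y₂, rfl⟩
  rw [integral_payoff_ruleTime hB hBM hν_meas hν_nonneg hexp x₀ hl₂ hd hp₂.mem hp₂.eq y₂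
    (hτ n)] at h2
  rw [integral_payoff_ruleTime hB hBM hν_meas hν_nonneg hexp x₀ (hd.trans_le hp₁.le) hd hp₁.mem
    hp₁.eq y₁ (hτ n)]
  linarith [(abs_le.1 (hc _ _ (hτ n))).2]

end Comparison

theorem exists_isStart_of_isCompact {R : Set (ℝ × ℝ)} (hR : IsCompact R)
    (hsub : R ⊆ Ico (0 : ℝ) 1 ×ˢ (univ : Set ℝ)) :
    ∃ (d : ℝ≥0) (K : ℝ), 0 < d ∧ d ≤ 1 ∧ 0 ≤ K ∧
      ∀ s y, (s, y) ∈ R → ∃ l, IsStart d K l s y := by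
  rcases R.eq_empty_or_nonempty with rfl | hne
  · exact ⟨1, 0, one_pos, le_rfl, le_rfl, by simp⟩
  obtain ⟨p, hp, hmax⟩ := hR.exists_isMaxOn hne continuous_fst.continuousOn
  obtain ⟨K, hK⟩ := hR.exists_bound_of_continuousOn continuous_snd.continuousOn
  have hp1 := (hsub hp).1
  have hpos : 0 < (1 - p.1) / 2 := by linarith [hp1.2]
  refine ⟨⟨(1 - p.1) / 2, hpos.le⟩, K, hpos, ?_, (norm_nonneg _).trans (hK p hp),
    fun s y h ↦ ?_⟩
  · exact show (1 - p.1) / 2 ≤ 1 by linarith [hp1.1]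
  · have hs : s ≤ p.1 := hmax h
    refine ⟨⟨1 - s - (1 - p.1) / 2, by linarith⟩, ?_, (hsub h).1, ?_, hK _ h⟩
    · exact show (1 - p.1) / 2 ≤ 1 - s - (1 - p.1) / 2 by linarith
    · exact show 1 - s - (1 - p.1) / 2 + (1 - p.1) / 2 = 1 - s by ring

end RandomizedBridge

theorem mainTheorem3 {Ω : Type*} [MeasurableSpace Ω] (P : Measure Ω) [IsProbabilityMeasure P]
    (B : ℝ≥0 → Ω → ℝ) (hB : ∀ u, Measurable (B u)) (hBM : IsBrownianReal B P)
    (T : ℝ) (hT : 0 < T) (α β ζ : ℝ → ℝ)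
    (hα : ContinuousOn α (Icc 0 T)) (hβ : ContinuousOn β (Icc 0 T))
    (hζ : ContinuousOn ζ (Icc 0 T)) (hζ_pos : ∀ t ∈ Icc 0 T, 0 < ζ t)
    (x₀ : ℝ) (ν : ℝ → ℝ) (hν_meas : Measurable ν) (hν_nonneg : ∀ z, 0 ≤ ν z)
    (hν_one : ∫⁻ z, ENNReal.ofReal (ν z) = 1)
    (hν_reg : RandomizedBridge.RegularTerminalDensity ν x₀) :
    (∀ s ∈ Ico (0 : ℝ) 1, ∀ y : ℝ,
      IsProbabilityMeasure (RandomizedBridge.pinningLaw ν x₀ s y) ∧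
      (∀ σ : Ω × ℝ → WithTop ℝ≥0, RandomizedBridge.IsAdmissible hB s y σ →
        Integrable (RandomizedBridge.payoff α β ζ T B s y σ)
          (RandomizedBridge.bridgeMeasure P ν x₀ s y)) ∧
      BddAbove (RandomizedBridge.expectedPayoffs α β ζ T ν x₀ P hB s y)) ∧
    ∀ R : Set (ℝ × ℝ), IsCompact R → R ⊆ Ico (0 : ℝ) 1 ×ˢ (univ : Set ℝ) →
      ∃ L : ℝ, 0 < L ∧ ∀ s₁ y₁ s₂ y₂ : ℝ, (s₁, y₁) ∈ R → (s₂, y₂) ∈ R →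
        |RandomizedBridge.value α β ζ T ν x₀ P hB s₁ y₁
            - RandomizedBridge.value α β ζ T ν x₀ P hB s₂ y₂|
          ≤ L * (|s₁ - s₂| + |y₁ - y₂|) := by
  have := RandomizedBridge.isProbabilityMeasure_terminalLaw hν_one
  have hexp := RandomizedBridge.integrable_exp_mul_terminalLaw hν_meas hν_nonneg hν_one hν_reg
  obtain ⟨A, hA⟩ := RandomizedBridge.exists_gainBound hT hα hβ hζ hζ_pos
  refine ⟨fun s hs y ↦ ⟨?_, fun σ hσ ↦ ?_, ?_⟩, fun R hR hsub ↦ ?_⟩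
  · exact RandomizedBridge.isProbabilityMeasure_pinningLaw hν_meas hν_nonneg hexp x₀ hs y
  · exact RandomizedBridge.integrable_payoff hB hBM hA hν_meas hν_nonneg hexp x₀ hs y hσ
  · exact RandomizedBridge.bddAbove_expectedPayoffs hB hBM hA hν_meas hν_nonneg hexp x₀ hs y
  · obtain ⟨d, K, hd, hd1, hK, hstart⟩ := RandomizedBridge.exists_isStart_of_isCompact hR hsub
    obtain ⟨S, hSi, hS0, hS⟩ := RandomizedBridge.exists_integrable_runningMax hB hBM
    obtain ⟨L, hL0, hL⟩ := RandomizedBridge.exists_lipschitz_expectedRulePayoff hB hSi hS0 hS hexp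
      hA x₀ hd hd1 hK
    refine ⟨L + 1, by linarith, fun s₁ y₁ s₂ y₂ h₁ h₂ ↦ ?_⟩
    obtain ⟨l₁, hp₁⟩ := hstart s₁ y₁ h₁
    obtain ⟨l₂, hp₂⟩ := hstart s₂ y₂ h₂
    have i₁ := RandomizedBridge.value_le_value_add hB hBM hA hν_meas hν_nonneg hexp hd hp₁ hp₂
      (hL l₁ l₂ s₁ s₂ y₁ y₂ hp₁ hp₂)
    have i₂ := RandomizedBridge.value_le_value_add hB hBM hA hν_meas hν_nonneg hexp hd hp₂ hp₁
      (hL l₂ l₁ s₂ s₁ y₂ y₁ hp₂ hp₁)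
    rw [abs_sub_comm s₂, abs_sub_comm y₂] at i₂
    have hδ : 0 ≤ |s₁ - s₂| + |y₁ - y₂| := by positivity
    exact abs_sub_le_iff.2 ⟨by linarith, by linarith⟩
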